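/- **Lemma 4.2 (Backtrack cancellations).** Conventions. A loop $\ell$ in $\mathbb Z^d$ is a closed path $e_1\cdots e_n$ of oriented nearest-neighbour edges (the null loop $\emptyset$ is the empty path); $e^{-1}$ is the reversal of $e$. Let $\mathcal P$ be the set of oriented plaquettes (closed oriented 4-cycles through four distinct vertices, without base point) of $\mathbb Z^d$, and let $K:\mathcal P\to\mathbb N$. The pair $(\ell,K)$ is *balanced* if $n_e=n_{e^{-1}}$ for every oriented edge $e$, where $n_e$ is the number of copies of $e$ in $\ell$ plus $\sum_{p\ni e}K(p)$. For $\ell\neq\emptyset$ and $(\ell,K)$ balanced, $\mathcal{NPM}(\ell,K)$ is the set of pairs $M=(m,\psi)$, up to orientation-preserving homeomorphism respecting $\psi$ and the identification of the boundary with $\ell$ (different edges of $\ell$ being distinguished by their position), such that: (i) $m$ is a finite connected planar map with one external face, whose faces are coloured yellow and blue so that the two sides of each edge have different colours and the external face is yellow; (ii) $\psi$ sends vertices of $m$ to vertices of $\mathbb Z^d$ and adjacent vertices to adjacent vertices, sends each internal yellow face isomorphically to a plaquette, and sends each blue face to a single unoriented edge; (iii) the clockwise boundary of the external face is identified edge by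 edge with $\ell$ via $\psi$, and for each $p\in\mathcal P$ exactly $K(p)$ internal yellow faces have clockwise boundary sent to $p$; (iv) (non-separability) for each unoriented lattice edge, deleting from the dual graph of $m$ (which includes the external face) all blue faces sent to that edge leaves a connected graph. If $(\ell,K)$ is not balanced, $\mathcal{NPM}(\ell,K)=\emptyset$. Put $w_\infty(M)=\prod_{f\text{ blue}}w_{\deg(f)/2}$ with $w_i=(-1)^{i-1}\mathrm{Cat}(i-1)$ and $\mathrm{Cat}(k)=\frac{(2k)!}{k!(k+1)!}$, let $\mathrm{area}(M)$ be the number of internal yellow faces and, for $\beta\in\mathbb R$, put $$\phi^K(\ell)=\sum_{M\in\mathcal{NPM}(\ell,K)}\beta^{\mathrm{area}(M)}w_\infty(M)\quad(\ell\ne\emptyset),\qquad \phi^0(\emptyset)=1,\qquad \phi^K(\emptyset)=0\ \ (K\neq0).$$ Statement. Let $d\ge 0$ be an integer, $\beta\in\mathbb R$, $K:\mathcal P\to\mathbb N$, and let $\ell=\pi_1\,\mathbf e\,\mathbf e^{-1}\,\pi_2$ be a loop with a backtrack $\mathbf e\mathbf e^{-1}$ ($\pi_1,\pi_2$ possibly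 empty paths) such that $(\ell,K)$ is balanced. Then $\mathcal{NPM}(\ell,K)$ and $\mathcal{NPM}(\pi_1\pi_2,K)$ are finite and $$\phi^K(\pi_1\mathbf e\mathbf e^{-1}\pi_2)=\phi^K(\pi_1\pi_2).$$ Moreover, if $\pi_1\pi_2\ne\emptyset$, there is a bijection, preserving area and $w_\infty$, from the set of maps $M\in\mathcal{NPM}(\ell,K)$ in which $\mathbf e$ and $\mathbf e^{-1}$ together bound a blue 2-gon onto $\mathcal{NPM}(\pi_1\pi_2,K)$; and the weights $w_\infty(M)$ of all other maps $M\in\mathcal{NPM}(\ell,K)$ sum to $0$. -/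

import Mathlib

namespace SurfaceSum

noncomputable section

/-! ### The lattice, loops, plaquettes -/

/-- The nearest-neighbour graph on `ℤ^d`. -/
def latticeGraph (d : ℕ) : SimpleGraph (Fin d → ℤ) where
  Adj x y := ∑ i, |x i - y i| = 1
  symm := ⟨fun x y h => by simpa only [abs_sub_comm] using h⟩
  loopless := ⟨fun x h => by simp at h⟩

/-- Oriented lattice edges; `e.symm` is the reversed edge `e⁻¹`. -/
abbrev LatticeEdge (d : ℕ) := (latticeGraph d).Dart

/-- A word of oriented edges is a loop if each edge ends where the (cyclically) next one starts.
The empty word is the null loop. A loop is written as a word, i.e. with a chosen first edge, so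
that its edges (including different copies of the same lattice edge) are told apart by their
position. -/
def IsLoop {d : ℕ} (l : List (LatticeEdge d)) : Prop :=
  (l : Cycle (LatticeEdge d)).Chain (latticeGraph d).DartAdj

/-- An oriented square: a closed oriented cycle of four edges (without a chosen first edge) visiting
four distinct vertices. -/
def IsPlaquette {d : ℕ} (c : Cycle (LatticeEdge d)) : Prop :=
  c.length = 4 ∧ c.Chain (latticeGraph d).DartAdj ∧ (c.map (fun e => e.fst)).Nodup

/-- The oriented plaquettes of `ℤ^d`. -/
def Plaquette (d : ℕ) := {c : Cycle (LatticeEdge d) // IsPlaquette c}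

/-- `n_e(ℓ, K)`: the number of copies of the oriented edge `e` in `ℓ`, plus the sum of `K p` over
the (finitely many) oriented plaquettes `p` that contain `e` with this orientation. -/
def edgeCount {d : ℕ} (l : List (LatticeEdge d)) (K : Plaquette d → ℕ) (e : LatticeEdge d) : ℕ :=
  l.count e + ∑ᶠ p ∈ {p : Plaquette d | e ∈ p.1}, K p

/-- The pair `(ℓ, K)` is balanced. -/
def IsBalanced {d : ℕ} (l : List (LatticeEdge d)) (K : Plaquette d → ℕ) : Prop :=
  ∀ e : LatticeEdge d, edgeCount l K e = edgeCount l K e.symm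

/-! ### Maps on oriented surfaces -/

/-- A combinatorial map: a finite graph properly embedded in a closed oriented surface, up to
orientation-preserving homeomorphism, presented by its darts (oriented edges). `rev` reverses a
dart; `next x` is the dart following `x` on the boundary of the face to the right of `x`, so that
`next` goes clockwise around every face. The start of a dart is a vertex, and `next (rev x)` is a
dart with the same start as `x`. -/
structure CombMap (D : Type) where
  rev : Equiv.Perm D
  next : Equiv.Perm D
  rev_rev : ∀ x, rev (rev x) = x
  rev_ne : ∀ x, rev x ≠ x

namespace CombMap

variable {D : Type} (m : CombMap D)

/-- Vertices: orbits of `next ∘ rev`, the rotation of the darts around their common start. -/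
def Vertex := Quotient (Equiv.Perm.SameCycle.setoid (m.next * m.rev))

/-- Unoriented edges: orbits of `rev`. -/
def Edge := Quotient (Equiv.Perm.SameCycle.setoid m.rev)

/-- Faces: orbits of `next`. -/
def Face := Quotient (Equiv.Perm.SameCycle.setoid m.next)

/-- The face to the right of a dart. -/
def face (x : D) : m.Face := Quotient.mk (Equiv.Perm.SameCycle.setoid m.next) x

/-- The degree of a face: the number of its sides. -/
def degree (f : m.Face) : ℕ := Nat.card {x : D // m.face x = f}

/-- The underlying graph (equivalently, the surface) is connected. -/
def IsConnected : Prop :=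
  ∀ x y : D, ∃ g ∈ Subgroup.closure ({m.rev, m.next} : Set (Equiv.Perm D)), g x = y

/-- The Euler characteristic `V - E + F` of the closed surface (all faces are counted). -/
def eulerChar : ℤ := (Nat.card m.Vertex : ℤ) - Nat.card m.Edge + Nat.card m.Face

/-- The dual graph: one vertex per face, two faces being adjacent if they share an edge. -/
def dual : SimpleGraph m.Face :=
  SimpleGraph.fromRel (fun f g => ∃ x : D, m.face x = f ∧ m.face (m.rev x) = g)

end CombMap

/-! ### Embedded maps with one boundary component -/

/-- A map with one external face, with a yellow/blue colouring of its faces such that the two sides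
of every edge have different colours and the external face is yellow, and with a graph homomorphism
from the map to the lattice `ℤ^d`.

* `yellow` is the set of darts whose right face is yellow;
* `pos x` is the image in `ℤ^d` of the start of the dart `x`;
* `root` is the side of the external face that is identified with the first edge of the boundary
  loop, and the external face is the face of `root` (removing a disk from its interior
  gives the surface with boundary).

As `next` goes clockwise around every face, the yellow darts carry the prior orientation of the
edges of an embedded map: clockwise around yellow faces, counter-clockwise around blue faces. -/
structure MarkedMap (d : ℕ) (D : Type) extends CombMap D where
  yellow : Set D
  yellow_next : ∀ x, next x ∈ yellow ↔ x ∈ yellow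
  yellow_rev : ∀ x, rev x ∈ yellow ↔ x ∉ yellow
  pos : D → Fin d → ℤ
  pos_vertex : ∀ x, pos (next (rev x)) = pos x
  pos_adj : ∀ x, (latticeGraph d).Adj (pos x) (pos (rev x))
  root : D
  root_mem : root ∈ yellow

namespace MarkedMap

variable {d : ℕ} {D : Type} (M : MarkedMap d D)

/-- The oriented lattice edge to which a dart is sent. -/
def edge (x : D) : LatticeEdge d := ⟨(M.pos x, M.pos (M.rev x)), M.pos_adj x⟩

/-- The word of lattice edges read clockwise around the face of `x`, starting from `x`. -/
def faceWord (x : D) : List (LatticeEdge d) :=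
  (List.range (Function.minimalPeriod M.next x)).map (fun i => M.edge (M.next^[i] x))

/-- The external face. -/
def externalFace : M.Face := M.face M.root

/-- `f` is a blue face. -/
def IsBlue (f : M.Face) : Prop := ∃ x, M.face x = f ∧ x ∉ M.yellow

/-- `f` is an internal yellow face (a plaquette face). -/
def IsInternalYellow (f : M.Face) : Prop :=
  f ≠ M.externalFace ∧ ∃ x, M.face x = f ∧ x ∈ M.yellow

/-- The homomorphism sends every internal yellow face isomorphically to a plaquette and every blue
face to a single unoriented edge. -/
def IsLatticeEmbedding : Prop :=
  (∀ x ∈ M.yellow, M.face x ≠ M.externalFace →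
    IsPlaquette (M.faceWord x : Cycle (LatticeEdge d))) ∧
  (∀ x ∉ M.yellow, ∀ y, M.face y = M.face x → (M.edge y).edge = (M.edge x).edge)

/-- The internal yellow face `f` is sent to the oriented plaquette `p`. -/
def IsSentToPlaquette (f : M.Face) (p : Plaquette d) : Prop :=
  M.IsInternalYellow f ∧ ∃ x, M.face x = f ∧ (M.faceWord x : Cycle (LatticeEdge d)) = p.1

/-- The blue face `f` is sent to the unoriented lattice edge `e`. -/
def IsSentToEdge (f : M.Face) (e : Sym2 (Fin d → ℤ)) : Prop :=
  M.IsBlue f ∧ ∃ x, M.face x = f ∧ (M.edge x).edge = e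

/-- Non-separability: for each unoriented lattice edge `e`, removing from the dual graph all blue
faces sent to `e` leaves a connected graph. -/
def IsNonSeparable : Prop :=
  ∀ e ∈ (latticeGraph d).edgeSet, (M.dual.induce {f | ¬ M.IsSentToEdge f e}).Connected

/-- `M` is a non-separable planar embedded map with boundary `l` and plaquette assignment `K`. -/
structure IsNPM (l : List (LatticeEdge d)) (K : Plaquette d → ℕ) : Prop where
  connected : M.IsConnected
  planar : M.eulerChar = 2
  embedding : M.IsLatticeEmbedding
  plaquettes : ∀ p, Nat.card {f : M.Face // M.IsSentToPlaquette f p} = K p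
  boundary : M.faceWord M.root = l
  nonSeparable : M.IsNonSeparable

/-- The number of internal yellow faces. -/
def area : ℕ := Nat.card {f : M.Face // M.IsInternalYellow f}

/-- The blue face on the other side of the boundary edge number `k` (counted from `0`). -/
def blueFaceAt (k : ℕ) : M.Face := M.face (M.rev (M.next^[k] M.root))

/-- The boundary edges number `k` and `k + 1` together form a blue face of degree two. -/
def IsTwoGonAt (k : ℕ) : Prop :=
  M.blueFaceAt k = M.blueFaceAt (k + 1) ∧ M.degree (M.blueFaceAt k) = 2

end MarkedMap

/-- `w_i = (-1)^(i-1) Cat(i-1)`, used for `i ≥ 1` only. -/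
def catalanWeight (i : ℕ) : ℝ := (-1) ^ (i - 1) * (catalan (i - 1) : ℝ)

/-- `w_∞(M)`, the product over the blue faces of `w_{deg/2}`. -/
def MarkedMap.weight {d : ℕ} {D : Type} (M : MarkedMap d D) : ℝ :=
  ∏ᶠ f : {f : M.Face // M.IsBlue f}, catalanWeight (M.degree f.1 / 2)

/-! ### Maps up to isomorphism -/

/-- An isomorphism of marked maps: an orientation-preserving homeomorphism of the surfaces that
respects the graphs, the colours, the maps to the lattice and the labelling of the boundary. -/
structure MarkedMap.Iso {d : ℕ} {D D' : Type} (M : MarkedMap d D) (M' : MarkedMap d D') where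
  toEquiv : D ≃ D'
  map_rev : ∀ x, toEquiv (M.rev x) = M'.rev (toEquiv x)
  map_next : ∀ x, toEquiv (M.next x) = M'.next (toEquiv x)
  map_yellow : ∀ x, toEquiv x ∈ M'.yellow ↔ x ∈ M.yellow
  map_pos : ∀ x, M'.pos (toEquiv x) = M.pos x
  map_root : toEquiv M.root = M'.root

namespace MarkedMap.Iso

variable {d : ℕ} {D D' D'' : Type} {M : MarkedMap d D} {M' : MarkedMap d D'} {M'' : MarkedMap d D''}

def refl (M : MarkedMap d D) : M.Iso M :=
  ⟨Equiv.refl D, fun _ => rfl, fun _ => rfl, fun _ => Iff.rfl, fun _ => rfl, rfl⟩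

def symm (f : M.Iso M') : M'.Iso M where
  toEquiv := f.toEquiv.symm
  map_rev x := by rw [Equiv.symm_apply_eq, f.map_rev, Equiv.apply_symm_apply]
  map_next x := by rw [Equiv.symm_apply_eq, f.map_next, Equiv.apply_symm_apply]
  map_yellow x := by rw [← f.map_yellow, Equiv.apply_symm_apply]
  map_pos x := by rw [← f.map_pos, Equiv.apply_symm_apply]
  map_root := by rw [Equiv.symm_apply_eq, f.map_root]

def trans (f : M.Iso M') (g : M'.Iso M'') : M.Iso M'' where
  toEquiv := f.toEquiv.trans g.toEquiv
  map_rev x := by simp [f.map_rev, g.map_rev]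
  map_next x := by simp [f.map_next, g.map_next]
  map_yellow x := by simp [f.map_yellow, g.map_yellow]
  map_pos x := by simp [f.map_pos, g.map_pos]
  map_root := by simp [f.map_root, g.map_root]

theorem sameCycle_iff (f : M.Iso M') (x y : D) :
    M'.next.SameCycle (f.toEquiv x) (f.toEquiv y) ↔ M.next.SameCycle x y := by
  have h : M'.next = f.toEquiv.permCongrHom M.next := by
    ext x
    simp [Equiv.permCongrHom, Equiv.permCongr_apply, f.map_next]
  have hz : ∀ (n : ℤ) (x : D), (M'.next ^ n) (f.toEquiv x) = f.toEquiv ((M.next ^ n) x) := by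
    intro n x
    rw [h, ← map_zpow]
    simp [Equiv.permCongrHom, Equiv.permCongr_apply]
  constructor
  · rintro ⟨n, hn⟩
    exact ⟨n, f.toEquiv.injective (by rw [← hz, hn])⟩
  · rintro ⟨n, hn⟩
    exact ⟨n, by rw [hz, hn]⟩

/-- The bijection between faces induced by an isomorphism. -/
def faceEquiv (f : M.Iso M') : M.Face ≃ M'.Face :=
  Quotient.congr f.toEquiv (fun x y => (f.sameCycle_iff x y).symm)

theorem faceEquiv_face (f : M.Iso M') (x : D) :
    f.faceEquiv (M.face x) = M'.face (f.toEquiv x) := rfl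

theorem degree_faceEquiv (f : M.Iso M') (F : M.Face) :
    M'.degree (f.faceEquiv F) = M.degree F := by
  refine (Nat.card_congr (f.toEquiv.subtypeEquiv fun x => ?_)).symm
  rw [← f.faceEquiv_face, f.faceEquiv.apply_eq_iff_eq]

theorem isBlue_faceEquiv (f : M.Iso M') (F : M.Face) :
    M'.IsBlue (f.faceEquiv F) ↔ M.IsBlue F := by
  unfold MarkedMap.IsBlue
  rw [← f.toEquiv.exists_congr_right]
  simp only [← f.faceEquiv_face, f.faceEquiv.apply_eq_iff_eq, f.map_yellow]

theorem isInternalYellow_faceEquiv (f : M.Iso M') (F : M.Face) :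
    M'.IsInternalYellow (f.faceEquiv F) ↔ M.IsInternalYellow F := by
  unfold MarkedMap.IsInternalYellow MarkedMap.externalFace
  rw [← f.toEquiv.exists_congr_right, ← f.map_root]
  simp only [← f.faceEquiv_face, f.faceEquiv.apply_eq_iff_eq, f.map_yellow, ne_eq]

theorem area_eq (f : M.Iso M') : M.area = M'.area :=
  Nat.card_congr (f.faceEquiv.subtypeEquiv fun F => (f.isInternalYellow_faceEquiv F).symm)

theorem weight_eq (f : M.Iso M') : M.weight = M'.weight := by
  unfold MarkedMap.weight
  refine finprod_eq_of_bijective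
    (f.faceEquiv.subtypeEquiv fun F => (f.isBlue_faceEquiv F).symm) (Equiv.bijective _) fun F => ?_
  simp [degree_faceEquiv]

end MarkedMap.Iso

/-- Two marked maps with finitely many darts are identified if they are isomorphic. -/
def mapSetoid (d : ℕ) : Setoid (Σ n : ℕ, MarkedMap d (Fin n)) where
  r M M' := Nonempty (M.2.Iso M'.2)
  iseqv := ⟨fun M => ⟨.refl M.2⟩, fun ⟨f⟩ => ⟨f.symm⟩, fun ⟨f⟩ ⟨g⟩ => ⟨f.trans g⟩⟩

/-- Isomorphism classes of (finite) marked maps. -/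
def MapClass (d : ℕ) := Quotient (mapSetoid d)

/-- The area of an isomorphism class. -/
def MapClass.area {d : ℕ} : MapClass d → ℕ :=
  Quotient.lift (fun M => M.2.area) (fun _ _ ⟨f⟩ => f.area_eq)

/-- The weight `w_∞` of an isomorphism class. -/
def MapClass.weight {d : ℕ} : MapClass d → ℝ :=
  Quotient.lift (fun M => M.2.weight) (fun _ _ ⟨f⟩ => f.weight_eq)

/-- The set of non-separable planar embedded maps with boundary `l` and plaquette assignment `K`,
up to isomorphism; empty if `(l, K)` is not balanced. -/
def NPM {d : ℕ} (l : List (LatticeEdge d)) (K : Plaquette d → ℕ) : Set (MapClass d) :=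
  {c | IsBalanced l K ∧
    ∃ M : Σ n : ℕ, MarkedMap d (Fin n), Quotient.mk (mapSetoid d) M = c ∧ M.2.IsNPM l K}

/-- The maps in `NPM l K` in which the boundary edges number `k` and `k + 1` (counted from `0`)
together form a blue 2-gon. -/
def NPMTwoGon {d : ℕ} (l : List (LatticeEdge d)) (K : Plaquette d → ℕ) (k : ℕ) :
    Set (MapClass d) :=
  {c | IsBalanced l K ∧ ∃ M : Σ n : ℕ, MarkedMap d (Fin n),
    Quotient.mk (mapSetoid d) M = c ∧ M.2.IsNPM l K ∧ M.2.IsTwoGonAt k}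

open Classical in
/-- `φ^K(ℓ)`: the sum of `β^area(M) w_∞(M)` over `M ∈ NPM(ℓ, K)` for a non-null loop `ℓ`; for the
null loop it is `1` if `K = 0` and `0` otherwise. -/
def phi {d : ℕ} (β : ℝ) (K : Plaquette d → ℕ) (l : List (LatticeEdge d)) : ℝ :=
  if l = [] then (if K = 0 then 1 else 0)
  else ∑ᶠ c ∈ NPM l K, β ^ c.area * c.weight

end

end SurfaceSum

/-! Consider the tip of the backtrack, the vertex where `e` ends and `e⁻¹` starts. The two blue
corners across these boundary edges are both sent to the unoriented edge of `e`. The proof rests on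
one surgery at the tip (`MarkedMap.swapNext`, applied as `MarkedMap.merge`): exchange the successors
of two blue darts ending there, so that the tip becomes a vertex of degree two, called free.

If the tip is not free already, these two darts lie on different blue faces. On a common face, the
surgery would cut both that face and the tip vertex in two and give Euler characteristic 4; since
the genus is not negative (`ree_inequality`), the result would be disconnected. But the surgery
alters only blue faces over the edge of `e`, and non-separability keeps everything else connected
(`MarkedMap.IsNPM.mergeable`). So the surgery joins two blue faces, of degrees 2a and 2b, into one
of degree 2(a+b) and cuts a vertex in two. The Euler characteristic, the yellow faces, the boundary
and non-separability survive, in both directions (`MarkedMap.Mergeable.isNPM_iff`).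

Now group the maps by their merged map M, whose tip is free and has a blue face of degree 2m. For m
= 1 the group is M alone, with the backtrack bounding a 2-gon. For m ≥ 2 it consists of M and of its
m - 1 splittings into degrees 2(m - i) and 2i. These are pairwise not isomorphic, because a
connected rooted map has no automorphism. The weights of the group are proportional to w_m + ∑
w_{m-i} w_i, which vanishes by the Catalan recursion (`catalanWeight_add_sum`,
`sum_weight_eq_zero`).

What remains are the maps with a 2-gon. As w_1 = 1, the 2-gon can be cut off at its corner of the
external face without changing weight or area, and insertion is the inverse operation
(`exists_equiv`). If `π₁π₂` is null there is nothing to cut it from; the 2-gon is then the whole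
map, which matches the convention for the null loop (`NPMTwoGon_pair`).

Faces and vertices are cycles of permutations, and every surgery multiplies by a transposition,
which joins or cuts cycles. Connectivity and non-separability are handled through sets of darts
closed under the rotations, a form that survives a change of faces. -/

namespace SurfaceSum

open Equiv Equiv.Perm

/-! ### Numbers of cycles -/

section Cycles

variable {α β : Type*}

/-- The equivalence relation obtained from `r` by merging the classes of `a` and `b`. -/
def glue (r : Setoid α) (a b : α) : Setoid α where
  r x y := r x y ∨ ((r x a ∨ r x b) ∧ (r y a ∨ r y b))
  iseqv := by
    refine ⟨fun x => Or.inl (r.refl x), ?_, ?_⟩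
    · rintro x y (h | ⟨h, h'⟩)
      · exact Or.inl (r.symm h)
      · exact Or.inr ⟨h', h⟩
    · rintro x y z (h | ⟨h1, h2⟩) (h' | ⟨h3, h4⟩)
      · exact Or.inl (r.trans h h')
      · exact Or.inr ⟨h3.imp (r.trans h) (r.trans h), h4⟩
      · exact Or.inr ⟨h1, h2.imp (r.trans (r.symm h')) (r.trans (r.symm h'))⟩
      · exact Or.inr ⟨h1, h4⟩

theorem glue_apply {r : Setoid α} {a b x y : α} :
    glue r a b x y ↔ r x y ∨ ((r x a ∨ r x b) ∧ (r y a ∨ r y b)) := Iff.rfl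

theorem le_glue (r : Setoid α) (a b : α) : r ≤ glue r a b := fun _ _ h => Or.inl h

theorem glue_pair (r : Setoid α) (a b : α) : glue r a b a b :=
  Or.inr ⟨Or.inl (r.refl a), Or.inr (r.refl b)⟩

theorem glue_le_iff {r s : Setoid α} {a b : α} : glue r a b ≤ s ↔ r ≤ s ∧ s a b := by
  constructor
  · exact fun h => ⟨(le_glue r a b).trans h, h (glue_pair r a b)⟩
  · rintro ⟨h, hab⟩ x y (hxy | ⟨hx, hy⟩)
    · exact h hxy
    · have key : ∀ z, r z a ∨ r z b → s z a := by
        rintro z (hz | hz)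
        · exact h hz
        · exact s.trans (h hz) (s.symm hab)
      exact s.trans (key x hx) (s.symm (key y hy))

theorem glue_eq_self {r : Setoid α} {a b : α} (h : r a b) : glue r a b = r :=
  le_antisymm (glue_le_iff.2 ⟨le_rfl, h⟩) (le_glue r a b)

theorem sup_glue (r s : Setoid α) (a b : α) : r ⊔ glue s a b = glue (r ⊔ s) a b := by
  apply le_antisymm
  · refine sup_le (le_sup_left.trans (le_glue _ _ _)) (glue_le_iff.2 ⟨?_, glue_pair _ _ _⟩)
    exact le_sup_right.trans (le_glue _ _ _)
  · refine glue_le_iff.2 ⟨sup_le_sup_left (le_glue _ _ _) _, ?_⟩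
    exact (le_sup_right : glue s a b ≤ r ⊔ glue s a b) (glue_pair _ _ _)

/-- The classes of `r` other than that of `b` represent each class of the glued relation exactly
once. -/
theorem card_glue [Finite α] {r : Setoid α} {a b : α} (h : ¬ r a b) :
    Nat.card (Quotient (glue r a b)) + 1 = Nat.card (Quotient r) := by
  classical
  have : Fintype (Quotient r) := Fintype.ofFinite _
  let g : {q : Quotient r // q ≠ Quotient.mk r b} → Quotient (glue r a b) :=
    fun q => Quotient.map' (s₁ := r) (s₂ := glue r a b) id (fun _ _ h => Or.inl h) q.1
  have hg : Function.Bijective g := by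
    constructor
    · rintro ⟨q, hq⟩ ⟨q', hq'⟩ hqq
      induction q using Quotient.inductionOn with | _ x
      induction q' using Quotient.inductionOn with | _ y
      have hx : ¬ r x b := fun hh => hq (Quotient.sound hh)
      have hy : ¬ r y b := fun hh => hq' (Quotient.sound hh)
      have hxy : glue r a b x y := Quotient.exact hqq
      rw [glue_apply] at hxy
      apply Subtype.ext
      apply Quotient.sound
      rcases hxy with hxy | ⟨h1, h2⟩
      · exact hxy
      · exact r.trans (h1.resolve_right hx) (r.symm (h2.resolve_right hy))
    · intro q
      induction q using Quotient.inductionOn with | _ x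
      by_cases hx : r x b
      · refine ⟨⟨Quotient.mk r a, fun hh => h (Quotient.exact hh)⟩, ?_⟩
        exact Quotient.sound (s := glue r a b) (Or.inr ⟨Or.inl (r.refl a), Or.inr hx⟩)
      · exact ⟨⟨Quotient.mk r x, fun hh => hx (Quotient.exact hh)⟩, rfl⟩
  rw [← Nat.card_congr (Equiv.ofBijective g hg), Nat.card_eq_fintype_card, Nat.card_eq_fintype_card,
    Fintype.card_subtype_compl, Fintype.card_subtype_eq]
  exact Nat.sub_add_cancel (Fintype.card_pos_iff.2 ⟨Quotient.mk r b⟩)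

/-- The partition into cycles. -/
abbrev orbits (f : Perm α) : Setoid α := SameCycle.setoid f

/-- The number of cycles, fixed points included. -/
noncomputable def numCycles (f : Perm α) : ℕ := Nat.card (Quotient (orbits f))

theorem orbits_le_iff {f : Perm α} {r : Setoid α} : orbits f ≤ r ↔ ∀ x, r x (f x) := by
  constructor
  · exact fun h x => h (show f.SameCycle x (f x) from (sameCycle_apply_right.2 (SameCycle.refl f x)))
  · rintro h x y ⟨n, rfl⟩
    induction n with
    | zero => exact r.refl x
    | succ n ih => rw [add_comm, zpow_add, zpow_one]; exact r.trans ih (h _)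
    | pred n ih =>
      refine r.trans ih (r.symm ?_)
      have := h ((f ^ (-(n : ℤ) - 1)) x)
      rwa [← Perm.mul_apply, ← zpow_one_add, add_sub_cancel] at this

theorem sameCycle_induction {f : Perm α} {p : α → Prop} (h : ∀ x, p (f x) ↔ p x) {x y : α}
    (hxy : f.SameCycle x y) : p x ↔ p y := by
  have : orbits f ≤ Setoid.comap p ⟨(· ↔ ·), ⟨Iff.refl, Iff.symm, Iff.trans⟩⟩ :=
    orbits_le_iff.2 fun x => (h x).symm
  exact this hxy

/-- On a finite set every element of a cycle is reached by non-negative powers, so preservation in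
one direction is enough. -/
theorem sameCycle_forward [Finite α] {f : Perm α} {p : α → Prop} (h : ∀ x, p x → p (f x)) {x y : α}
    (hxy : f.SameCycle x y) : p x → p y := by
  intro hx
  obtain ⟨n, -, rfl⟩ := hxy.exists_pow_eq'
  clear hxy
  induction n with
  | zero => simpa using hx
  | succ n ih => rw [pow_succ', Perm.mul_apply]; exact h _ ih

/-- A transposition of elements of two different cycles joins these cycles, because the product
leaves `a` into the cycle of `b` and leaves `b` into the cycle of `a`. -/
theorem orbits_mul_swap [Finite α] [DecidableEq α] {f : Perm α} {a b : α} (h : ¬ f.SameCycle a b) :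
    orbits (f * swap a b) = glue (orbits f) a b := by
  have hab : (f * swap a b).SameCycle a b := by
    by_contra hn
    -- Walk from `f b`, the image of `a` under the product, along the old cycle of `b`. It never
    -- meets `a`, and by assumption the new cycle of `a` never meets `b`, so the product keeps
    -- acting as `f`; yet the walk must end at `b`.
    have key : ∀ x, (f.SameCycle b x ∧ (f * swap a b).SameCycle a x) →
        (f.SameCycle b (f x) ∧ (f * swap a b).SameCycle a (f x)) := by
      rintro x ⟨h1, h2⟩
      refine ⟨sameCycle_apply_right.2 h1, ?_⟩
      have hxa : x ≠ a := by rintro rfl; exact h h1.symm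
      have hxb : x ≠ b := by rintro rfl; exact hn h2
      have : (f * swap a b) x = f x := by
        rw [Perm.mul_apply, swap_apply_of_ne_of_ne hxa hxb]
      rw [← this]
      exact sameCycle_apply_right.2 h2
    have h0 : f.SameCycle b (f b) ∧ (f * swap a b).SameCycle a (f b) := by
      refine ⟨sameCycle_apply_right.2 (SameCycle.refl f b), ?_⟩
      have : (f * swap a b) a = f b := by simp
      rw [← this]
      exact sameCycle_apply_right.2 (SameCycle.refl _ a)
    exact hn (sameCycle_forward key (sameCycle_apply_left.2 (SameCycle.refl f b)) h0).2
  apply le_antisymm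
  · rw [orbits_le_iff]
    intro x
    rw [Perm.mul_apply]
    by_cases hxa : x = a
    · subst hxa
      rw [swap_apply_left]
      exact Or.inr ⟨Or.inl (SameCycle.refl f _), Or.inr (sameCycle_apply_left.2 (SameCycle.refl f b))⟩
    by_cases hxb : x = b
    · subst hxb
      rw [swap_apply_right]
      exact Or.inr ⟨Or.inr (SameCycle.refl f _), Or.inl (sameCycle_apply_left.2 (SameCycle.refl f a))⟩
    rw [swap_apply_of_ne_of_ne hxa hxb]
    exact Or.inl (sameCycle_apply_right.2 (SameCycle.refl f x))
  · refine glue_le_iff.2 ⟨orbits_le_iff.2 fun x => ?_, hab⟩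
    change (f * swap a b).SameCycle x (f x)
    by_cases hxa : x = a
    · subst hxa
      have : (f * swap x b) b = f x := by simp
      rw [← this]
      exact sameCycle_apply_right.2 hab
    by_cases hxb : x = b
    · subst hxb
      have : (f * swap a x) a = f x := by simp
      rw [← this]
      exact sameCycle_apply_right.2 hab.symm
    have : (f * swap a b) x = f x := by
      rw [Perm.mul_apply, swap_apply_of_ne_of_ne hxa hxb]
    rw [← this]
    exact sameCycle_apply_right.2 (SameCycle.refl _ x)

theorem numCycles_mul_swap [Finite α] [DecidableEq α] {f : Perm α} {a b : α} (h : ¬ f.SameCycle a b) :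
    numCycles (f * swap a b) + 1 = numCycles f := by
  rw [numCycles, orbits_mul_swap h]
  exact card_glue h

/-- The product sends `f^[k] a` back to `f a` and acts as `f` in between, so the arc from `f a` to
`f^[k] a` closes up. The element `a` itself stays in the other part, and the arc has exactly `k`
elements. -/
theorem sameCycle_mul_swap_iterate [Finite α] [DecidableEq α] {f : Perm α} {a : α} {k : ℕ} (hk : 0 < k)
    (hka : k < Function.minimalPeriod f a) (y : α) :
    (f * swap a (f^[k] a)).SameCycle (f^[k] a) y ↔ ∃ j, 1 ≤ j ∧ j ≤ k ∧ f^[j] a = y := by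
  set g := f * swap a (f^[k] a) with hg
  have hinj : ∀ i j, i < Function.minimalPeriod f a → j < Function.minimalPeriod f a →
      f^[i] a = f^[j] a → i = j := fun i j hi hj h =>
    (Function.iterate_eq_iterate_iff_of_lt_minimalPeriod hi hj).1 h
  have hlast : g (f^[k] a) = f a := by simp [hg]
  have hmid : ∀ j, 1 ≤ j → j < k → g (f^[j] a) = f^[j + 1] a := by
    intro j hj1 hjk
    rw [hg, Perm.mul_apply, swap_apply_of_ne_of_ne, Function.iterate_succ_apply']
    · intro hh
      have := hinj j 0 (by omega) (by omega) hh
      omega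
    · intro hh
      have := hinj j k (by omega) (by omega) hh
      omega
  constructor
  · intro h
    refine sameCycle_forward (p := fun y => ∃ j, 1 ≤ j ∧ j ≤ k ∧ f^[j] a = y) ?_ h
      ⟨k, hk, le_rfl, rfl⟩
    rintro x ⟨j, hj1, hjk, rfl⟩
    rcases hjk.eq_or_lt with rfl | hlt
    · exact ⟨1, le_rfl, hj1, by rw [hlast]; rfl⟩
    · exact ⟨j + 1, by omega, by omega, (hmid j hj1 hlt).symm⟩
  · rintro ⟨j, hj1, hjk, rfl⟩
    induction j, hj1 using Nat.le_induction with
    | base =>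
      have : f^[1] a = g (f^[k] a) := by rw [hlast]; rfl
      rw [this]
      exact sameCycle_apply_right.2 (SameCycle.refl _ _)
    | succ j hj1 ih =>
      rw [← hmid j hj1 (by omega)]
      exact sameCycle_apply_right.2 (ih (by omega))

theorem sameCycle_iff_iterate [Finite α] {f : Perm α} {a b : α} :
    f.SameCycle a b ↔ ∃ k, k < Function.minimalPeriod f a ∧ f^[k] a = b := by
  constructor
  · intro h
    obtain ⟨n, -, hn⟩ := h.exists_pow_eq'
    have hp : 0 < Function.minimalPeriod f a :=
      Function.minimalPeriod_pos_of_mem_periodicPts (f.injective.mem_periodicPts a)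
    refine ⟨n % Function.minimalPeriod f a, Nat.mod_lt _ hp, ?_⟩
    rw [Function.iterate_mod_minimalPeriod_eq, ← hn, Perm.iterate_eq_pow]
  · rintro ⟨k, -, rfl⟩
    rw [Perm.iterate_eq_pow]
    exact ⟨k, by simp⟩

theorem not_sameCycle_mul_swap [Finite α] [DecidableEq α] {f : Perm α} {a b : α} (h : f.SameCycle a b)
    (hab : a ≠ b) : ¬ (f * swap a b).SameCycle a b := by
  obtain ⟨k, hk, rfl⟩ := sameCycle_iff_iterate.1 h
  have hk0 : 0 < k := Nat.pos_of_ne_zero (by rintro rfl; exact hab rfl)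
  intro h'
  obtain ⟨j, hj1, hjk, hj⟩ := (sameCycle_mul_swap_iterate hk0 hk a).1 h'.symm
  have := (Function.iterate_eq_iterate_iff_of_lt_minimalPeriod (f := f) (x := a) (m := j) (n := 0)
    (by omega) (by omega)).1 hj
  omega

theorem numCycles_mul_swap_of_sameCycle [Finite α] [DecidableEq α] {f : Perm α} {a b : α} (h : f.SameCycle a b)
    (hab : a ≠ b) : numCycles (f * swap a b) = numCycles f + 1 := by
  rw [← numCycles_mul_swap (not_sameCycle_mul_swap h hab)]
  simp [mul_assoc]

theorem numCycles_le [Finite α] (f : Perm α) : numCycles f ≤ Nat.card α :=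
  Nat.card_le_card_of_surjective _ Quotient.mk_surjective

theorem numCycles_one [Finite α] : numCycles (1 : Perm α) = Nat.card α := by
  refine (Nat.card_congr (Equiv.ofBijective _ ⟨?_, Quotient.mk_surjective⟩)).symm
  intro x y h
  exact sameCycle_one.1 (Quotient.exact h)

theorem orbits_one : orbits (1 : Perm α) = ⊥ := by
  ext x y
  exact sameCycle_one

/-- Ree's inequality, which says that the genus of a surface is not negative. -/
theorem ree_inequality [Finite α] (σ τ : Perm α) :
    numCycles (σ * τ) + numCycles σ + numCycles τ ≤
      2 * Nat.card (Quotient (orbits σ ⊔ orbits τ)) + Nat.card α := by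
  classical
  -- Split a transposition off `τ`: this raises its number of cycles by one, up to the identity,
  -- where equality holds.
  induction hn : Nat.card α - numCycles τ using Nat.strong_induction_on generalizing τ with
  | _ n ih =>
  by_cases hτ : τ = 1
  · subst hτ
    rw [orbits_one, sup_bot_eq, mul_one, numCycles_one]
    unfold numCycles
    omega
  · obtain ⟨a, ha⟩ : ∃ a, τ a ≠ a := by
      by_contra! h
      exact hτ (Equiv.ext h)
    set b := τ a with hb
    have hab : τ.SameCycle a b := sameCycle_apply_right.2 (SameCycle.refl τ a)
    set τ' := τ * swap a b with hτ'
    have h1 : ¬ τ'.SameCycle a b := not_sameCycle_mul_swap hab ha.symm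
    have h2 : numCycles τ' = numCycles τ + 1 := numCycles_mul_swap_of_sameCycle hab ha.symm
    have h3 : τ = τ' * swap a b := by simp [hτ', mul_assoc]
    have h4 := numCycles_le τ'
    have h5 := ih _ (by omega) τ' rfl
    have h6 : σ * τ = (σ * τ') * swap a b := by rw [mul_assoc, ← h3]
    have h7 : orbits σ ⊔ orbits τ = glue (orbits σ ⊔ orbits τ') a b := by
      rw [h3, orbits_mul_swap h1, sup_glue]
    rw [h7]
    -- If `a` and `b` are already in one joint orbit, passing from `τ'` to `τ` costs `τ` one cycle
    -- and gains `σ * τ` at most one. Otherwise a joint orbit disappears, the right side drops by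
    -- two, and `σ * τ` and `τ` lose one cycle each.
    by_cases h8 : (orbits σ ⊔ orbits τ') a b
    · rw [glue_eq_self h8]
      have h9 : numCycles (σ * τ) ≤ numCycles (σ * τ') + 1 := by
        rw [h6]
        by_cases h10 : (σ * τ').SameCycle a b
        · exact (numCycles_mul_swap_of_sameCycle h10 ha.symm).le
        · have := numCycles_mul_swap h10
          omega
      omega
    · have h9 := card_glue h8
      have h10 : ¬ (σ * τ').SameCycle a b := by
        intro h
        apply h8
        have : orbits (σ * τ') ≤ orbits σ ⊔ orbits τ' := by
          rw [orbits_le_iff]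
          intro x
          rw [Perm.mul_apply]
          refine (orbits σ ⊔ orbits τ').trans (b := τ' x) ?_ ?_
          · exact (le_sup_right : orbits τ' ≤ _) (sameCycle_apply_right.2 (SameCycle.refl τ' x))
          · exact (le_sup_left : orbits σ ≤ _) (sameCycle_apply_right.2 (SameCycle.refl σ _))
        exact this h
      have h11 := numCycles_mul_swap h10
      rw [← h6] at h11
      omega

theorem numCycles_sumCongr [Finite α] [Finite β] (f : Perm α) (g : Perm β) :
    numCycles (Perm.sumCongr f g) = numCycles f + numCycles g := by
  have hl : ∀ (n : ℤ) x, (Perm.sumCongr f g ^ n) (Sum.inl x) = Sum.inl ((f ^ n) x) := by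
    intro n x
    have : (Perm.sumCongr f g) ^ n = Perm.sumCongr (f ^ n) (g ^ n) :=
      (map_zpow (Perm.sumCongrHom α β) (f, g) n).symm
    rw [this]; rfl
  have hr : ∀ (n : ℤ) x, (Perm.sumCongr f g ^ n) (Sum.inr x) = Sum.inr ((g ^ n) x) := by
    intro n x
    have : (Perm.sumCongr f g) ^ n = Perm.sumCongr (f ^ n) (g ^ n) :=
      (map_zpow (Perm.sumCongrHom α β) (f, g) n).symm
    rw [this]; rfl
  unfold numCycles
  rw [← Nat.card_sum]
  let φ : Quotient (orbits f) ⊕ Quotient (orbits g) → Quotient (orbits (Perm.sumCongr f g)) :=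
    Sum.elim
      (Quotient.map' (s₁ := orbits f) (s₂ := orbits (Perm.sumCongr f g)) Sum.inl
        (by rintro x y ⟨n, rfl⟩; exact ⟨n, hl n x⟩))
      (Quotient.map' (s₁ := orbits g) (s₂ := orbits (Perm.sumCongr f g)) Sum.inr
        (by rintro x y ⟨n, rfl⟩; exact ⟨n, hr n x⟩))
  refine (Nat.card_congr (Equiv.ofBijective φ ⟨?_, ?_⟩)).symm
  · rintro (q | q) (q' | q') h <;>
    induction q using Quotient.inductionOn with | _ x <;>
    induction q' using Quotient.inductionOn with | _ y <;>
    obtain ⟨n, hn⟩ : (Perm.sumCongr f g).SameCycle _ _ := Quotient.exact h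
    · rw [hl] at hn
      exact congrArg Sum.inl (Quotient.sound ⟨n, Sum.inl.inj hn⟩)
    · rw [hl] at hn
      cases hn
    · rw [hr] at hn
      cases hn
    · rw [hr] at hn
      exact congrArg Sum.inr (Quotient.sound ⟨n, Sum.inr.inj hn⟩)
  · intro q
    induction q using Quotient.inductionOn with | _ x
    rcases x with x | x
    · exact ⟨Sum.inl (Quotient.mk _ x), rfl⟩
    · exact ⟨Sum.inr (Quotient.mk _ x), rfl⟩

theorem numCycles_permCongr (e : α ≃ β) {f : Perm α} {g : Perm β} (h : ∀ x, e (f x) = g (e x)) :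
    numCycles f = numCycles g := by
  have h1 : orbits f ≤ Setoid.comap e (orbits g) := orbits_le_iff.2 fun x => by
    rw [Setoid.comap_rel, h]
    exact sameCycle_apply_right.2 (SameCycle.refl g _)
  have h2 : orbits g ≤ Setoid.comap e.symm (orbits f) := orbits_le_iff.2 fun x => by
    obtain ⟨x, rfl⟩ := e.surjective x
    rw [Setoid.comap_rel, ← h, e.symm_apply_apply, e.symm_apply_apply]
    exact sameCycle_apply_right.2 (SameCycle.refl f _)
  exact Nat.card_congr (Quotient.congr e fun x y => ⟨fun hh => h1 hh, fun hh => by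
    have := h2 hh
    rwa [Setoid.comap_rel, e.symm_apply_apply, e.symm_apply_apply] at this⟩)

end Cycles

/-! ### Basic properties of marked maps -/

namespace CombMap

variable {D : Type} (m : CombMap D)

theorem face_eq_iff {x y : D} : m.face x = m.face y ↔ m.next.SameCycle x y :=
  ⟨fun h => Quotient.exact h, fun h => Quotient.sound h⟩

theorem face_next (x : D) : m.face (m.next x) = m.face x :=
  (m.face_eq_iff).2 (sameCycle_apply_left.2 (SameCycle.refl _ x))

theorem face_iterate (x : D) (k : ℕ) : m.face (m.next^[k] x) = m.face x := by
  induction k with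
  | zero => rfl
  | succ k ih => rw [Function.iterate_succ_apply', face_next, ih]

theorem exists_face (f : m.Face) : ∃ x, m.face x = f := Quotient.exists_rep f

theorem rev_mul_rev : m.rev * m.rev = 1 := Equiv.ext m.rev_rev

theorem sameCycle_rev_iff {x y : D} : m.rev.SameCycle x y ↔ x = y ∨ m.rev x = y := by
  constructor
  · intro h
    have := sameCycle_induction (p := fun z => x = z ∨ m.rev x = z) (f := m.rev) (fun z => by
      constructor
      · rintro (rfl | h)
        · exact Or.inr (m.rev_rev z)
        · exact Or.inl (m.rev.injective h)
      · rintro (rfl | rfl)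
        · exact Or.inr rfl
        · exact Or.inl (m.rev_rev x).symm) h
    exact this.1 (Or.inl rfl)
  · rintro (rfl | rfl)
    · exact SameCycle.refl _ _
    · exact sameCycle_apply_right.2 (SameCycle.refl _ _)

theorem eulerChar_eq :
    m.eulerChar = (numCycles (m.next * m.rev) : ℤ) - numCycles m.rev + numCycles m.next := rfl

/-- The orbit of a dart under the generated group is itself an invariant set. Unlike the group,
invariant sets are easily compared between maps whose rotations differ at only two darts. -/
theorem isConnected_iff : m.IsConnected ↔ ∀ T : Set D, (∀ x, m.rev x ∈ T ↔ x ∈ T) →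
    (∀ x, m.next x ∈ T ↔ x ∈ T) → ∀ x y, x ∈ T → y ∈ T := by
  constructor
  · intro h T hr hn x y hx
    obtain ⟨g, hg, rfl⟩ := h x y
    have : ∀ z, g z ∈ T ↔ z ∈ T := by
      induction hg using Subgroup.closure_induction with
      | mem g hg =>
        rcases hg with rfl | rfl
        · exact hr
        · exact hn
      | one => exact fun z => Iff.rfl
      | mul g g' _ _ h1 h2 => exact fun z => (h1 _).trans (h2 z)
      | inv g _ h1 =>
        intro z
        rw [← h1 (g⁻¹ z)]
        simp
    exact (this x).2 hx
  · intro h x y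
    have h1 : m.rev ∈ Subgroup.closure ({m.rev, m.next} : Set (Perm D)) :=
      Subgroup.subset_closure (by simp)
    have h2 : m.next ∈ Subgroup.closure ({m.rev, m.next} : Set (Perm D)) :=
      Subgroup.subset_closure (by simp)
    have key : ∀ p ∈ Subgroup.closure ({m.rev, m.next} : Set (Perm D)), ∀ z,
        p z ∈ {y | ∃ g ∈ Subgroup.closure ({m.rev, m.next} : Set (Perm D)), g x = y} ↔
        z ∈ {y | ∃ g ∈ Subgroup.closure ({m.rev, m.next} : Set (Perm D)), g x = y} := by
      intro p hp z
      constructor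
      · rintro ⟨g, hg, hgx⟩
        exact ⟨p⁻¹ * g, mul_mem (inv_mem hp) hg, by rw [Perm.mul_apply, hgx]; simp⟩
      · rintro ⟨g, hg, rfl⟩
        exact ⟨p * g, mul_mem hp hg, rfl⟩
    exact h {y | ∃ g ∈ Subgroup.closure ({m.rev, m.next} : Set (Perm D)), g x = y}
      (key _ h1) (key _ h2) x y ⟨1, one_mem _, rfl⟩

variable [Finite D]

theorem minimalPeriod_pos (x : D) : 0 < Function.minimalPeriod m.next x :=
  Function.minimalPeriod_pos_of_mem_periodicPts (m.next.injective.mem_periodicPts x)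

theorem degree_face (x : D) : m.degree (m.face x) = Function.minimalPeriod m.next x := by
  unfold degree
  rw [← Nat.card_fin (Function.minimalPeriod m.next x)]
  let g : Fin (Function.minimalPeriod m.next x) → {y : D // m.face y = m.face x} :=
    fun i => ⟨m.next^[i] x, m.face_iterate x i⟩
  refine (Nat.card_congr (Equiv.ofBijective g ⟨?_, ?_⟩)).symm
  · intro i j hij
    exact Fin.ext ((Function.iterate_eq_iterate_iff_of_lt_minimalPeriod i.2 j.2).1
      (congrArg Subtype.val hij))
  · rintro ⟨y, hy⟩
    obtain ⟨k, hk, rfl⟩ := sameCycle_iff_iterate.1 (m.face_eq_iff.1 hy.symm)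
    exact ⟨⟨k, hk⟩, rfl⟩

end CombMap

namespace MarkedMap

variable {d : ℕ} {D : Type} (M : MarkedMap d D)

theorem pos_next (x : D) : M.pos (M.next x) = M.pos (M.rev x) := by
  have := M.pos_vertex (M.rev x)
  rwa [M.rev_rev] at this

theorem edge_rev (x : D) : M.edge (M.rev x) = (M.edge x).symm := by
  apply SimpleGraph.Dart.ext
  simp [edge, SimpleGraph.Dart.symm, M.rev_rev]

theorem edge_fst (x : D) : (M.edge x).fst = M.pos x := rfl

theorem edge_snd (x : D) : (M.edge x).snd = M.pos (M.rev x) := rfl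

theorem pos_rev_ne (x : D) : M.pos x ≠ M.pos (M.rev x) := (M.pos_adj x).ne

theorem rev_notMem {x : D} (h : x ∈ M.yellow) : M.rev x ∉ M.yellow :=
  fun h' => (M.yellow_rev x).1 h' h

theorem rev_mem {x : D} (h : x ∉ M.yellow) : M.rev x ∈ M.yellow := (M.yellow_rev x).2 h

theorem yellow_sameCycle {x y : D} (h : M.next.SameCycle x y) : x ∈ M.yellow ↔ y ∈ M.yellow :=
  sameCycle_induction (p := (· ∈ M.yellow)) M.yellow_next h

theorem yellow_face {x y : D} (h : M.face x = M.face y) : x ∈ M.yellow ↔ y ∈ M.yellow :=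
  M.yellow_sameCycle (M.face_eq_iff.1 h)

theorem yellow_iterate (x : D) (k : ℕ) : M.next^[k] x ∈ M.yellow ↔ x ∈ M.yellow :=
  M.yellow_face (M.face_iterate x k)

theorem isBlue_face {x : D} : M.IsBlue (M.face x) ↔ x ∉ M.yellow := by
  constructor
  · rintro ⟨y, hy, hy'⟩
    rwa [← M.yellow_face hy]
  · exact fun h => ⟨x, rfl, h⟩

theorem isInternalYellow_face {x : D} :
    M.IsInternalYellow (M.face x) ↔ M.face x ≠ M.externalFace ∧ x ∈ M.yellow := by
  refine and_congr_right fun _ => ⟨?_, fun h => ⟨x, rfl, h⟩⟩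
  rintro ⟨y, hy, hy'⟩
  rwa [← M.yellow_face hy]

theorem numCycles_rev : numCycles M.rev = Nat.card M.yellow := by
  refine (Nat.card_congr (Equiv.ofBijective
    (fun x : M.yellow => (Quotient.mk (orbits M.rev) x.1)) ⟨?_, ?_⟩)).symm
  · rintro ⟨x, hx⟩ ⟨y, hy⟩ h
    rcases M.sameCycle_rev_iff.1 (Quotient.exact h) with h | h
    · exact Subtype.ext h
    · change M.rev x = y at h
      exact absurd (h ▸ hy) (M.rev_notMem hx)
  · intro q
    induction q using Quotient.inductionOn with | _ x
    by_cases hx : x ∈ M.yellow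
    · exact ⟨⟨x, hx⟩, rfl⟩
    · exact ⟨⟨M.rev x, M.rev_mem hx⟩, Quotient.sound (M.sameCycle_rev_iff.2 (Or.inr (M.rev_rev x)))⟩

theorem card_darts [Finite D] : Nat.card D = 2 * Nat.card M.yellow := by
  have h1 : Nat.card M.yellow = Nat.card ↥(M.yellow)ᶜ := by
    refine Nat.card_congr ⟨fun x => ⟨M.rev x.1, M.rev_notMem x.2⟩,
      fun x => ⟨M.rev x.1, M.rev_mem x.2⟩, ?_, ?_⟩
    · rintro ⟨x, hx⟩
      simp [M.rev_rev]
    · rintro ⟨x, hx⟩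
      simp [M.rev_rev]
  have h2 := Set.ncard_add_ncard_compl M.yellow
  rw [← Nat.card_coe_set_eq, ← Nat.card_coe_set_eq, ← h1] at h2
  omega

/-- In Ree's inequality for `next` and `rev` connectedness leaves one joint orbit. Each edge has
exactly one yellow side, so the number of darts is 2E and V + E + F ≤ 2 + 2E. -/
theorem eulerChar_le_two [Finite D] (h : M.IsConnected) : M.eulerChar ≤ 2 := by
  have h1 := ree_inequality M.next M.rev
  have h2 : Nat.card (Quotient (orbits M.next ⊔ orbits M.rev)) ≤ 1 := by
    refine Finite.card_le_one_iff_subsingleton.2 ⟨fun p q => ?_⟩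
    induction p using Quotient.inductionOn with | _ x
    induction q using Quotient.inductionOn with | _ y
    apply Quotient.sound
    set r := orbits M.next ⊔ orbits M.rev with hr
    have hn : ∀ z, r z (M.next z) := fun z =>
      (le_sup_left : orbits M.next ≤ r) (sameCycle_apply_right.2 (SameCycle.refl _ z))
    have hv : ∀ z, r z (M.rev z) := fun z =>
      (le_sup_right : orbits M.rev ≤ r) (sameCycle_apply_right.2 (SameCycle.refl _ z))
    refine M.isConnected_iff.1 h {z | r x z} ?_ ?_ x y (r.refl x)
    · exact fun z => ⟨fun hz => r.trans hz (r.symm (hv z)), fun hz => r.trans hz (hv z)⟩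
    · exact fun z => ⟨fun hz => r.trans hz (r.symm (hn z)), fun hz => r.trans hz (hn z)⟩
  have h3 := M.card_darts
  have h4 := M.numCycles_rev
  rw [M.eulerChar_eq]
  omega

theorem faceWord_length (x : D) : (M.faceWord x).length = Function.minimalPeriod M.next x := by
  simp [faceWord]

theorem faceWord_getElem (x : D) (i : ℕ) (h : i < (M.faceWord x).length) :
    (M.faceWord x)[i] = M.edge (M.next^[i] x) := by
  simp [faceWord]

theorem edge_edge_eq_iff {x y : D} :
    (M.edge x).edge = (M.edge y).edge ↔ M.edge x = M.edge y ∨ M.edge x = (M.edge y).symm :=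
  SimpleGraph.dart_edge_eq_iff _ _

theorem edge_rev_edge (x : D) : (M.edge (M.rev x)).edge = (M.edge x).edge := by
  rw [edge_rev, SimpleGraph.Dart.edge_symm]

/-- Blue faces are sent to single unoriented edges. -/
def BlueCollapse : Prop :=
  ∀ x ∉ M.yellow, ∀ y, M.face y = M.face x → (M.edge y).edge = (M.edge x).edge

variable {M}

theorem BlueCollapse.edge_next (h : M.BlueCollapse) {x : D} (hx : x ∉ M.yellow) :
    M.edge (M.next x) = (M.edge x).symm := by
  rcases M.edge_edge_eq_iff.1 (h x hx (M.next x) (M.face_next x)) with h1 | h1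
  · have : M.pos (M.next x) = M.pos x := congrArg (fun e : LatticeEdge d => e.fst) h1
    rw [M.pos_next] at this
    exact absurd this.symm (M.pos_rev_ne x)
  · exact h1

theorem BlueCollapse.edge_iterate (h : M.BlueCollapse) {x : D} (hx : x ∉ M.yellow) (k : ℕ) :
    M.edge (M.next^[k] x) = if Even k then M.edge x else (M.edge x).symm := by
  induction k with
  | zero => simp
  | succ k ih =>
    rw [Function.iterate_succ_apply', h.edge_next (by rwa [M.yellow_iterate]), ih]
    by_cases hk : Even k
    · simp [hk, Nat.even_add_one]
    · simp [hk, Nat.even_add_one]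

/-- Consecutive darts of a blue face cross its lattice edge in opposite directions, and a full turn
returns to the original orientation. -/
theorem BlueCollapse.even_degree [Finite D] (h : M.BlueCollapse) {x : D} (hx : x ∉ M.yellow) :
    Even (M.degree (M.face x)) := by
  rw [M.degree_face]
  have := h.edge_iterate hx (Function.minimalPeriod M.next x)
  rw [Function.iterate_minimalPeriod] at this
  by_contra hn
  rw [if_neg hn] at this
  exact SimpleGraph.Dart.symm_ne _ this.symm

theorem degree_pos [Finite D] (f : M.Face) : 0 < M.degree f := by
  obtain ⟨x, rfl⟩ := M.exists_face f
  rw [M.degree_face]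
  exact M.minimalPeriod_pos x

variable (M) in
/-- The dart `x` survives the removal of the blue faces sent to `e`. -/
def Live (e : Sym2 (Fin d → ℤ)) (x : D) : Prop := x ∈ M.yellow ∨ (M.edge x).edge ≠ e

theorem BlueCollapse.live_iff (h : M.BlueCollapse) {e : Sym2 (Fin d → ℤ)} {x : D} :
    M.Live e x ↔ ¬ M.IsSentToEdge (M.face x) e := by
  unfold Live IsSentToEdge
  rw [M.isBlue_face]
  constructor
  · rintro (hx | hx) ⟨h1, y, hy, hy'⟩
    · exact h1 hx
    · exact hx ((h x h1 y hy).symm.trans hy')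
  · intro hx
    by_contra! hc
    exact hx ⟨hc.1, x, rfl, hc.2⟩

theorem live_of_yellow {e : Sym2 (Fin d → ℤ)} {x : D} (h : x ∈ M.yellow) : M.Live e x := Or.inl h

theorem BlueCollapse.live_face (h : M.BlueCollapse) {e : Sym2 (Fin d → ℤ)} {x y : D}
    (hxy : M.face x = M.face y) : M.Live e x ↔ M.Live e y := by
  rw [h.live_iff, h.live_iff, hxy]

theorem mem_of_face_eq {T : Set D} {P : D → Prop} (hP : ∀ x, P (M.next x) ↔ P x)
    (hT : ∀ x, P x → (M.next x ∈ T ↔ x ∈ T)) {x y : D} (hxy : M.face x = M.face y) (hx : P x) :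
    x ∈ T ↔ y ∈ T := by
  have := sameCycle_induction (f := M.next) (p := fun z => P z ∧ z ∈ T)
    (fun z => ⟨fun hz => ⟨(hP z).1 hz.1, (hT z ((hP z).1 hz.1)).1 hz.2⟩,
      fun hz => ⟨(hP z).2 hz.1, (hT z hz.1).2 hz.2⟩⟩) (M.face_eq_iff.1 hxy)
  have hy : P y := (sameCycle_induction (p := P) hP (M.face_eq_iff.1 hxy)).1 hx
  simpa [hx, hy] using this

/-- A union of components of the reduced dual graph is the same as a set of live darts closed under
`next` and under those reversals that join two live darts. The right side makes sense without faces,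
so it can be carried through surgeries that change them. -/
theorem BlueCollapse.isNonSeparable_iff (h : M.BlueCollapse) : M.IsNonSeparable ↔
    ∀ e ∈ (latticeGraph d).edgeSet, ∀ T : Set D, (∀ x, M.Live e x → (M.next x ∈ T ↔ x ∈ T)) →
      (∀ x, M.Live e x → M.Live e (M.rev x) → (M.rev x ∈ T ↔ x ∈ T)) →
      ∀ x y, M.Live e x → M.Live e y → x ∈ T → y ∈ T := by
  refine forall₂_congr fun e _ => ⟨?_, ?_⟩
  · intro hc T hn hr x y hx hy hxT
    have hnl : ∀ x, M.Live e (M.next x) ↔ M.Live e x := fun x => h.live_face (M.face_next x)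
    have key : ∀ f g : {f | ¬ M.IsSentToEdge f e}, Relation.ReflTransGen
        (M.dual.induce {f | ¬ M.IsSentToEdge f e}).Adj f g →
        (∀ x, M.face x = f.1 → x ∈ T) → (∀ x, M.face x = g.1 → x ∈ T) := by
      intro f g hfg hf
      induction hfg with
      | refl => exact hf
      | tail _ hadj ih =>
        rename_i g1 g2 _
        have hl1 : ∀ z, M.face z = g1.1 → M.Live e z := fun z hz => h.live_iff.2 (hz ▸ g1.2)
        have hl2 : ∀ z, M.face z = g2.1 → M.Live e z := fun z hz => h.live_iff.2 (hz ▸ g2.2)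
        obtain ⟨-, ⟨z, hz1, hz2⟩ | ⟨z, hz1, hz2⟩⟩ := hadj
        · intro w hw
          rw [← mem_of_face_eq hnl hn (hz2.trans hw.symm) (hl2 _ hz2)]
          exact (hr z (hl1 _ hz1) (hl2 _ hz2)).2 (ih z hz1)
        · intro w hw
          rw [← mem_of_face_eq hnl hn (hz1.trans hw.symm) (hl2 _ hz1)]
          exact (hr z (hl2 _ hz1) (hl1 _ hz2)).1 (ih _ hz2)
    have hreach := hc.preconnected ⟨M.face x, h.live_iff.1 hx⟩ ⟨M.face y, h.live_iff.1 hy⟩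
    rw [SimpleGraph.reachable_iff_reflTransGen] at hreach
    exact key _ _ hreach (fun z hz => (mem_of_face_eq hnl hn hz.symm hx).1 hxT) y rfl
  · intro hT
    have hroot : M.Live e M.root := live_of_yellow M.root_mem
    rw [SimpleGraph.connected_iff_exists_forall_reachable]
    refine ⟨⟨M.face M.root, h.live_iff.1 hroot⟩, ?_⟩
    rintro ⟨f, hf⟩
    obtain ⟨y, rfl⟩ := M.exists_face f
    have hy : M.Live e y := h.live_iff.2 hf
    -- The darts whose face can be reached from the external face, which is yellow and therefore
    -- never removed.
    have := hT {z | ∃ hz : ¬ M.IsSentToEdge (M.face z) e,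
      (M.dual.induce {f | ¬ M.IsSentToEdge f e}).Reachable ⟨M.face M.root, h.live_iff.1 hroot⟩
        ⟨M.face z, hz⟩} ?_ ?_ M.root y hroot hy ⟨h.live_iff.1 hroot, SimpleGraph.Reachable.refl _⟩
    · exact this.2
    · intro x _
      simp only [Set.mem_ofPred_eq, M.face_next]
    · intro x hx hrx
      have hadj : M.face x = M.face (M.rev x) ∨
          (M.dual.induce {f | ¬ M.IsSentToEdge f e}).Adj ⟨M.face x, h.live_iff.1 hx⟩
            ⟨M.face (M.rev x), h.live_iff.1 hrx⟩ := by
        by_cases hf : M.face x = M.face (M.rev x)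
        · exact Or.inl hf
        · exact Or.inr ⟨hf, Or.inl ⟨x, rfl, rfl⟩⟩
      simp only [Set.mem_ofPred_eq]
      rcases hadj with hf | hadj
      · simp only [← hf]
      · exact ⟨fun ⟨_, h2⟩ => ⟨h.live_iff.1 hx, h2.trans hadj.symm.reachable⟩,
          fun ⟨_, h2⟩ => ⟨h.live_iff.1 hrx, h2.trans hadj.reachable⟩⟩

end MarkedMap

/-! ### Comparison of faces -/

namespace MarkedMap

variable {d : ℕ} {D D' : Type} {M : MarkedMap d D} {N : MarkedMap d D'}

section Transfer

variable {φ : D → D'}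

/-- A face around which `φ` commutes with `next` is mapped bijectively onto a face. -/
theorem sameCycle_of_commute [Finite D'] {x : D}
    (hφ : ∀ y, M.next.SameCycle x y → N.next (φ y) = φ (M.next y)) {z : D'}
    (h : N.next.SameCycle (φ x) z) : ∃ y, M.next.SameCycle x y ∧ φ y = z := by
  refine sameCycle_forward (p := fun z => ∃ y, M.next.SameCycle x y ∧ φ y = z) ?_ h
    ⟨x, SameCycle.refl _ x, rfl⟩
  rintro _ ⟨y, hy, rfl⟩
  exact ⟨M.next y, sameCycle_apply_right.2 hy, (hφ y hy).symm⟩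

theorem iterate_of_commute {x : D}
    (hφ : ∀ y, M.next.SameCycle x y → N.next (φ y) = φ (M.next y)) (k : ℕ) :
    N.next^[k] (φ x) = φ (M.next^[k] x) := by
  induction k with
  | zero => rfl
  | succ k ih =>
    rw [Function.iterate_succ_apply', Function.iterate_succ_apply', ih]
    exact hφ _ (M.face_eq_iff.1 (M.face_iterate x k).symm)

theorem minimalPeriod_of_commute (hinj : Function.Injective φ) {x : D}
    (hφ : ∀ y, M.next.SameCycle x y → N.next (φ y) = φ (M.next y)) :
    Function.minimalPeriod N.next (φ x) = Function.minimalPeriod M.next x := by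
  rw [Function.minimalPeriod_eq_minimalPeriod_iff]
  intro n
  unfold Function.IsPeriodicPt Function.IsFixedPt
  rw [iterate_of_commute hφ, hinj.eq_iff]

theorem faceWord_of_commute (hinj : Function.Injective φ) {x : D}
    (hφ : ∀ y, M.next.SameCycle x y → N.next (φ y) = φ (M.next y))
    (he : ∀ y, N.edge (φ y) = M.edge y) : N.faceWord (φ x) = M.faceWord x := by
  unfold faceWord
  rw [minimalPeriod_of_commute hinj hφ]
  refine List.map_congr_left fun k _ => ?_
  rw [iterate_of_commute hφ, he]

/-- The map between the sets of faces. -/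
def faceMap (h : ∀ x, N.next.SameCycle (φ x) (φ (M.next x))) : M.Face → N.Face :=
  Quotient.map' (s₁ := orbits M.next) (s₂ := orbits N.next) φ
    (fun _ _ hxy => (orbits_le_iff (r := Setoid.comap φ (orbits N.next))).2 h hxy)

theorem faceMap_face (h : ∀ x, N.next.SameCycle (φ x) (φ (M.next x))) (x : D) :
    faceMap h (M.face x) = N.face (φ x) := rfl

theorem face_inj_of_commute [Finite D'] (hinj : Function.Injective φ) {x y : D}
    (hφ : ∀ y, M.next.SameCycle x y → N.next (φ y) = φ (M.next y))
    (h : N.face (φ x) = N.face (φ y)) : M.face x = M.face y := by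
  obtain ⟨w, hw, hwy⟩ := sameCycle_of_commute hφ (N.face_eq_iff.1 h)
  rw [← hinj hwy]
  exact M.face_eq_iff.2 hw

theorem degree_of_commute [Finite D] [Finite D'] (hinj : Function.Injective φ) {x : D}
    (hφ : ∀ y, M.next.SameCycle x y → N.next (φ y) = φ (M.next y)) :
    N.degree (N.face (φ x)) = M.degree (M.face x) := by
  rw [N.degree_face, M.degree_face, minimalPeriod_of_commute hinj hφ]

end Transfer

/-- `N` contains the map `M`, and both have the same internal yellow faces. -/
structure SameYellow (M : MarkedMap d D) (N : MarkedMap d D') (φ : D → D') : Prop where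
  inj : Function.Injective φ
  rev : ∀ x, N.rev (φ x) = φ (M.rev x)
  yellow : ∀ x, φ x ∈ N.yellow ↔ x ∈ M.yellow
  pos : ∀ x, N.pos (φ x) = M.pos x
  sameCycle : ∀ x, N.next.SameCycle (φ x) (φ (M.next x))
  next_internal : ∀ x ∈ M.yellow, M.face x ≠ M.externalFace → N.next (φ x) = φ (M.next x)
  external : ∀ x, N.face (φ x) = N.externalFace ↔ M.face x = M.externalFace
  surj : ∀ y ∈ N.yellow, N.face y ≠ N.externalFace → ∃ x, φ x = y

namespace SameYellow

variable {φ : D → D'} (h : SameYellow M N φ)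

include h

theorem edge (x : D) : N.edge (φ x) = M.edge x := by
  apply SimpleGraph.Dart.ext
  apply Prod.ext
  · exact h.pos x
  · change N.pos (N.rev (φ x)) = M.pos (M.rev x)
    rw [h.rev, h.pos]

theorem commute {x : D} (hx : x ∈ M.yellow) (hx' : M.face x ≠ M.externalFace) :
    ∀ y, M.next.SameCycle x y → N.next (φ y) = φ (M.next y) := by
  intro y hy
  refine h.next_internal y ((M.yellow_sameCycle hy).1 hx) ?_
  rwa [← M.face_eq_iff.2 hy]

theorem faceWord {x : D} (hx : x ∈ M.yellow) (hx' : M.face x ≠ M.externalFace) :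
    N.faceWord (φ x) = M.faceWord x :=
  faceWord_of_commute h.inj (h.commute hx hx') h.edge

theorem yellow_embedding_iff :
    (∀ x ∈ N.yellow, N.face x ≠ N.externalFace →
      IsPlaquette (N.faceWord x : Cycle (LatticeEdge d))) ↔
    (∀ x ∈ M.yellow, M.face x ≠ M.externalFace →
      IsPlaquette (M.faceWord x : Cycle (LatticeEdge d))) := by
  constructor
  · intro hN x hx hx'
    rw [← h.faceWord hx hx']
    exact hN (φ x) ((h.yellow x).2 hx) (fun hh => hx' ((h.external x).1 hh))
  · intro hM y hy hy'
    obtain ⟨x, rfl⟩ := h.surj y hy hy'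
    rw [h.yellow] at hy
    rw [ne_eq, h.external] at hy'
    rw [h.faceWord hy hy']
    exact hM x hy hy'

theorem isInternalYellow (f : M.Face) :
    N.IsInternalYellow (faceMap h.sameCycle f) ↔ M.IsInternalYellow f := by
  obtain ⟨x, rfl⟩ := M.exists_face f
  rw [faceMap_face, isInternalYellow_face, isInternalYellow_face, h.yellow, ne_eq, h.external]

variable [Finite D']

theorem bijOn : Set.BijOn (faceMap h.sameCycle) {f | M.IsInternalYellow f}
    {f | N.IsInternalYellow f} := by
  refine ⟨fun f hf => (h.isInternalYellow f).2 hf, ?_, ?_⟩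
  · intro f hf g hg hfg
    obtain ⟨x, rfl⟩ := M.exists_face f
    obtain ⟨y, rfl⟩ := M.exists_face g
    have hf' := M.isInternalYellow_face.1 hf
    exact face_inj_of_commute h.inj (h.commute hf'.2 hf'.1) hfg
  · intro g hg
    obtain ⟨y, rfl⟩ := N.exists_face g
    have hg' := N.isInternalYellow_face.1 hg
    obtain ⟨x, rfl⟩ := h.surj y hg'.2 hg'.1
    exact ⟨M.face x, (h.isInternalYellow (M.face x)).1 hg, rfl⟩

theorem area_eq : N.area = M.area :=
  (Nat.card_congr (h.bijOn.equiv _)).symm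

theorem isSentToPlaquette (f : M.Face) (p : Plaquette d) :
    N.IsSentToPlaquette (faceMap h.sameCycle f) p ↔ M.IsSentToPlaquette f p := by
  unfold IsSentToPlaquette
  rw [h.isInternalYellow]
  refine and_congr_right fun hf => ?_
  constructor
  · rintro ⟨y, hy, hyp⟩
    obtain ⟨x, rfl⟩ := M.exists_face f
    have hf' := M.isInternalYellow_face.1 hf
    obtain ⟨w, hw, rfl⟩ := sameCycle_of_commute (h.commute hf'.2 hf'.1) (N.face_eq_iff.1 hy.symm)
    refine ⟨w, (M.face_eq_iff.2 hw).symm, ?_⟩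
    rw [← hyp, h.faceWord ((M.yellow_sameCycle hw).1 hf'.2)]
    rw [← M.face_eq_iff.2 hw]
    exact hf'.1
  · rintro ⟨x, rfl, hx⟩
    have hf' := M.isInternalYellow_face.1 hf
    exact ⟨φ x, rfl, by rw [h.faceWord hf'.2 hf'.1, hx]⟩

theorem card_plaquettes (p : Plaquette d) :
    Nat.card {f : N.Face // N.IsSentToPlaquette f p} =
      Nat.card {f : M.Face // M.IsSentToPlaquette f p} := by
  have : Set.BijOn (faceMap h.sameCycle) {f | M.IsSentToPlaquette f p}
      {f | N.IsSentToPlaquette f p} := by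
    refine ⟨fun f hf => (h.isSentToPlaquette f p).2 hf, ?_, ?_⟩
    · exact h.bijOn.injOn.mono fun f hf => hf.1
    · intro g hg
      obtain ⟨f, -, rfl⟩ := h.bijOn.surjOn hg.1
      exact ⟨f, (h.isSentToPlaquette f p).1 hg, rfl⟩
  exact (Nat.card_congr (this.equiv _)).symm

end SameYellow

/-! ### Isomorphisms -/

namespace Iso

variable (f : M.Iso N)

include f

theorem sameYellow : SameYellow M N f.toEquiv where
  inj := f.toEquiv.injective
  rev x := (f.map_rev x).symm
  yellow := f.map_yellow
  pos := f.map_pos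
  sameCycle x := by
    rw [f.sameCycle_iff]
    exact sameCycle_apply_right.2 (SameCycle.refl _ x)
  next_internal x _ _ := (f.map_next x).symm
  external x := by
    unfold externalFace
    rw [← f.map_root, N.face_eq_iff, f.sameCycle_iff, M.face_eq_iff]
  surj y _ _ := f.toEquiv.surjective y

theorem edge (x : D) : N.edge (f.toEquiv x) = M.edge x := f.sameYellow.edge x

theorem map_next_iterate (x : D) (k : ℕ) : f.toEquiv (M.next^[k] x) = N.next^[k] (f.toEquiv x) :=
  (iterate_of_commute (fun y _ => (f.map_next y).symm) k).symm

theorem map_next_symm (x : D) : f.toEquiv (M.next.symm x) = N.next.symm (f.toEquiv x) := by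
  rw [Equiv.eq_symm_apply, ← f.map_next, Equiv.apply_symm_apply]

/-- Rigidity of rooted maps: the darts at which two isomorphisms agree form an invariant set that
contains the root. -/
theorem ext_of_connected (g : M.Iso N) (h : M.IsConnected) : f.toEquiv = g.toEquiv := by
  refine Equiv.ext fun x => ?_
  refine M.isConnected_iff.1 h {x | f.toEquiv x = g.toEquiv x} ?_ ?_ M.root x ?_
  · intro x
    simp [f.map_rev, g.map_rev]
  · intro x
    simp [f.map_next, g.map_next]
  · exact f.map_root.trans g.map_root.symm

theorem isConnected (h : M.IsConnected) : N.IsConnected := by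
  rw [CombMap.isConnected_iff] at h ⊢
  intro T hr hn x y hx
  obtain ⟨x, rfl⟩ := f.toEquiv.surjective x
  obtain ⟨y, rfl⟩ := f.toEquiv.surjective y
  refine h (f.toEquiv ⁻¹' T) ?_ ?_ x y hx
  · intro z
    simp only [Set.mem_preimage, f.map_rev, hr]
  · intro z
    simp only [Set.mem_preimage, f.map_next, hn]

theorem eulerChar_eq : M.eulerChar = N.eulerChar := by
  rw [CombMap.eulerChar_eq, CombMap.eulerChar_eq, numCycles_permCongr f.toEquiv f.map_rev,
    numCycles_permCongr f.toEquiv f.map_next,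
    numCycles_permCongr (f := M.next * M.rev) (g := N.next * N.rev) f.toEquiv]
  intro x
  simp [f.map_rev, f.map_next]

theorem face_eq_iff (x y : D) : N.face (f.toEquiv x) = N.face (f.toEquiv y) ↔
    M.face x = M.face y := by
  rw [N.face_eq_iff, M.face_eq_iff, f.sameCycle_iff]

theorem blueCollapse (h : M.BlueCollapse) : N.BlueCollapse := by
  intro x hx y hy
  obtain ⟨x, rfl⟩ := f.toEquiv.surjective x
  obtain ⟨y, rfl⟩ := f.toEquiv.surjective y
  rw [f.edge, f.edge]
  rw [f.map_yellow] at hx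
  exact h x hx y ((f.face_eq_iff _ _).1 hy)

theorem live (e : Sym2 (Fin d → ℤ)) (x : D) : N.Live e (f.toEquiv x) ↔ M.Live e x := by
  unfold Live
  rw [f.map_yellow, f.edge]

theorem isNonSeparable (hM : M.BlueCollapse) (h : M.IsNonSeparable) : N.IsNonSeparable := by
  rw [(f.blueCollapse hM).isNonSeparable_iff]
  rw [hM.isNonSeparable_iff] at h
  intro e he T hn hr x y hx hy hxT
  obtain ⟨x, rfl⟩ := f.toEquiv.surjective x
  obtain ⟨y, rfl⟩ := f.toEquiv.surjective y
  refine h e he (f.toEquiv ⁻¹' T) ?_ ?_ x y ((f.live e x).1 hx) ((f.live e y).1 hy) hxT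
  · intro z hz
    simp only [Set.mem_preimage, f.map_next]
    exact hn _ ((f.live e z).2 hz)
  · intro z hz hz'
    simp only [Set.mem_preimage, f.map_rev]
    refine hr _ ((f.live e z).2 hz) ?_
    rw [← f.map_rev]
    exact (f.live e _).2 hz'

theorem faceWord_eq (x : D) : N.faceWord (f.toEquiv x) = M.faceWord x :=
  faceWord_of_commute f.toEquiv.injective (fun y _ => (f.map_next y).symm) f.edge

theorem isNPM [Finite D'] {l : List (LatticeEdge d)} {K : Plaquette d → ℕ} (h : M.IsNPM l K) :
    N.IsNPM l K where
  connected := f.isConnected h.connected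
  planar := by rw [← f.eulerChar_eq, h.planar]
  embedding := ⟨f.sameYellow.yellow_embedding_iff.2 h.embedding.1, f.blueCollapse h.embedding.2⟩
  plaquettes p := by rw [f.sameYellow.card_plaquettes, h.plaquettes]
  boundary := by rw [← f.map_root, f.faceWord_eq, h.boundary]
  nonSeparable := f.isNonSeparable h.embedding.2 h.nonSeparable

theorem blueFaceAt (k : ℕ) : N.blueFaceAt k = f.faceEquiv (M.blueFaceAt k) := by
  unfold MarkedMap.blueFaceAt
  rw [f.faceEquiv_face, f.map_rev, f.map_next_iterate, f.map_root]

theorem isTwoGonAt {k : ℕ} (h : M.IsTwoGonAt k) : N.IsTwoGonAt k := by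
  unfold IsTwoGonAt at h ⊢
  rw [f.blueFaceAt, f.blueFaceAt, f.degree_faceEquiv, h.1]
  exact ⟨rfl, by rw [← h.1, h.2]⟩

end Iso

end MarkedMap

/-! ### Merging and splitting blue faces -/

namespace MarkedMap

variable {d : ℕ} {D D' : Type}

open Classical in
/-- Exchange the successors of two blue darts that end at the same lattice point. -/
noncomputable def swapNext (M : MarkedMap d D) (a b : D) (ha : a ∉ M.yellow) (hb : b ∉ M.yellow)
    (hpos : M.pos (M.rev a) = M.pos (M.rev b)) : MarkedMap d D where
  rev := M.rev
  next := M.next * swap a b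
  rev_rev := M.rev_rev
  rev_ne := M.rev_ne
  yellow := M.yellow
  yellow_next x := by
    rw [Perm.mul_apply, M.yellow_next]
    by_cases hxa : x = a
    · subst hxa; simp [ha, hb]
    by_cases hxb : x = b
    · subst hxb; simp [ha, hb]
    rw [swap_apply_of_ne_of_ne hxa hxb]
  yellow_rev := M.yellow_rev
  pos := M.pos
  pos_vertex x := by
    rw [Perm.mul_apply, M.pos_next]
    by_cases hxa : M.rev x = a
    · rw [hxa, swap_apply_left, ← hpos, ← hxa, M.rev_rev]
    by_cases hxb : M.rev x = b
    · rw [hxb, swap_apply_right, hpos, ← hxb, M.rev_rev]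
    rw [swap_apply_of_ne_of_ne hxa hxb, M.rev_rev]
  pos_adj := M.pos_adj
  root := M.root
  root_mem := M.root_mem

section

variable (M : MarkedMap d D) {a b : D} (ha : a ∉ M.yellow) (hb : b ∉ M.yellow)
    (hpos : M.pos (M.rev a) = M.pos (M.rev b))

theorem swapNext_next_left : (M.swapNext a b ha hb hpos).next a = M.next b := by
  simp [swapNext]

theorem swapNext_next_right : (M.swapNext a b ha hb hpos).next b = M.next a := by
  simp [swapNext]

theorem swapNext_next_of_ne {x : D} (hxa : x ≠ a) (hxb : x ≠ b) :
    (M.swapNext a b ha hb hpos).next x = M.next x := by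
  classical
  simp [swapNext, swap_apply_of_ne_of_ne hxa hxb]

theorem swapNext_next_yellow {x : D} (hx : x ∈ M.yellow) :
    (M.swapNext a b ha hb hpos).next x = M.next x :=
  M.swapNext_next_of_ne ha hb hpos (by rintro rfl; exact ha hx) (by rintro rfl; exact hb hx)

/-- Merging and splitting are one and the same involution, which is why each undoes the other. -/
theorem swapNext_swapNext :
    (M.swapNext a b ha hb hpos).swapNext a b ha hb hpos = M := by
  obtain ⟨⟨rev, next, _, _⟩, _⟩ := M
  simp [swapNext, mul_assoc]

-- Conjugation by `rev` turns the transposition of `a` and `b` into that of `rev a` and `rev b`. The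
-- surgery therefore acts on vertices as on faces, joining or cutting them at the common end of `a`
-- and `b`.
open Classical in
theorem swapNext_vertex : (M.swapNext a b ha hb hpos).next * (M.swapNext a b ha hb hpos).rev =
    M.next * M.rev * swap (M.rev a) (M.rev b) := by
  have h : M.rev * swap (M.rev a) (M.rev b) = swap a b * M.rev := by
    have hinv : M.rev⁻¹ = M.rev := inv_eq_of_mul_eq_one_left M.rev_mul_rev
    rw [Equiv.swap_apply_apply, hinv, mul_assoc, ← mul_assoc, M.rev_mul_rev, one_mul]
  rw [mul_assoc, h, ← mul_assoc]
  rfl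

theorem swapNext_face_yellow {x : D} (hx : x ∈ M.yellow) (y : D) :
    M.next.SameCycle x y → (M.swapNext a b ha hb hpos).next y = M.next y :=
  fun hy => M.swapNext_next_yellow ha hb hpos ((M.yellow_sameCycle hy).1 hx)

theorem swapNext_faceWord_yellow {x : D} (hx : x ∈ M.yellow) :
    (M.swapNext a b ha hb hpos).faceWord x = M.faceWord x :=
  faceWord_of_commute (φ := id) Function.injective_id (M.swapNext_face_yellow ha hb hpos hx)
    (fun _ => rfl)

theorem swapNext_iterate_yellow {x : D} (hx : x ∈ M.yellow) (k : ℕ) :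
    (M.swapNext a b ha hb hpos).next^[k] x = M.next^[k] x :=
  iterate_of_commute (N := M.swapNext a b ha hb hpos) (φ := id)
    (M.swapNext_face_yellow ha hb hpos hx) k

variable {M} in
/-- The exchange of successors is compatible with isomorphisms. -/
noncomputable def swapNextIso {N : MarkedMap d D'} (f : M.Iso N) {a' b' : D'}
    (haa : f.toEquiv a = a') (hbb : f.toEquiv b = b') (ha' : a' ∉ N.yellow) (hb' : b' ∉ N.yellow)
    (hpos' : N.pos (N.rev a') = N.pos (N.rev b')) :
    (M.swapNext a b ha hb hpos).Iso (N.swapNext a' b' ha' hb' hpos') where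
  toEquiv := f.toEquiv
  map_rev := f.map_rev
  map_next x := by
    subst haa hbb
    by_cases hxa : x = a
    · subst hxa; rw [swapNext_next_left, swapNext_next_left, f.map_next]
    by_cases hxb : x = b
    · subst hxb; rw [swapNext_next_right, swapNext_next_right, f.map_next]
    rw [swapNext_next_of_ne _ _ _ _ hxa hxb, swapNext_next_of_ne, f.map_next]
    · exact fun h => hxa (f.toEquiv.injective h)
    · exact fun h => hxb (f.toEquiv.injective h)
  map_yellow := f.map_yellow
  map_pos := f.map_pos
  map_root := f.map_root

end

/-- The blue faces of `a` and `b` are different, are sent to the same edge, touch each other at the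
end of `a` and `b`, and are both adjacent to some yellow face. -/
structure Mergeable (M : MarkedMap d D) (a b : D) : Prop where
  left : a ∉ M.yellow
  right : b ∉ M.yellow
  pos : M.pos (M.rev a) = M.pos (M.rev b)
  ne : ¬ M.next.SameCycle a b
  vertex : (M.next * M.rev).SameCycle (M.rev a) (M.rev b)
  edge : (M.edge a).edge = (M.edge b).edge
  adj : ∃ y ∈ M.yellow, ∃ y', M.face y = M.face y' ∧ M.face (M.rev y) = M.face a ∧
    M.face (M.rev y') = M.face b

namespace Mergeable

variable {M : MarkedMap d D} {a b : D} (h : M.Mergeable a b)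

/-- The map in which the two faces are merged. -/
noncomputable abbrev merged : MarkedMap d D := M.swapNext a b h.left h.right h.pos

include h

theorem rev_ne : M.rev a ≠ M.rev b := fun hh => h.ne (M.rev.injective hh ▸ SameCycle.refl _ a)

variable [Finite D]

theorem orbits_merged : orbits h.merged.next = glue (orbits M.next) a b := by
  classical
  exact orbits_mul_swap h.ne

theorem face_merged_iff {x y : D} : h.merged.face x = h.merged.face y ↔ M.face x = M.face y ∨
    ((M.face x = M.face a ∨ M.face x = M.face b) ∧ (M.face y = M.face a ∨ M.face y = M.face b)) := by
  simp only [CombMap.face_eq_iff]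
  change orbits h.merged.next x y ↔ _
  rw [h.orbits_merged]
  rfl

theorem face_merged_of_face {x y : D} (hxy : M.face x = M.face y) :
    h.merged.face x = h.merged.face y := h.face_merged_iff.2 (Or.inl hxy)

omit [Finite D] in
theorem commute {x : D} (hxa : M.face x ≠ M.face a) (hxb : M.face x ≠ M.face b) :
    ∀ y, M.next.SameCycle x y → h.merged.next y = M.next y := by
  intro y hy
  have := M.face_eq_iff.2 hy
  refine M.swapNext_next_of_ne _ _ _ ?_ ?_
  · rintro rfl; exact hxa this
  · rintro rfl; exact hxb this

theorem sameYellow : SameYellow M h.merged id where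
  inj := Function.injective_id
  rev _ := rfl
  yellow _ := Iff.rfl
  pos _ := rfl
  sameCycle x := h.merged.face_eq_iff.1 (h.face_merged_of_face (M.face_next x).symm)
  next_internal x hx _ := M.swapNext_next_yellow _ _ _ hx
  external x := by
    change h.merged.face x = h.merged.face M.root ↔ M.face x = M.face M.root
    rw [h.face_merged_iff]
    refine ⟨?_, Or.inl⟩
    rintro (hx | ⟨-, hx | hx⟩)
    · exact hx
    · exact absurd ((M.yellow_face hx).1 M.root_mem) h.left
    · exact absurd ((M.yellow_face hx).1 M.root_mem) h.right
  surj y _ _ := ⟨y, rfl⟩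

/-- Two faces become one, while the vertex at which they touch is cut in two; the edges are
unchanged. -/
theorem eulerChar_merged : h.merged.eulerChar = M.eulerChar := by
  classical
  have h1 : numCycles h.merged.next + 1 = numCycles M.next := by
    exact numCycles_mul_swap h.ne
  have h2 : numCycles (h.merged.next * h.merged.rev) = numCycles (M.next * M.rev) + 1 := by
    rw [swapNext_vertex]
    exact numCycles_mul_swap_of_sameCycle h.vertex h.rev_ne
  rw [CombMap.eulerChar_eq, CombMap.eulerChar_eq, h2, ← h1]
  change _ - (numCycles M.rev : ℤ) + _ = _
  push_cast
  ring

-- The two rotations differ only by exchanging their values at `a` and `b`, which is invisible to a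
-- set that does not separate `a` from `b`. The predicate `P` is trivial for connectivity and is
-- liveness for non-separability.
omit [Finite D] in
theorem closed_iff {P : D → Prop} {T : Set D} (hab : P a ↔ P b) (hT : P a → (a ∈ T ↔ b ∈ T)) :
    (∀ x, P x → (h.merged.next x ∈ T ↔ x ∈ T)) ↔ (∀ x, P x → (M.next x ∈ T ↔ x ∈ T)) := by
  have hl : h.merged.next a = M.next b := M.swapNext_next_left _ _ _
  have hr : h.merged.next b = M.next a := M.swapNext_next_right _ _ _
  constructor
  · intro hc x hx
    by_cases hxa : x = a
    · subst hxa
      rw [← hr, hc b (hab.1 hx), hT hx]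
    by_cases hxb : x = b
    · subst hxb
      rw [← hl, hc a (hab.2 hx), hT (hab.2 hx)]
    rw [← hc x hx, ← M.swapNext_next_of_ne h.left h.right h.pos hxa hxb]
  · intro hc x hx
    by_cases hxa : x = a
    · subst hxa
      rw [hl, hc b (hab.1 hx), hT hx]
    by_cases hxb : x = b
    · subst hxb
      rw [hr, hc a (hab.2 hx), hT (hab.2 hx)]
    rw [← hc x hx, ← M.swapNext_next_of_ne h.left h.right h.pos hxa hxb]

theorem face_merged : h.merged.face a = h.merged.face b :=
  h.face_merged_iff.2 (Or.inr ⟨Or.inl rfl, Or.inr rfl⟩)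

/-- In both maps `a` and `b` are linked independently of the surgery: before it through the yellow
face in the field `adj`, after it through the merged blue face. An invariant set of either map thus
cannot separate them. -/
theorem isConnected_iff : h.merged.IsConnected ↔ M.IsConnected := by
  rw [CombMap.isConnected_iff, CombMap.isConnected_iff]
  refine forall_congr' fun T => ?_
  refine forall_congr' fun hr => ?_
  have key : (a ∈ T ↔ b ∈ T) → ((∀ x, h.merged.next x ∈ T ↔ x ∈ T) ↔ ∀ x, M.next x ∈ T ↔ x ∈ T) := by
    intro hab
    have := h.closed_iff (P := fun _ => True) (T := T) Iff.rfl (fun _ => hab)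
    simpa using this
  constructor
  · intro hc hn
    refine hc ((key ?_).2 hn)
    have hf : ∀ x y, M.face x = M.face y → (x ∈ T ↔ y ∈ T) := fun x y hxy =>
      mem_of_face_eq (P := fun _ => True) (fun _ => Iff.rfl) (fun x _ => hn x) hxy trivial
    obtain ⟨y, -, y', h1, h2, h3⟩ := h.adj
    have hr' : ∀ x, M.rev x ∈ T ↔ x ∈ T := hr
    rw [← hf _ _ h2, ← hf _ _ h3, hr', hr', hf _ _ h1]
  · intro hc hn
    refine hc ((key ?_).1 hn)
    exact mem_of_face_eq (M := h.merged) (P := fun _ => True) (fun _ => Iff.rfl) (fun x _ => hn x)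
      h.face_merged trivial

theorem blueCollapse_iff : h.merged.BlueCollapse ↔ M.BlueCollapse := by
  constructor
  · intro hc x hx y hy
    exact hc x hx y (h.face_merged_of_face hy)
  · intro hc x hx y hy
    change (M.edge y).edge = (M.edge x).edge
    have key : ∀ z, (M.face z = M.face a ∨ M.face z = M.face b) → (M.edge z).edge = (M.edge a).edge := by
      rintro z (hz | hz)
      · exact hc a h.left z hz
      · rw [hc b h.right z hz, h.edge]
    rcases h.face_merged_iff.1 hy with hy | ⟨h1, h2⟩
    · exact hc x hx y hy
    · rw [key x h2, key y h1]

omit [Finite D] in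
theorem live_iff (e : Sym2 (Fin d → ℤ)) : M.Live e a ↔ M.Live e b := by
  unfold Live
  simp [h.left, h.right, h.edge]

/-- Both blue faces lie over one lattice edge, so they are removed together. If they are removed,
the rotations agree on all live darts; if not, the link through the yellow face or through the
merged face consists of live darts, as for connectivity. -/
theorem isNonSeparable_iff (hM : M.BlueCollapse) : h.merged.IsNonSeparable ↔ M.IsNonSeparable := by
  have hN := h.blueCollapse_iff.2 hM
  rw [hM.isNonSeparable_iff, hN.isNonSeparable_iff]
  refine forall₃_congr fun e _ T => ?_
  have hrev : (∀ x, h.merged.Live e x → h.merged.Live e (h.merged.rev x) →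
      (h.merged.rev x ∈ T ↔ x ∈ T)) ↔ (∀ x, M.Live e x → M.Live e (M.rev x) →
      (M.rev x ∈ T ↔ x ∈ T)) := Iff.rfl
  have hend : (∀ x y, h.merged.Live e x → h.merged.Live e y → x ∈ T → y ∈ T) ↔
      (∀ x y, M.Live e x → M.Live e y → x ∈ T → y ∈ T) := Iff.rfl
  have hlive : ∀ x, h.merged.Live e x ↔ M.Live e x := fun _ => Iff.rfl
  rw [hrev, hend]
  have key : (M.Live e a → (a ∈ T ↔ b ∈ T)) → ((∀ x, h.merged.Live e x →
      (h.merged.next x ∈ T ↔ x ∈ T)) ↔ ∀ x, M.Live e x → (M.next x ∈ T ↔ x ∈ T)) :=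
    fun hab => h.closed_iff (P := M.Live e) (T := T) (h.live_iff e) hab
  constructor
  · intro hc hn hr
    refine hc ((key ?_).2 hn) hr
    intro hla
    have hf : ∀ x y, M.face x = M.face y → M.Live e x → (x ∈ T ↔ y ∈ T) := fun x y hxy hx =>
      mem_of_face_eq (fun x => hM.live_face (M.face_next x)) hn hxy hx
    obtain ⟨y, hy, y', h1, h2, h3⟩ := h.adj
    have hlb := (h.live_iff e).1 hla
    have hy' : y' ∈ M.yellow := (M.yellow_face h1).1 hy
    have hry : M.Live e (M.rev y) := (hM.live_face h2).2 hla
    have hry' : M.Live e (M.rev y') := (hM.live_face h3).2 hlb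
    rw [← hf _ _ h2 hry, ← hf _ _ h3 hry', hr _ (live_of_yellow hy) hry,
      hr _ (live_of_yellow hy') hry', hf _ _ h1 (live_of_yellow hy)]
  · intro hc hn hr
    refine hc ((key ?_).1 hn) hr
    intro hla
    exact mem_of_face_eq (M := h.merged) (P := h.merged.Live e)
      (fun x => hN.live_face (h.merged.face_next x)) hn h.face_merged hla

theorem isNPM_iff {l : List (LatticeEdge d)} {K : Plaquette d → ℕ} :
    h.merged.IsNPM l K ↔ M.IsNPM l K := by
  have hw : h.merged.faceWord h.merged.root = M.faceWord M.root :=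
    M.swapNext_faceWord_yellow _ _ _ M.root_mem
  constructor
  · intro hN
    have hb := h.blueCollapse_iff.1 hN.embedding.2
    exact ⟨h.isConnected_iff.1 hN.connected, by rw [← h.eulerChar_merged, hN.planar],
      ⟨h.sameYellow.yellow_embedding_iff.1 hN.embedding.1, hb⟩,
      fun p => by rw [← h.sameYellow.card_plaquettes, hN.plaquettes],
      by rw [← hw, hN.boundary], (h.isNonSeparable_iff hb).1 hN.nonSeparable⟩
  · intro hN
    have hb := h.blueCollapse_iff.2 hN.embedding.2
    exact ⟨h.isConnected_iff.2 hN.connected, by rw [h.eulerChar_merged, hN.planar],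
      ⟨h.sameYellow.yellow_embedding_iff.2 hN.embedding.1, hb⟩,
      fun p => by rw [h.sameYellow.card_plaquettes, hN.plaquettes],
      by rw [hw, hN.boundary], (h.isNonSeparable_iff hN.embedding.2).2 hN.nonSeparable⟩

theorem degree_merged :
    h.merged.degree (h.merged.face a) = M.degree (M.face a) + M.degree (M.face b) := by
  have hne : M.face a ≠ M.face b := fun hh => h.ne (M.face_eq_iff.1 hh)
  have h1 : {x | h.merged.face x = h.merged.face a} =
      {x | M.face x = M.face a} ∪ {x | M.face x = M.face b} := by
    ext x
    simp only [Set.mem_ofPred_eq, Set.mem_union, h.face_merged_iff]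
    tauto
  have h2 : Disjoint {x | M.face x = M.face a} {x | M.face x = M.face b} := by
    rw [Set.disjoint_left]
    intro x hx hx'
    exact hne (hx.symm.trans hx')
  have h3 := Set.ncard_union_eq h2
  rw [← h1] at h3
  exact h3

end Mergeable

/-- The contribution of a blue face of degree `n` to the weight. -/
noncomputable abbrev faceWeight (n : ℕ) : ℝ := catalanWeight (n / 2)

theorem weight_eq_finprod (M : MarkedMap d D) :
    M.weight = ∏ᶠ f ∈ {f : M.Face | M.IsBlue f}, faceWeight (M.degree f) :=
  finprod_set_coe_eq_finprod_mem (f := fun f => faceWeight (M.degree f)) {f : M.Face | M.IsBlue f}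

instance (M : MarkedMap d D) [Finite D] : Finite M.Face := Quotient.finite _

/-! ### The weight of a merged map -/

namespace Mergeable

variable {M : MarkedMap d D} {a b : D} (h : M.Mergeable a b) [Finite D]

include h

/-- The blue faces not involved in the merge correspond bijectively with equal degrees. The
comparison is cross-multiplied to avoid division. -/
theorem weight_merged :
    M.weight * faceWeight (M.degree (M.face a) + M.degree (M.face b)) =
      h.merged.weight * (faceWeight (M.degree (M.face a)) * faceWeight (M.degree (M.face b))) := by
  have hne : M.face a ≠ M.face b := fun hh => h.ne (M.face_eq_iff.1 hh)
  set R : Set M.Face := {f | M.IsBlue f ∧ f ≠ M.face a ∧ f ≠ M.face b} with hR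
  set R' : Set h.merged.Face := {f | h.merged.IsBlue f ∧ f ≠ h.merged.face a} with hR'
  have h1 : {f : M.Face | M.IsBlue f} = insert (M.face a) (insert (M.face b) R) := by
    ext f
    simp only [Set.mem_ofPred_eq, Set.mem_insert_iff, hR]
    constructor
    · intro hf
      tauto
    · rintro (rfl | rfl | hf)
      · exact M.isBlue_face.2 h.left
      · exact M.isBlue_face.2 h.right
      · exact hf.1
  have h2 : {f : h.merged.Face | h.merged.IsBlue f} = insert (h.merged.face a) R' := by
    ext f
    simp only [Set.mem_ofPred_eq, Set.mem_insert_iff, hR']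
    constructor
    · intro hf
      tauto
    · rintro (rfl | hf)
      · exact h.merged.isBlue_face.2 h.left
      · exact hf.1
  have hbij : Set.BijOn (faceMap h.sameYellow.sameCycle) R R' := by
    refine ⟨?_, ?_, ?_⟩
    · intro f hf
      obtain ⟨x, rfl⟩ := M.exists_face f
      refine ⟨h.merged.isBlue_face.2 (M.isBlue_face.1 hf.1), fun hh => ?_⟩
      rcases h.face_merged_iff.1 hh with hh | ⟨hh, -⟩
      · exact hf.2.1 hh
      · exact hh.elim hf.2.1 hf.2.2
    · intro f hf g hg hfg
      obtain ⟨x, rfl⟩ := M.exists_face f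
      obtain ⟨y, rfl⟩ := M.exists_face g
      exact face_inj_of_commute (N := h.merged) (φ := id) Function.injective_id
        (h.commute hf.2.1 hf.2.2) hfg
    · intro g hg
      obtain ⟨x, rfl⟩ := h.merged.exists_face g
      refine ⟨M.face x, ⟨M.isBlue_face.2 (h.merged.isBlue_face.1 hg.1), fun hh => ?_,
        fun hh => ?_⟩, rfl⟩
      · exact hg.2 (h.face_merged_of_face hh)
      · exact hg.2 ((h.face_merged_of_face hh).trans h.face_merged.symm)
  have h3 : ∏ᶠ f ∈ R, faceWeight (M.degree f) = ∏ᶠ f ∈ R', faceWeight (h.merged.degree f) := by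
    refine finprod_mem_eq_of_bijOn _ hbij fun f hf => ?_
    obtain ⟨x, rfl⟩ := M.exists_face f
    congr 1
    exact (degree_of_commute (N := h.merged) (φ := id) Function.injective_id
      (h.commute hf.2.1 hf.2.2)).symm
  rw [weight_eq_finprod, weight_eq_finprod, h1, h2, finprod_mem_insert, finprod_mem_insert,
    finprod_mem_insert, h3, h.degree_merged]
  · ring
  · exact fun hh => hh.2 rfl
  · exact Set.toFinite _
  · exact fun hh => hh.2.2 rfl
  · exact Set.toFinite _
  · rintro (hh | hh)
    · exact hne hh
    · exact hh.2.1 rfl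
  · exact Set.toFinite _

end Mergeable

end MarkedMap

/-! ### The recursion for the weights -/

theorem catalanWeight_ne_zero (i : ℕ) : catalanWeight i ≠ 0 := by
  have h : (catalan (i - 1) : ℝ) ≠ 0 := by
    rw [catalan_eq_centralBinom_div]
    have h1 := Nat.succ_dvd_centralBinom (i - 1)
    have h2 := Nat.centralBinom_pos (i - 1)
    exact_mod_cast (Nat.div_pos (Nat.le_of_dvd h2 h1) (Nat.succ_pos _)).ne'
  unfold catalanWeight
  exact mul_ne_zero (pow_ne_zero _ (by norm_num)) h

/-- With m = n + 2, all products in the sum have the sign (-1)^n, so the sum is (-1)^n Cat(n + 1) by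
the Catalan recursion, while w_m has the opposite sign. -/
theorem catalanWeight_add_sum {m : ℕ} (hm : 2 ≤ m) :
    catalanWeight m + ∑ i ∈ Finset.Ico 1 m, catalanWeight (m - i) * catalanWeight i = 0 := by
  obtain ⟨n, rfl⟩ := Nat.exists_eq_add_of_le' hm
  rw [Finset.sum_Ico_eq_sum_range]
  have h1 : ∀ j ∈ Finset.range (n + 2 - 1), catalanWeight (n + 2 - (1 + j)) * catalanWeight (1 + j) =
      (-1) ^ n * ((catalan j * catalan (n - j) : ℕ) : ℝ) := by
    intro j hj
    have hj' : j ≤ n := by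
      have := Finset.mem_range.1 hj
      omega
    unfold catalanWeight
    have e1 : n + 2 - (1 + j) - 1 = n - j := by omega
    have e2 : 1 + j - 1 = j := by omega
    have e3 : (-1 : ℝ) ^ n = (-1) ^ (n - j) * (-1) ^ j := by
      rw [← pow_add]
      congr 1
      omega
    rw [e1, e2, e3]
    push_cast
    ring
  rw [Finset.sum_congr rfl h1, ← Finset.mul_sum, ← Nat.cast_sum]
  have h2 : ∑ j ∈ Finset.range (n + 2 - 1), catalan j * catalan (n - j) = catalan (n + 1) := by
    rw [catalan_succ]
    exact Finset.sum_range (fun j => catalan j * catalan (n - j))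
  rw [h2]
  unfold catalanWeight
  have e1 : n + 2 - 1 = n + 1 := by omega
  rw [e1, pow_succ]
  ring

namespace MarkedMap

variable {d : ℕ} {D D' : Type}

theorem IsNPM.blueCollapse {M : MarkedMap d D} {l : List (LatticeEdge d)} {K : Plaquette d → ℕ}
    (h : M.IsNPM l K) : M.BlueCollapse := h.embedding.2

/-! ### The two blue faces at a backtrack -/

section Backtrack

variable (M : MarkedMap d D) (k : ℕ)

/-- The boundary dart number `k`. -/
def bdry : D := M.next^[k] M.root

/-- The blue dart that ends at the tip of the backtrack `k, k + 1`, on the far side of `k + 1`. -/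
def inner : D := M.rev (M.bdry (k + 1))

/-- The blue dart that precedes the far side of the boundary dart `k`. -/
def outer : D := M.next.symm (M.rev (M.bdry k))

/-- The tip of the backtrack is a vertex of degree two. -/
def Free : Prop := M.next (M.inner k) = M.rev (M.bdry k)

theorem bdry_mem : M.bdry k ∈ M.yellow := (M.yellow_iterate _ _).2 M.root_mem

theorem bdry_succ : M.bdry (k + 1) = M.next (M.bdry k) := Function.iterate_succ_apply' _ _ _

theorem inner_notMem : M.inner k ∉ M.yellow := M.rev_notMem (M.bdry_mem _)

theorem next_outer : M.next (M.outer k) = M.rev (M.bdry k) := M.next.apply_symm_apply _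

theorem rev_inner : M.rev (M.inner k) = M.bdry (k + 1) := M.rev_rev _

theorem outer_notMem : M.outer k ∉ M.yellow := by
  rw [← M.yellow_next, next_outer]
  exact M.rev_notMem (M.bdry_mem _)

theorem pos_inner_outer : M.pos (M.rev (M.inner k)) = M.pos (M.rev (M.outer k)) := by
  rw [← M.pos_next (M.outer k), next_outer, rev_inner, bdry_succ, pos_next]

theorem free_iff : M.Free k ↔ M.inner k = M.outer k := by
  rw [Free, ← next_outer, M.next.injective.eq_iff]

theorem face_outer : M.face (M.outer k) = M.face (M.rev (M.bdry k)) := by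
  rw [← next_outer, M.face_next]

/-- Make the tip of the backtrack a vertex of degree two. -/
noncomputable def merge : MarkedMap d D :=
  M.swapNext (M.inner k) (M.outer k) (M.inner_notMem k) (M.outer_notMem k) (M.pos_inner_outer k)

theorem swapNext_bdry {a b : D} (ha : a ∉ M.yellow) (hb : b ∉ M.yellow)
    (hpos : M.pos (M.rev a) = M.pos (M.rev b)) (j : ℕ) :
    (M.swapNext a b ha hb hpos).bdry j = M.bdry j :=
  M.swapNext_iterate_yellow _ _ _ M.root_mem j

theorem swapNext_inner {a b : D} (ha : a ∉ M.yellow) (hb : b ∉ M.yellow)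
    (hpos : M.pos (M.rev a) = M.pos (M.rev b)) (j : ℕ) :
    (M.swapNext a b ha hb hpos).inner j = M.inner j :=
  congrArg M.rev (M.swapNext_bdry ha hb hpos _)

theorem merge_inner : (M.merge k).inner k = M.inner k := M.swapNext_inner _ _ _ _

theorem free_merge : (M.merge k).Free k := by
  unfold Free
  rw [merge_inner, merge, swapNext_next_left, next_outer, swapNext_bdry]
  rfl

variable {M k}

theorem swapNext_self {a : D} (ha : a ∉ M.yellow) (hb : a ∉ M.yellow)
    (hpos : M.pos (M.rev a) = M.pos (M.rev a)) : M.swapNext a a ha hb hpos = M := by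
  obtain ⟨⟨rev, next, _, _⟩, _⟩ := M
  simp [swapNext]
  rfl

/-- At a free tip the two darts whose successors are exchanged coincide. Hence `merge` is a
retraction onto the maps with a free tip. -/
theorem Free.merge_eq (h : M.Free k) : M.merge k = M := by
  unfold merge
  simp only [← (M.free_iff k).1 h]
  exact swapNext_self _ _ _

theorem Iso.map_bdry {N : MarkedMap d D'} (f : M.Iso N) (j : ℕ) :
    f.toEquiv (M.bdry j) = N.bdry j := by
  unfold bdry
  rw [f.map_next_iterate, f.map_root]

theorem Iso.map_inner {N : MarkedMap d D'} (f : M.Iso N) (j : ℕ) :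
    f.toEquiv (M.inner j) = N.inner j := by
  unfold inner
  rw [f.map_rev, f.map_bdry]

theorem Iso.map_outer {N : MarkedMap d D'} (f : M.Iso N) (j : ℕ) :
    f.toEquiv (M.outer j) = N.outer j := by
  unfold outer
  rw [f.map_next_symm, f.map_rev, f.map_bdry]

variable (k) in
/-- Merging is compatible with isomorphisms. -/
noncomputable def Iso.merge {N : MarkedMap d D'} (f : M.Iso N) : (M.merge k).Iso (N.merge k) :=
  swapNextIso _ _ _ f (f.map_inner k) (f.map_outer k) _ _ _

end Backtrack

/-! ### The two blue faces at a tip that is not free -/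

section

variable {M : MarkedMap d D} {k : ℕ} {e : LatticeEdge d}

theorem bdry_ne (he : M.edge (M.bdry k) = e) (he' : M.edge (M.bdry (k + 1)) = e.symm) :
    M.bdry k ≠ M.bdry (k + 1) := by
  intro h
  rw [h, he'] at he
  exact SimpleGraph.Dart.symm_ne _ he

/-- In a face of degree two the far sides of the two boundary edges, being different darts, must
follow each other; this makes the tip free. -/
theorem isTwoGonAt_iff [Finite D] (he : M.edge (M.bdry k) = e)
    (he' : M.edge (M.bdry (k + 1)) = e.symm) :
    M.IsTwoGonAt k ↔ M.Free k ∧ M.degree (M.face (M.inner k)) = 2 := by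
  change M.face (M.rev (M.bdry k)) = M.face (M.inner k) ∧
    M.degree (M.face (M.rev (M.bdry k))) = 2 ↔ _
  constructor
  · rintro ⟨h1, h2⟩
    rw [h1] at h2
    refine ⟨?_, h2⟩
    obtain ⟨j, hj, hj'⟩ := sameCycle_iff_iterate.1 (M.face_eq_iff.1 h1.symm)
    rw [← M.degree_face, h2] at hj
    have hj1 : j = 1 := by
      have : j ≠ 0 := by
        rintro rfl
        exact bdry_ne he he' (M.rev.injective hj').symm
      omega
    subst hj1
    exact hj'
  · rintro ⟨h1, h2⟩
    have h3 : M.face (M.rev (M.bdry k)) = M.face (M.inner k) := by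
      rw [← h1, M.face_next]
    exact ⟨h3, by rw [h3, h2]⟩

/-- The geometric conditions for merging hold automatically at a backtrack: both darts end at the
tip, and the external face touches both blue faces. -/
theorem mergeable_of (hne : ¬ M.next.SameCycle (M.inner k) (M.outer k))
    (hedge : (M.edge (M.inner k)).edge = (M.edge (M.outer k)).edge) :
    M.Mergeable (M.inner k) (M.outer k) where
  left := M.inner_notMem k
  right := M.outer_notMem k
  pos := M.pos_inner_outer k
  ne := hne
  vertex := by
    -- Two rotations around the tip lead from the reversal of `outer` over the far side of the
    -- boundary dart `k` to the boundary dart `k + 1`.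
    have : (M.next * M.rev) ((M.next * M.rev) (M.rev (M.outer k))) = M.rev (M.inner k) := by
      simp only [Perm.mul_apply, M.rev_rev, next_outer, rev_inner, bdry_succ]
    rw [← this]
    exact ((sameCycle_apply_right.2 (sameCycle_apply_right.2 (SameCycle.refl _ _)))).symm
  edge := hedge
  adj := ⟨M.bdry (k + 1), M.bdry_mem _, M.bdry k, by rw [bdry_succ, M.face_next], rfl,
    (M.face_outer k).symm⟩

theorem edge_outer_edge (hM : M.BlueCollapse) (he : M.edge (M.bdry k) = e) :
    (M.edge (M.outer k)).edge = e.edge := by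
  rw [← he, ← M.edge_rev_edge (M.bdry k)]
  exact hM _ (M.rev_notMem (M.bdry_mem k)) _ (M.face_outer k)

theorem edge_inner (he' : M.edge (M.bdry (k + 1)) = e.symm) : M.edge (M.inner k) = e := by
  unfold inner
  rw [M.edge_rev, he', SimpleGraph.Dart.symm_symm]

/-- In a non-separable planar map, the two blue faces at a backtrack whose tip is not free are
different: a curve through a common blue face would separate the map. -/
theorem IsNPM.mergeable [Finite D] {l : List (LatticeEdge d)} {K : Plaquette d → ℕ}
    (h : M.IsNPM l K) (he : M.edge (M.bdry k) = e) (he' : M.edge (M.bdry (k + 1)) = e.symm)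
    (hfree : ¬ M.Free k) : M.Mergeable (M.inner k) (M.outer k) := by
  classical
  have hin : (M.edge (M.inner k)).edge = e.edge := by rw [edge_inner he']
  have hout := edge_outer_edge h.embedding.2 he
  refine mergeable_of ?_ (by rw [hin, hout])
  intro hsame
  set a := M.inner k with ha
  set b := M.outer k with hb
  have hab : a ≠ b := fun hh => hfree ((M.free_iff k).2 hh)
  -- Assume a common face: the surgery then adds one face and one vertex, too many for a connected
  -- surface.
  set N := M.merge k with hN
  have h1 : numCycles N.next = numCycles M.next + 1 := by
    exact numCycles_mul_swap_of_sameCycle hsame hab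
  have h2 : numCycles (N.next * N.rev) = numCycles (M.next * M.rev) + 1 := by
    rw [hN, merge, swapNext_vertex]
    have hv : (M.next * M.rev).SameCycle (M.rev a) (M.rev b) := by
      have : (M.next * M.rev) ((M.next * M.rev) (M.rev b)) = M.rev a := by
        simp only [Perm.mul_apply, M.rev_rev, ha, hb, next_outer, rev_inner, bdry_succ]
      rw [← this]
      exact ((sameCycle_apply_right.2 (sameCycle_apply_right.2 (SameCycle.refl _ _)))).symm
    exact numCycles_mul_swap_of_sameCycle hv (fun hh => hab (M.rev.injective hh))
  have h3 : N.eulerChar = 4 := by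
    have h4 := h.planar
    rw [CombMap.eulerChar_eq] at h4 ⊢
    rw [h1, h2]
    change _ - (numCycles M.rev : ℤ) + _ = _
    push_cast
    linarith
  have h4 : ¬ N.IsConnected := by
    intro hc
    have := N.eulerChar_le_two hc
    omega
  apply h4
  rw [CombMap.isConnected_iff]
  intro T hr hn x y hx
  -- An invariant set of `N` is closed under the rotation of `M` at all darts except `inner` and
  -- `outer`. These are blue and lie over `e`, so they are not live, and non-separability at `e`
  -- applies. Every other dart is reached through its yellow side.
  have key := h.blueCollapse.isNonSeparable_iff.1 h.nonSeparable e.edge e.adj T ?_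
    (fun z _ _ => hr z)
  · have hr' : ∀ z, M.rev z ∈ T ↔ z ∈ T := hr
    have hyel : ∀ z, ∃ w ∈ M.yellow, w ∈ T ↔ z ∈ T := by
      intro z
      by_cases hz : z ∈ M.yellow
      · exact ⟨z, hz, Iff.rfl⟩
      · exact ⟨M.rev z, M.rev_mem hz, hr' z⟩
    obtain ⟨x', hx', hxT⟩ := hyel x
    obtain ⟨y', hy', hyT⟩ := hyel y
    exact hyT.1 (key x' y' (live_of_yellow hx') (live_of_yellow hy') (hxT.2 hx))
  · intro z hz
    have hza : z ≠ a := by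
      rintro rfl
      exact hz.elim (M.inner_notMem k) (fun hh => hh hin)
    have hzb : z ≠ b := by
      rintro rfl
      exact hz.elim (M.outer_notMem k) (fun hh => hh hout)
    rw [← hn z, hN, merge, swapNext_next_of_ne _ _ _ _ hza hzb]

end

/-! ### Splitting a blue face at a free tip -/

section Split

variable {M : MarkedMap d D} (k : ℕ)

/-- An even number of steps around a blue face keeps the oriented edge, hence the end point. Odd
steps would reverse it, so a split always produces parts of even degree. -/
theorem BlueCollapse.pos_rev_iterate (hM : M.BlueCollapse) (i : ℕ) :
    M.pos (M.rev (M.inner k)) = M.pos (M.rev (M.next^[2 * i] (M.inner k))) := by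
  have := hM.edge_iterate (M.inner_notMem k) (2 * i)
  rw [if_pos (even_two_mul i)] at this
  exact congrArg (fun e : LatticeEdge d => e.snd) this.symm

theorem iterate_inner_notMem (i : ℕ) : M.next^[i] (M.inner k) ∉ M.yellow := by
  rw [M.yellow_iterate]
  exact M.inner_notMem k

/-- Split the blue face at the tip of the backtrack so that one part has degree `2 * i`. -/
noncomputable def BlueCollapse.split (hM : M.BlueCollapse) (i : ℕ) : MarkedMap d D :=
  M.swapNext (M.inner k) (M.next^[2 * i] (M.inner k)) (M.inner_notMem k)
    (iterate_inner_notMem k _) (hM.pos_rev_iterate k i)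

variable {k} {i : ℕ} (hM : M.BlueCollapse)

/-- The index 0 stands for the map that is not split, so that a whole fibre of `merge` is indexed by
i < m. -/
theorem BlueCollapse.split_zero : hM.split k 0 = M := swapNext_self _ _ _

theorem BlueCollapse.split_inner : (hM.split k i).inner k = M.inner k := M.swapNext_inner _ _ _ _

/-- The position of `outer` on the original blue face records `i`; this later tells the splittings
apart. -/
theorem BlueCollapse.split_outer (hfree : M.Free k) :
    (hM.split k i).outer k = M.next^[2 * i] (M.inner k) := by
  unfold outer
  rw [Equiv.symm_apply_eq, split, swapNext_next_right, hfree, swapNext_bdry]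
  rfl

theorem BlueCollapse.merge_split (hfree : M.Free k) : (hM.split k i).merge k = M := by
  have h : ∀ (b : D) (hb : b ∉ M.yellow) (hpos : M.pos (M.rev (M.inner k)) = M.pos (M.rev b))
      (a' b' : D) (haa : a' = M.inner k) (hbb : b' = b)
      (h1 : a' ∉ (M.swapNext (M.inner k) b (M.inner_notMem k) hb hpos).yellow)
      (h2 : b' ∉ (M.swapNext (M.inner k) b (M.inner_notMem k) hb hpos).yellow)
      (h3 : (M.swapNext (M.inner k) b (M.inner_notMem k) hb hpos).pos
        ((M.swapNext (M.inner k) b (M.inner_notMem k) hb hpos).rev a') =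
        (M.swapNext (M.inner k) b (M.inner_notMem k) hb hpos).pos
        ((M.swapNext (M.inner k) b (M.inner_notMem k) hb hpos).rev b')),
      (M.swapNext (M.inner k) b (M.inner_notMem k) hb hpos).swapNext a' b' h1 h2 h3 = M := by
    rintro b hb hpos a' b' rfl rfl h1 h2 h3
    exact M.swapNext_swapNext _ _ _
  exact h _ _ _ _ _ hM.split_inner (hM.split_outer hfree) _ _ _

variable [Finite D]

theorem BlueCollapse.split_mergeable (hfree : M.Free k) (hi : 0 < i)
    (hi' : 2 * i < Function.minimalPeriod M.next (M.inner k)) :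
    (hM.split k i).Mergeable ((hM.split k i).inner k) ((hM.split k i).outer k) := by
  classical
  apply mergeable_of
  · rw [hM.split_inner, hM.split_outer hfree]
    refine not_sameCycle_mul_swap ?_ ?_
    · exact M.face_eq_iff.1 (M.face_iterate _ _).symm
    · intro h
      have := (Function.iterate_eq_iterate_iff_of_lt_minimalPeriod (f := M.next) (x := M.inner k)
        (m := 0) (n := 2 * i) (by omega) hi').1 h
      omega
  · rw [hM.split_inner, hM.split_outer hfree]
    exact hM _ (iterate_inner_notMem k (2 * i)) _ (M.face_iterate _ _).symm

/-- The part that is cut off consists of the darts number 1 to `2 * i` after `inner`; `inner`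
belongs to the other part. -/
theorem BlueCollapse.degree_split (hi : 0 < i)
    (hi' : 2 * i < Function.minimalPeriod M.next (M.inner k)) :
    (hM.split k i).degree ((hM.split k i).face (M.next^[2 * i] (M.inner k))) = 2 * i := by
  classical
  have h : {x | (hM.split k i).face x = (hM.split k i).face (M.next^[2 * i] (M.inner k))} =
      (fun j => M.next^[j] (M.inner k)) '' (Finset.Icc 1 (2 * i) : Set ℕ) := by
    ext x
    rw [Set.mem_ofPred_eq, eq_comm, CombMap.face_eq_iff]
    refine (sameCycle_mul_swap_iterate (f := M.next) (a := M.inner k) (by omega) hi' x).trans ?_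
    simp only [Set.mem_image, Finset.coe_Icc, Set.mem_Icc, and_assoc]
  have h2 : (hM.split k i).degree ((hM.split k i).face (M.next^[2 * i] (M.inner k))) =
      ({x | (hM.split k i).face x = (hM.split k i).face (M.next^[2 * i] (M.inner k))}).ncard := rfl
  rw [h2, h, Set.InjOn.ncard_image, Set.ncard_coe_finset]
  · simp
  · intro j hj j' hj' hjj
    simp only [Finset.coe_Icc, Set.mem_Icc] at hj hj'
    exact (Function.iterate_eq_iterate_iff_of_lt_minimalPeriod (by omega) (by omega)).1 hjj

/-- Merging the split map gives back `M`, so `weight_merged` compares the two: the factor w_m is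
replaced by one factor for `inner`, of degree `2 * (m - i)`, and one for `outer`, of degree `2 * i`.
-/
theorem BlueCollapse.weight_split (hfree : M.Free k) {m : ℕ}
    (hm : M.degree (M.face (M.inner k)) = 2 * m) (hi : 0 < i) (hi' : i < m) :
    (hM.split k i).weight = M.weight / catalanWeight m * (catalanWeight (m - i) * catalanWeight i) := by
  have hp : Function.minimalPeriod M.next (M.inner k) = 2 * m := by rw [← M.degree_face, hm]
  have hmg := hM.split_mergeable hfree hi (by omega)
  have h1 := hmg.weight_merged
  have h2 := hmg.degree_merged
  have h3 : hmg.merged = M := hM.merge_split hfree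
  have h4 := hM.degree_split hi (by omega : 2 * i < Function.minimalPeriod M.next (M.inner k))
  rw [← hM.split_outer hfree] at h4
  have h5 : hmg.merged.degree (hmg.merged.face ((hM.split k i).inner k)) = 2 * m := by
    rw [h3, hM.split_inner, hm]
  rw [← h2, h5, h3] at h1
  have h6 : (hM.split k i).degree ((hM.split k i).face ((hM.split k i).inner k)) = 2 * (m - i) := by
    omega
  rw [h6, h4] at h1
  simp only [faceWeight, Nat.mul_div_cancel_left _ (Nat.succ_pos 1)] at h1
  field_simp [catalanWeight_ne_zero m]
  linarith

theorem BlueCollapse.area_split (hfree : M.Free k) (hi : 0 < i)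
    (hi' : 2 * i < Function.minimalPeriod M.next (M.inner k)) : (hM.split k i).area = M.area := by
  have h := (hM.split_mergeable hfree hi hi').sameYellow.area_eq
  rw [show (hM.split_mergeable hfree hi hi').merged = M from hM.merge_split hfree] at h
  exact h.symm

theorem IsNPM.split {l : List (LatticeEdge d)} {K : Plaquette d → ℕ} (h : M.IsNPM l K)
    (hfree : M.Free k) (hi' : 2 * i < Function.minimalPeriod M.next (M.inner k)) :
    (hM.split k i).IsNPM l K := by
  rcases Nat.eq_zero_or_pos i with rfl | hi
  · rwa [hM.split_zero]
  · refine (hM.split_mergeable hfree hi hi').isNPM_iff.1 ?_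
    rwa [show (hM.split_mergeable hfree hi hi').merged = M from hM.merge_split hfree]

theorem BlueCollapse.not_free_split (hfree : M.Free k) (hi : 0 < i)
    (hi' : 2 * i < Function.minimalPeriod M.next (M.inner k)) : ¬ (hM.split k i).Free k := by
  rw [free_iff]
  intro hh
  exact (hM.split_mergeable hfree hi hi').ne (hh ▸ SameCycle.refl _ _)

end Split

end MarkedMap

variable {d : ℕ}

/-! ### Finiteness -/

namespace MarkedMap

variable {D : Type} {M : MarkedMap d D} {l : List (LatticeEdge d)} {K : Plaquette d → ℕ}

theorem IsNPM.exists_plaquette (h : M.IsNPM l K) {f : M.Face} (hf : M.IsInternalYellow f) :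
    ∃ p, M.IsSentToPlaquette f p := by
  obtain ⟨x, rfl⟩ := M.exists_face f
  have hx := M.isInternalYellow_face.1 hf
  exact ⟨⟨_, h.embedding.1 x hx.2 hx.1⟩, hf, x, rfl, rfl⟩

theorem IsNPM.pos_of_isSentToPlaquette [Finite D] (h : M.IsNPM l K) {f : M.Face} {p : Plaquette d}
    (hf : M.IsSentToPlaquette f p) : K p ≠ 0 := by
  rw [← h.plaquettes p]
  have : Nonempty {f : M.Face // M.IsSentToPlaquette f p} := ⟨⟨f, hf⟩⟩
  exact Nat.card_pos.ne'

theorem IsNPM.finite_support [Finite D] (h : M.IsNPM l K) : K.support.Finite := by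
  refine Set.Finite.of_injOn (f := fun p : Plaquette d => p.1)
    (t := Set.range fun x => (M.faceWord x : Cycle (LatticeEdge d))) ?_
    (fun p _ q _ hpq => Subtype.ext hpq) (Set.finite_range _)
  intro p hp
  have hp' : Nat.card {f : M.Face // M.IsSentToPlaquette f p} ≠ 0 := by
    rw [h.plaquettes p]; exact hp
  obtain ⟨⟨f, -, x, -, hx⟩⟩ := (Nat.card_ne_zero.1 hp').1
  exact ⟨x, hx⟩

/-- Each internal yellow face is sent to some plaquette `p`, and only `K p` faces are sent to `p`,
so these faces inject into the disjoint union of the `Fin (K p)`. -/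
theorem IsNPM.area_le [Finite D] (h : M.IsNPM l K) : M.area ≤ Nat.card (Σ p, Fin (K p)) := by
  choose p hp using fun f : {f : M.Face // M.IsInternalYellow f} => h.exists_plaquette f.2
  have e : ∀ p, {f : M.Face // M.IsSentToPlaquette f p} ≃ Fin (K p) := fun p => by
    rw [← h.plaquettes p]
    exact Finite.equivFin _
  -- The bound needs this finiteness, since `Nat.card` of an infinite type is 0.
  have : Finite (Σ p, Fin (K p)) := by
    have : Finite K.support := h.finite_support
    refine Finite.of_injective (β := Σ p : K.support, Fin (K p))
      (fun x => ⟨⟨x.1, fun h0 => (Fin.pos x.2).ne' h0⟩, x.2⟩) ?_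
    rintro ⟨p, i⟩ ⟨q, j⟩ hh
    obtain ⟨h1, h2⟩ := Sigma.mk.inj_iff.1 hh
    obtain rfl : p = q := congrArg Subtype.val h1
    exact congrArg _ (eq_of_heq h2)
  refine Nat.card_le_card_of_injective
    (fun f : {f : M.Face // M.IsInternalYellow f} =>
      (⟨p f, e (p f) ⟨f.1, hp f⟩⟩ : Σ p, Fin (K p))) ?_
  intro f g hfg
  have key : ∀ q q' (x : {f : M.Face // M.IsSentToPlaquette f q})
      (x' : {f : M.Face // M.IsSentToPlaquette f q'}),
      (⟨q, e q x⟩ : Σ p, Fin (K p)) = ⟨q', e q' x'⟩ → x.1 = x'.1 := by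
    intro q q' x x' hh
    obtain ⟨rfl, hh⟩ := Sigma.mk.inj_iff.1 hh
    rw [(e q).injective (eq_of_heq hh)]
  exact Subtype.ext (key _ _ _ _ hfg)

theorem IsNPM.degree_le [Finite D] (h : M.IsNPM l K) {x : D} (hx : x ∈ M.yellow) :
    M.degree (M.face x) ≤ l.length + 4 := by
  by_cases hf : M.face x = M.externalFace
  · rw [hf, externalFace, M.degree_face, ← M.faceWord_length, h.boundary]
    omega
  · have h1 : (M.faceWord x).length = 4 := (h.embedding.1 x hx hf).1
    rw [M.degree_face, ← M.faceWord_length]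
    omega

/-- Half of the darts are yellow. They are spread over at most area + 1 faces, whose degree is the
length of `l` for the external face and 4 for the others. -/
theorem IsNPM.card_le [Finite D] (h : M.IsNPM l K) :
    Nat.card D ≤ 2 * ((l.length + 4) * (Nat.card (Σ p, Fin (K p)) + 1)) := by
  classical
  have := Fintype.ofFinite D
  have := Fintype.ofFinite M.Face
  rw [M.card_darts, Nat.card_coe_set_eq, Set.ncard_eq_toFinset_card']
  refine Nat.mul_le_mul_left 2 ?_
  have h1 := Finset.card_le_mul_card_image (s := M.yellow.toFinset) (f := M.face) (l.length + 4) ?_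
  · refine h1.trans (Nat.mul_le_mul_left _ ?_)
    refine le_trans (Finset.card_le_card (t := insert M.externalFace
      (Finset.univ.filter fun f => M.IsInternalYellow f)) ?_) ((Finset.card_insert_le _ _).trans ?_)
    · intro f hf
      obtain ⟨x, hx, rfl⟩ := Finset.mem_image.1 hf
      by_cases hxe : M.face x = M.externalFace
      · exact Finset.mem_insert.2 (Or.inl hxe)
      · refine Finset.mem_insert.2 (Or.inr (Finset.mem_filter.2 ⟨Finset.mem_univ _, ?_⟩))
        exact M.isInternalYellow_face.2 ⟨hxe, by simpa using hx⟩
    · have h2 := h.area_le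
      unfold area at h2
      rw [Nat.card_eq_fintype_card, Fintype.card_subtype] at h2
      omega
  · intro f hf
    obtain ⟨x, hx, rfl⟩ := Finset.mem_image.1 hf
    refine le_trans ?_ (h.degree_le (by simpa using hx))
    unfold CombMap.degree
    rw [Nat.card_eq_fintype_card, Fintype.card_subtype]
    exact Finset.card_le_card (Finset.filter_subset_filter _ (Finset.subset_univ _))

/-- The lattice points that can be visited by a map with boundary `l` and plaquettes `K`. -/
def reach (l : List (LatticeEdge d)) (K : Plaquette d → ℕ) : Set (Fin d → ℤ) :=
  ⋃ e ∈ {e | e ∈ l} ∪ ⋃ p ∈ K.support, {e | e ∈ p.1}, {e.fst, e.snd}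

theorem finite_reach (hK : K.support.Finite) : (reach l K).Finite := by
  refine Set.Finite.biUnion ?_ fun e _ => Set.toFinite _
  refine (List.finite_toSet l).union (hK.biUnion fun p _ => ?_)
  induction p.1 using Quotient.inductionOn with | _ w
  exact List.finite_toSet w

theorem edge_mem_faceWord [Finite D] {x y : D} (h : M.face x = M.face y) :
    M.edge y ∈ M.faceWord x := by
  obtain ⟨k, hk, rfl⟩ := sameCycle_iff_iterate.1 (M.face_eq_iff.1 h)
  exact List.mem_map.2 ⟨k, List.mem_range.2 hk, rfl⟩

/-- Every dart or its reversal borders a yellow face, and the edges of these are edges of `l` or of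
plaquettes with `K p ≠ 0`. -/
theorem IsNPM.pos_mem_reach [Finite D] (h : M.IsNPM l K) (x : D) : M.pos x ∈ reach l K := by
  have key : ∀ x ∈ M.yellow, M.edge x ∈ {e | e ∈ l} ∪ ⋃ p ∈ K.support, {e | e ∈ p.1} := by
    intro x hx
    by_cases hf : M.face x = M.externalFace
    · left
      change M.edge x ∈ l
      rw [← h.boundary]
      exact edge_mem_faceWord hf.symm
    · right
      obtain ⟨p, hp⟩ := h.exists_plaquette (M.isInternalYellow_face.2 ⟨hf, hx⟩)
      refine Set.mem_biUnion (h.pos_of_isSentToPlaquette hp) ?_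
      obtain ⟨-, y, hy, hyp⟩ := hp
      change M.edge x ∈ p.1
      rw [← hyp]
      exact edge_mem_faceWord hy
  by_cases hx : x ∈ M.yellow
  · exact Set.mem_biUnion (key x hx) (Or.inl rfl)
  · refine Set.mem_biUnion (key _ (M.rev_mem hx)) (Or.inr ?_)
    change M.pos x = M.pos (M.rev (M.rev x))
    rw [M.rev_rev]

theorem finite_of_pos_mem [Finite D] {T : Set (Fin d → ℤ)} (hT : T.Finite) :
    {M : MarkedMap d D | ∀ x, M.pos x ∈ T}.Finite := by
  have := hT.to_subtype
  let g : {M : MarkedMap d D // ∀ x, M.pos x ∈ T} → Perm D × Perm D × Set D × (D → T) × D :=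
    fun M => (M.1.rev, M.1.next, M.1.yellow, fun x => ⟨M.1.pos x, M.2 x⟩, M.1.root)
  refine Finite.of_injective g ?_
  rintro ⟨⟨⟨rev, next, _, _⟩, yellow, _, _, pos, _, _, root, _⟩, hM⟩
    ⟨⟨⟨rev', next', _, _⟩, yellow', _, _, pos', _, _, root', _⟩, hM'⟩ h
  simp only [g, Prod.mk.injEq] at h
  obtain ⟨rfl, rfl, rfl, h, rfl⟩ := h
  obtain rfl : pos = pos' := funext fun x => congrArg Subtype.val (congrFun h x)
  rfl

end MarkedMap

/-- The number of darts and the lattice points that can be visited are bounded, which leaves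
finitely many data. If `K` has infinite support, no finite map realises it. -/
theorem NPM_finite (l : List (LatticeEdge d)) (K : Plaquette d → ℕ) : (NPM l K).Finite := by
  by_cases hK : K.support.Finite
  · set B := 2 * ((l.length + 4) * (Nat.card (Σ p, Fin (K p)) + 1)) with hB
    have h1 : (⋃ n ∈ Set.Iic B, Sigma.mk n ''
        {M : MarkedMap d (Fin n) | ∀ x, M.pos x ∈ MarkedMap.reach l K}).Finite :=
      (Set.finite_Iic B).biUnion fun n _ =>
        (MarkedMap.finite_of_pos_mem (MarkedMap.finite_reach hK)).image _
    refine (h1.image (Quotient.mk (mapSetoid d))).subset ?_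
    rintro c ⟨-, ⟨n, M⟩, rfl, hM⟩
    refine ⟨_, Set.mem_biUnion ?_ ⟨M, hM.pos_mem_reach, rfl⟩, rfl⟩
    have := hM.card_le
    rwa [Nat.card_fin] at this
  · refine Set.finite_empty.subset ?_
    rintro c ⟨-, M, -, hM⟩
    exact hK hM.finite_support

/-! ### Classes of maps -/

theorem mk_mem_NPM {l : List (LatticeEdge d)} {K : Plaquette d → ℕ} (hbal : IsBalanced l K)
    {M : Σ n : ℕ, MarkedMap d (Fin n)} : Quotient.mk (mapSetoid d) M ∈ NPM l K ↔ M.2.IsNPM l K := by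
  constructor
  · rintro ⟨-, N, hN, h⟩
    obtain ⟨f⟩ := Quotient.exact hN
    exact f.isNPM h
  · exact fun h => ⟨hbal, M, rfl, h⟩

theorem mk_mem_NPMTwoGon {l : List (LatticeEdge d)} {K : Plaquette d → ℕ} (hbal : IsBalanced l K)
    {k : ℕ} {M : Σ n : ℕ, MarkedMap d (Fin n)} :
    Quotient.mk (mapSetoid d) M ∈ NPMTwoGon l K k ↔ M.2.IsNPM l K ∧ M.2.IsTwoGonAt k := by
  constructor
  · rintro ⟨-, N, hN, h, h'⟩
    obtain ⟨f⟩ := Quotient.exact hN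
    exact ⟨f.isNPM h, f.isTwoGonAt h'⟩
  · exact fun h => ⟨hbal, M, rfl, h⟩

theorem NPMTwoGon_subset {l : List (LatticeEdge d)} {K : Plaquette d → ℕ} {k : ℕ} :
    NPMTwoGon l K k ⊆ NPM l K := by
  rintro c ⟨h, M, hM, hM', -⟩
  exact ⟨h, M, hM, hM'⟩

theorem MarkedMap.IsNPM.edge_bdry {D : Type} {M : MarkedMap d D} {l : List (LatticeEdge d)}
    {K : Plaquette d → ℕ} (h : M.IsNPM l K) {j : ℕ} (hj : j < l.length) :
    M.edge (M.bdry j) = l[j] := by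
  have h1 := h.boundary
  subst h1
  rw [M.faceWord_getElem]
  rfl

/-! ### Cancellation -/

/-- The effect of merging on classes of maps. -/
noncomputable def mergeClass (k : ℕ) : MapClass d → MapClass d :=
  Quotient.map (sa := mapSetoid d) (sb := mapSetoid d) (fun M => ⟨M.1, M.2.merge k⟩)
    (fun _ _ ⟨f⟩ => ⟨f.merge k⟩)

section Cancellation

variable {K : Plaquette d → ℕ} {π₁ π₂ : List (LatticeEdge d)} {e : LatticeEdge d}

theorem edge_bdry_left {D : Type} {M : MarkedMap d D}
    (h : M.IsNPM (π₁ ++ e :: e.symm :: π₂) K) : M.edge (M.bdry π₁.length) = e := by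
  rw [h.edge_bdry (by simp)]
  simp

theorem edge_bdry_right {D : Type} {M : MarkedMap d D}
    (h : M.IsNPM (π₁ ++ e :: e.symm :: π₂) K) : M.edge (M.bdry (π₁.length + 1)) = e.symm := by
  rw [h.edge_bdry (by simp)]
  simp

/-- The merged map of a map that is not counted by `NPMTwoGon` is of the same kind. -/
theorem MarkedMap.IsNPM.merge {D : Type} [Finite D] {M : MarkedMap d D}
    (h : M.IsNPM (π₁ ++ e :: e.symm :: π₂) K) (h2 : ¬ M.IsTwoGonAt π₁.length) :
    (M.merge π₁.length).IsNPM (π₁ ++ e :: e.symm :: π₂) K ∧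
      ∃ m, 2 ≤ m ∧
        (M.merge π₁.length).degree ((M.merge π₁.length).face ((M.merge π₁.length).inner π₁.length)) =
          2 * m := by
  have he := edge_bdry_left h
  have he' := edge_bdry_right h
  by_cases hfree : M.Free π₁.length
  · rw [hfree.merge_eq]
    obtain ⟨m, hm⟩ := h.blueCollapse.even_degree (M.inner_notMem π₁.length)
    refine ⟨h, m, ?_, by omega⟩
    have h3 := degree_pos (M.face (M.inner π₁.length))
    -- At a free tip, degree two would mean the excluded 2-gon. In the other case below two positive
    -- half-degrees are added, so the sum is at least two.
    have h4 : m ≠ 1 := by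
      rintro rfl
      exact h2 ((isTwoGonAt_iff he he').2 ⟨hfree, hm⟩)
    omega
  · have hmg := h.mergeable he he' hfree
    refine ⟨hmg.isNPM_iff.2 h, ?_⟩
    obtain ⟨m, hm⟩ := h.blueCollapse.even_degree (M.inner_notMem π₁.length)
    obtain ⟨m', hm'⟩ := h.blueCollapse.even_degree (M.outer_notMem π₁.length)
    have h3 := degree_pos (M.face (M.inner π₁.length))
    have h4 := degree_pos (M.face (M.outer π₁.length))
    refine ⟨m + m', by omega, ?_⟩
    rw [merge_inner]
    have := hmg.degree_merged
    change (M.merge π₁.length).degree ((M.merge π₁.length).face (M.inner π₁.length)) = _ at this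
    omega

/-- The sum is taken fibre by fibre of `mergeClass`. Area is constant on a fibre, and the weights in
each fibre cancel by the Catalan recursion. -/
theorem sum_weight_eq_zero (β : ℝ) (hbal : IsBalanced (π₁ ++ e :: e.symm :: π₂) K) :
    ∑ᶠ c ∈ NPM (π₁ ++ e :: e.symm :: π₂) K \ NPMTwoGon (π₁ ++ e :: e.symm :: π₂) K π₁.length,
      β ^ c.area * c.weight = 0 := by
  classical
  set l := π₁ ++ e :: e.symm :: π₂ with hl
  set k := π₁.length with hk
  have hfin : (NPM l K \ NPMTwoGon l K k).Finite := (NPM_finite l K).subset Set.sdiff_subset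
  rw [finsum_mem_eq_finite_toFinset_sum _ hfin,
    ← Finset.sum_fiberwise_of_maps_to (t := hfin.toFinset.image (mergeClass k)) (g := mergeClass k)
      (fun c hc => Finset.mem_image_of_mem _ hc)]
  refine Finset.sum_eq_zero fun a ha => ?_
  obtain ⟨c, hc, rfl⟩ := Finset.mem_image.1 ha
  rw [Set.Finite.mem_toFinset] at hc
  obtain ⟨⟨-, ⟨n, M₀⟩, rfl, hM₀⟩, hc⟩ := hc
  have hM₀' : ¬ M₀.IsTwoGonAt k := fun hh => hc ⟨hbal, _, rfl, hM₀, hh⟩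
  obtain ⟨hM, m, hm2, hm⟩ := hM₀.merge hM₀'
  rw [← hk] at hM hm
  have hfree : (M₀.merge k).Free k := M₀.free_merge k
  change ∑ c ∈ hfin.toFinset with mergeClass k c =
    Quotient.mk (mapSetoid d) ⟨n, M₀.merge k⟩, _ = _
  -- From here on only three properties of the merged map matter: it is counted, its tip is free,
  -- and the blue face there has degree `2 * m` with `m ≥ 2`.
  generalize M₀.merge k = M at hM hm hfree
  have hb := hM.blueCollapse
  have hp : Function.minimalPeriod M.next (M.inner k) = 2 * m := by rw [← M.degree_face, hm]
  have he := edge_bdry_left hM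
  have he' := edge_bdry_right hM
  let cl : ℕ → MapClass d := fun i => Quotient.mk (mapSetoid d) ⟨n, hb.split k i⟩
  have hfib : (hfin.toFinset.filter fun c => mergeClass k c = Quotient.mk (mapSetoid d) ⟨n, M⟩) =
      (Finset.range m).image cl := by
    ext c
    rw [Finset.mem_filter, Set.Finite.mem_toFinset, Finset.mem_image]
    constructor
    -- A map `N` in the fibre is recovered from its merged map by exchanging the same two darts
    -- again. Transported to `M`, these are `inner` and some dart `j` steps further on the same blue
    -- face.
    · rintro ⟨⟨⟨-, ⟨n', N⟩, rfl, hN⟩, -⟩, hcM⟩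
      obtain ⟨f⟩ : Nonempty ((N.merge k).Iso M) := Quotient.exact hcM
      have hin : f.toEquiv (N.inner k) = M.inner k := by
        rw [← N.merge_inner k]
        exact f.map_inner k
      have hface : M.face (M.inner k) = M.face (f.toEquiv (N.outer k)) := by
        rw [← hin, f.face_eq_iff]
        by_cases hNf : N.Free k
        · rw [(N.free_iff k).1 hNf]
        · exact (hN.mergeable (edge_bdry_left hN) (edge_bdry_right hN) hNf).face_merged
      obtain ⟨j, hj, hj'⟩ := sameCycle_iff_iterate.1 (M.face_eq_iff.1 hface)
      have hpos : M.pos (M.rev (M.inner k)) = M.pos (M.rev (f.toEquiv (N.outer k))) := by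
        rw [← hin, ← f.map_rev, ← f.map_rev, f.map_pos, f.map_pos]
        exact N.pos_inner_outer k
      -- For odd `j` the second dart would end at the start of `inner`, whereas both end at the tip.
      have hev : Even j := by
        by_contra hodd
        have h1 := hb.edge_iterate (M.inner_notMem k) j
        rw [if_neg hodd, hj'] at h1
        have h2 : M.pos (M.rev (f.toEquiv (N.outer k))) = M.pos (M.inner k) :=
          congrArg (fun e : LatticeEdge d => e.snd) h1
        rw [← hpos] at h2
        exact M.pos_rev_ne _ h2.symm
      obtain ⟨i, rfl⟩ := hev
      refine ⟨i, Finset.mem_range.2 (by omega), ?_⟩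
      apply Quotient.sound
      have hN2 : (N.merge k).swapNext (N.inner k) (N.outer k) (N.inner_notMem k) (N.outer_notMem k)
          (N.pos_inner_outer k) = N := N.swapNext_swapNext _ _ _
      have f' := MarkedMap.swapNextIso (M := N.merge k) (N.inner_notMem k) (N.outer_notMem k) (N.pos_inner_outer k) f hin
        (by rw [← hj', ← two_mul]) (M.inner_notMem k) (MarkedMap.iterate_inner_notMem k (2 * i))
        (hb.pos_rev_iterate k i)
      rw [hN2] at f'
      exact ⟨f'.symm⟩
    · rintro ⟨i, hi, rfl⟩
      rw [Finset.mem_range] at hi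
      have hi' : 2 * i < Function.minimalPeriod M.next (M.inner k) := by omega
      have hS : (hb.split k i).IsNPM l K := hM.split hb hfree hi'
      refine ⟨⟨⟨hbal, _, rfl, hS⟩, fun hh => ?_⟩, ?_⟩
      -- No member is a 2-gon map: the map that is not split has degree `2 * m > 2` at the tip, and
      -- the tip of a split map is not free.
      · have htwo := ((mk_mem_NPMTwoGon hbal).1 hh).2
        change (hb.split k i).IsTwoGonAt k at htwo
        rw [MarkedMap.isTwoGonAt_iff (edge_bdry_left hS) (edge_bdry_right hS)] at htwo
        rcases Nat.eq_zero_or_pos i with rfl | hi0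
        · rw [hb.split_zero, hm] at htwo
          omega
        · exact hb.not_free_split hfree hi0 hi' htwo.1
      · change Quotient.mk (mapSetoid d) ⟨n, (hb.split k i).merge k⟩ = _
        rw [hb.merge_split hfree]
  -- An isomorphism between two splittings induces an automorphism of `M`, which is the identity by
  -- rigidity. The two `outer` darts then coincide, and with them the indices.
  have hinj : Set.InjOn cl (Finset.range m) := by
    intro i hi j hj hij
    rw [Finset.coe_range, Set.mem_Iio] at hi hj
    obtain ⟨f⟩ : Nonempty ((hb.split k i).Iso (hb.split k j)) := Quotient.exact hij
    have key : ∀ P Q : MarkedMap d (Fin n), P = M → Q = M → ∀ g : P.Iso Q,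
        g.toEquiv = Equiv.refl _ := by
      intro P Q hP hQ g
      subst hP
      subst hQ
      exact g.ext_of_connected (MarkedMap.Iso.refl _) hM.connected
    have hf : f.toEquiv = Equiv.refl _ :=
      key _ _ (hb.merge_split hfree) (hb.merge_split hfree) (f.merge k)
    have hout := f.map_outer k
    rw [hf, hb.split_outer hfree, hb.split_outer hfree] at hout
    have := (Function.iterate_eq_iterate_iff_of_lt_minimalPeriod (by omega) (by omega)).1 hout
    omega
  rw [hfib, Finset.sum_image hinj]
  have hterm : ∀ i ∈ Finset.Ico 1 m, β ^ (cl i).area * (cl i).weight =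
      β ^ M.area * (M.weight / catalanWeight m) * (catalanWeight (m - i) * catalanWeight i) := by
    intro i hi
    rw [Finset.mem_Ico] at hi
    change β ^ (hb.split k i).area * (hb.split k i).weight = _
    rw [hb.weight_split hfree hm (by omega) hi.2, hb.area_split hfree (by omega) (by omega)]
    ring
  -- The term i = 0 is `M` itself and supplies w_m; the other terms supply the products.
  rw [Finset.range_eq_Ico, Finset.sum_eq_sum_Ico_succ_bot (by omega), Finset.sum_congr rfl hterm,
    ← Finset.mul_sum]
  have h0 : cl 0 = Quotient.mk (mapSetoid d) ⟨n, M⟩ := by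
    change Quotient.mk (mapSetoid d) ⟨n, hb.split k 0⟩ = _
    rw [hb.split_zero]
  rw [h0]
  change β ^ M.area * M.weight + _ = 0
  have hrec := catalanWeight_add_sum hm2
  have hne := catalanWeight_ne_zero m
  rw [eq_neg_of_add_eq_zero_right hrec]
  field_simp
  ring

end Cancellation

/-! ### Inserting a two-gon at a corner of the external face -/

/-- The darts of a two-gon: the number of the edge, and whether the dart is yellow. -/
abbrev TwoGonDart := Bool × Bool

/-- Reversal of the darts of a two-gon. -/
def twoGonRev : Perm TwoGonDart := ⟨fun q => (q.1, !q.2), fun q => (q.1, !q.2), by decide, by decide⟩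

/-- Rotation around the faces of a two-gon. -/
def twoGonNext : Perm TwoGonDart := ⟨fun q => (!q.1, q.2), fun q => (!q.1, q.2), by decide, by decide⟩

theorem numCycles_eq_card {α β : Type*} {f : Perm α} (g : α → β) (hg : Function.Surjective g)
    (h : ∀ x y, f.SameCycle x y ↔ g x = g y) : numCycles f = Nat.card β :=
  Nat.card_congr (Equiv.ofBijective
    (Quotient.lift (s := orbits f) g fun x y hxy => (h x y).1 hxy)
    ⟨by
      intro p q hpq
      induction p using Quotient.inductionOn with | _ x
      induction q using Quotient.inductionOn with | _ y
      exact Quotient.sound ((h x y).2 hpq),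
    fun b => by
      obtain ⟨x, rfl⟩ := hg b
      exact ⟨Quotient.mk _ x, rfl⟩⟩)

theorem numCycles_twoGonRev : numCycles twoGonRev = 2 := by
  rw [numCycles_eq_card (Prod.fst : TwoGonDart → Bool) Prod.fst_surjective (by decide)]
  simp

theorem numCycles_twoGonNext : numCycles twoGonNext = 2 := by
  rw [numCycles_eq_card (Prod.snd : TwoGonDart → Bool) Prod.snd_surjective (by decide)]
  simp

theorem numCycles_twoGonVertex : numCycles (twoGonNext * twoGonRev) = 2 := by
  rw [numCycles_eq_card (fun q : TwoGonDart => xor q.1 q.2) (by decide) (by decide)]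
  simp

theorem sameCycle_sumCongr_inl {α β : Type*} [Finite α] [Finite β] {f : Perm α} {g : Perm β} {x : α}
    {z : α ⊕ β} :
    (Perm.sumCongr f g).SameCycle (Sum.inl x) z ↔ ∃ y, f.SameCycle x y ∧ Sum.inl y = z := by
  constructor
  · intro h
    refine sameCycle_forward (p := fun z => ∃ y, f.SameCycle x y ∧ Sum.inl y = z) ?_ h
      ⟨x, SameCycle.refl _ x, rfl⟩
    rintro _ ⟨y, hy, rfl⟩
    exact ⟨f y, sameCycle_apply_right.2 hy, rfl⟩
  · rintro ⟨y, hy, rfl⟩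
    refine sameCycle_forward (p := fun y => (Perm.sumCongr f g).SameCycle (Sum.inl x) (Sum.inl y))
      ?_ hy (SameCycle.refl _ _)
    intro y hy
    exact sameCycle_apply_right.2 hy

namespace MarkedMap

variable {D D' : Type}

open Classical in
/-- Insert a two-gon, sent to `e`, into the corner of the face of `p` that follows `p`. -/
noncomputable def insertTwoGon (M : MarkedMap d D) (p : D) (hp : p ∈ M.yellow) (e : LatticeEdge d)
    (he : e.fst = M.pos (M.next p)) (r : D ⊕ TwoGonDart)
    (hr : Sum.elim (· ∈ M.yellow) (fun q : TwoGonDart => q.2 = true) r) : MarkedMap d (D ⊕ TwoGonDart) where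
  rev := Perm.sumCongr M.rev twoGonRev
  -- The transposition opens the outer face of the 2-gon into the face of `p`: after `p` come the
  -- yellow darts `(false, true)` and `(true, true)`, then the old successor of `p`.
  next := Perm.sumCongr M.next twoGonNext * swap (Sum.inl p) (Sum.inr (true, true))
  rev_rev := by
    rintro (x | ⟨i, j⟩)
    · exact congrArg Sum.inl (M.rev_rev x)
    · simp [twoGonRev]
  rev_ne := by
    rintro (x | ⟨i, j⟩) h
    · exact M.rev_ne x (Sum.inl.inj h)
    · simp [twoGonRev] at h
  yellow := {y | Sum.elim (· ∈ M.yellow) (fun q : TwoGonDart => q.2 = true) y}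
  yellow_next := by
    intro y
    simp only [Set.mem_ofPred_eq, Perm.mul_apply]
    by_cases h1 : y = Sum.inl p
    · subst h1; simp [twoGonNext, hp]
    by_cases h2 : y = Sum.inr (true, true)
    · subst h2; simp [M.yellow_next, hp]
    rw [swap_apply_of_ne_of_ne h1 h2]
    rcases y with x | ⟨i, j⟩
    · simp [M.yellow_next]
    · simp [twoGonNext]
  yellow_rev := by
    rintro (x | ⟨i, j⟩)
    · exact M.yellow_rev x
    · simp [twoGonRev]
  -- The first edge runs along `e` on its yellow side and the second one along `e⁻¹`; the blue sides
  -- are their reversals.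
  pos := Sum.elim M.pos (fun q => if q.1 = q.2 then e.snd else e.fst)
  pos_vertex := by
    have key : ∀ y, Sum.elim M.pos (fun q : TwoGonDart => if q.1 = q.2 then e.snd else e.fst)
        ((Perm.sumCongr M.next twoGonNext * swap (Sum.inl p) (Sum.inr (true, true))) y) =
        Sum.elim M.pos (fun q : TwoGonDart => if q.1 = q.2 then e.snd else e.fst)
        (Perm.sumCongr M.rev twoGonRev y) := by
      intro y
      rw [Perm.mul_apply]
      by_cases h1 : y = Sum.inl p
      · subst h1; simp [twoGonNext, he, M.pos_next]
      by_cases h2 : y = Sum.inr (true, true)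
      · subst h2; simp [twoGonRev, he]
      rw [swap_apply_of_ne_of_ne h1 h2]
      rcases y with x | ⟨i, j⟩
      · simp [M.pos_next]
      · cases i <;> cases j <;> simp_all [twoGonRev, twoGonNext]
    intro y
    rw [key]
    rcases y with x | ⟨i, j⟩
    · simp [M.rev_rev]
    · simp [twoGonRev]
  pos_adj := by
    rintro (x | ⟨i, j⟩)
    · exact M.pos_adj x
    · cases i <;> cases j <;> simp [twoGonRev, e.adj, e.adj.symm]
  root := r
  root_mem := hr

section Insert

variable (M : MarkedMap d D) {p : D} (hp : p ∈ M.yellow) {e : LatticeEdge d}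
    (he : e.fst = M.pos (M.next p)) {r : D ⊕ TwoGonDart}
    (hr : Sum.elim (· ∈ M.yellow) (fun q : TwoGonDart => q.2 = true) r)

theorem insert_rev_inr (i j : Bool) :
    (M.insertTwoGon p hp e he r hr).rev (Sum.inr (i, j)) = Sum.inr (i, !j) := rfl

theorem insert_next_inl {x : D} (hx : x ≠ p) :
    (M.insertTwoGon p hp e he r hr).next (Sum.inl x) = Sum.inl (M.next x) := by
  classical
  simp [insertTwoGon, swap_apply_of_ne_of_ne, hx]

theorem insert_next_corner :
    (M.insertTwoGon p hp e he r hr).next (Sum.inl p) = Sum.inr (false, true) := by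
  simp [insertTwoGon, twoGonNext]

theorem insert_next_first :
    (M.insertTwoGon p hp e he r hr).next (Sum.inr (false, true)) = Sum.inr (true, true) := by
  classical
  simp [insertTwoGon, swap_apply_of_ne_of_ne, twoGonNext]

theorem insert_next_second :
    (M.insertTwoGon p hp e he r hr).next (Sum.inr (true, true)) = Sum.inl (M.next p) := by
  simp [insertTwoGon]

theorem insert_next_blue (i : Bool) :
    (M.insertTwoGon p hp e he r hr).next (Sum.inr (i, false)) = Sum.inr (!i, false) := by
  classical
  simp [insertTwoGon, swap_apply_of_ne_of_ne, twoGonNext]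

theorem insert_yellow_inr (i j : Bool) :
    Sum.inr (i, j) ∈ (M.insertTwoGon p hp e he r hr).yellow ↔ j = true := Iff.rfl

theorem insert_edge_inl (x : D) : (M.insertTwoGon p hp e he r hr).edge (Sum.inl x) = M.edge x := rfl

theorem insert_edge_first : (M.insertTwoGon p hp e he r hr).edge (Sum.inr (false, true)) = e := by
  apply SimpleGraph.Dart.ext
  simp [edge, insertTwoGon, twoGonRev]

theorem insert_edge_second :
    (M.insertTwoGon p hp e he r hr).edge (Sum.inr (true, true)) = e.symm := by
  apply SimpleGraph.Dart.ext
  simp [edge, insertTwoGon, twoGonRev]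
  rfl

theorem insert_edge_inr (q : TwoGonDart) :
    ((M.insertTwoGon p hp e he r hr).edge (Sum.inr q)).edge = e.edge := by
  have h : ∀ i, ((M.insertTwoGon p hp e he r hr).edge (Sum.inr (i, true))).edge = e.edge := by
    rintro (_ | _)
    · rw [insert_edge_first]
    · rw [insert_edge_second, SimpleGraph.Dart.edge_symm]
  obtain ⟨i, _ | _⟩ := q
  · rw [← h i, ← edge_rev_edge _ (Sum.inr (i, true))]
    rfl
  · exact h i

variable [Finite D]

theorem not_sameCycle_sumCongr : ¬ (Perm.sumCongr M.next twoGonNext).SameCycle (Sum.inl p)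
    (Sum.inr (true, true)) := by
  rw [sameCycle_sumCongr_inl]
  rintro ⟨y, -, h⟩
  cases h

theorem orbits_insert : orbits (M.insertTwoGon p hp e he r hr).next =
    glue (orbits (Perm.sumCongr M.next twoGonNext)) (Sum.inl p) (Sum.inr (true, true)) := by
  classical
  exact orbits_mul_swap M.not_sameCycle_sumCongr

/-- A separate 2-gon on a sphere has V = E = F = 2. Attaching it at a corner identifies one pair of
vertices and one pair of faces, so V, E and F grow by 1, 2 and 1. -/
theorem eulerChar_insert : (M.insertTwoGon p hp e he r hr).eulerChar = M.eulerChar := by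
  classical
  have h1 : numCycles (M.insertTwoGon p hp e he r hr).next + 1 = numCycles M.next + 2 := by
    rw [← numCycles_twoGonNext, ← numCycles_sumCongr]
    exact numCycles_mul_swap M.not_sameCycle_sumCongr
  have h2 : numCycles (M.insertTwoGon p hp e he r hr).rev = numCycles M.rev + 2 := by
    rw [← numCycles_twoGonRev, ← numCycles_sumCongr]
    rfl
  have h3 : numCycles ((M.insertTwoGon p hp e he r hr).next *
      (M.insertTwoGon p hp e he r hr).rev) + 1 = numCycles (M.next * M.rev) + 2 := by
    have h4 : (M.insertTwoGon p hp e he r hr).next * (M.insertTwoGon p hp e he r hr).rev =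
        Perm.sumCongr (M.next * M.rev) (twoGonNext * twoGonRev) *
          swap (Sum.inl (M.rev p)) (Sum.inr (true, false)) := by
      have h5 : Perm.sumCongr M.rev twoGonRev * swap (Sum.inl (M.rev p)) (Sum.inr (true, false)) =
          swap (Sum.inl p) (Sum.inr (true, true)) * Perm.sumCongr M.rev twoGonRev := by
        have h6 : (Sum.inl (M.rev p) : D ⊕ TwoGonDart) =
          Perm.sumCongr M.rev twoGonRev (Sum.inl p) := rfl
        have h7 : (Sum.inr (true, false) : D ⊕ TwoGonDart) =
          Perm.sumCongr M.rev twoGonRev (Sum.inr (true, true)) := rfl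
        have h8 : (Perm.sumCongr M.rev twoGonRev) * (Perm.sumCongr M.rev twoGonRev) = 1 :=
          (M.insertTwoGon p hp e he r hr).rev_mul_rev
        have hinv : (Perm.sumCongr M.rev twoGonRev)⁻¹ = Perm.sumCongr M.rev twoGonRev :=
          inv_eq_of_mul_eq_one_left h8
        rw [h6, h7, Equiv.swap_apply_apply, hinv, mul_assoc, ← mul_assoc, h8, one_mul]
      rw [← Perm.sumCongr_mul, mul_assoc, h5, ← mul_assoc]
      rfl
    rw [h4, ← numCycles_twoGonVertex, ← numCycles_sumCongr]
    refine numCycles_mul_swap ?_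
    rw [sameCycle_sumCongr_inl]
    rintro ⟨y, -, h⟩
    cases h
  rw [CombMap.eulerChar_eq, CombMap.eulerChar_eq]
  omega

theorem insert_face_inl_iff {x y : D} : (M.insertTwoGon p hp e he r hr).face (Sum.inl x) =
    (M.insertTwoGon p hp e he r hr).face (Sum.inl y) ↔ M.face x = M.face y := by
  simp only [CombMap.face_eq_iff]
  change orbits (M.insertTwoGon p hp e he r hr).next _ _ ↔ _
  have h1 : ∀ x y : D, orbits (Perm.sumCongr M.next twoGonNext) (Sum.inl x) (Sum.inl y) ↔
      M.next.SameCycle x y := by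
    intro x y
    change (Perm.sumCongr M.next twoGonNext).SameCycle _ _ ↔ _
    rw [sameCycle_sumCongr_inl]
    simp
  have h2 : ∀ (x : D) (q : TwoGonDart), ¬ orbits (Perm.sumCongr M.next twoGonNext) (Sum.inl x)
      (Sum.inr q) := by
    intro x q
    change ¬ (Perm.sumCongr M.next twoGonNext).SameCycle _ _
    rw [sameCycle_sumCongr_inl]
    simp
  rw [orbits_insert, glue_apply]
  simp only [h1, h2, or_false]
  refine ⟨?_, Or.inl⟩
  rintro (h | ⟨h, h'⟩)
  · exact h
  · exact h.trans h'.symm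

omit [Finite D] in
theorem insert_face_yellow (i : Bool) : (M.insertTwoGon p hp e he r hr).face (Sum.inr (i, true)) =
    (M.insertTwoGon p hp e he r hr).face (Sum.inl p) := by
  rw [← CombMap.face_next _ (Sum.inl p), insert_next_corner]
  cases i
  · rfl
  · rw [← CombMap.face_next _ (Sum.inr (false, true)), insert_next_first]

theorem sameYellow_insert (hpr : M.face p = M.externalFace)
    (hrr : r = Sum.inl M.root ∨ r = Sum.inr (false, true)) :
    SameYellow M (M.insertTwoGon p hp e he r hr) Sum.inl := by
  have hext : (M.insertTwoGon p hp e he r hr).externalFace =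
      (M.insertTwoGon p hp e he r hr).face (Sum.inl M.root) := by
    change (M.insertTwoGon p hp e he r hr).face r = _
    obtain rfl | rfl := hrr
    · rfl
    · rw [insert_face_yellow, insert_face_inl_iff, hpr]
      rfl
  exact
  { inj := Sum.inl_injective
    rev := fun _ => rfl
    yellow := fun _ => Iff.rfl
    pos := fun _ => rfl
    sameCycle := fun x => by
      rw [← CombMap.face_eq_iff, insert_face_inl_iff, M.face_next]
    next_internal := fun x _ hx' => insert_next_inl _ _ _ _ (by rintro rfl; exact hx' hpr)
    external := fun x => by
      rw [hext, insert_face_inl_iff]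
      rfl
    surj := by
      rintro (x | ⟨i, j⟩) hy hy'
      · exact ⟨x, rfl⟩
      · rw [insert_yellow_inr] at hy
        subst hy
        rw [insert_face_yellow, hext, ne_eq, insert_face_inl_iff, hpr] at hy'
        exact absurd rfl hy' }

-- The 2-gon hangs on the corner after `p`: an invariant set of `M` extends by treating all its
-- darts like `p`, and an invariant set of the larger map must treat them so.
omit [Finite D] in
theorem isConnected_insert_iff :
    (M.insertTwoGon p hp e he r hr).IsConnected ↔ M.IsConnected := by
  rw [CombMap.isConnected_iff, CombMap.isConnected_iff]
  constructor
  · intro h T hr' hn x y hx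
    refine h {z | Sum.elim (· ∈ T) (fun _ => p ∈ T) z} ?_ ?_ (Sum.inl x) (Sum.inl y) hx
    · rintro (z | ⟨i, j⟩)
      · exact hr' z
      · exact Iff.rfl
    · rintro (z | ⟨i, j⟩)
      · by_cases hz : z = p
        · subst hz
          rw [insert_next_corner]
          exact Iff.rfl
        · rw [insert_next_inl _ _ _ _ hz]
          exact hn z
      · rcases j with _ | _
        · rw [insert_next_blue]
          exact Iff.rfl
        · rcases i with _ | _
          · rw [insert_next_first]
            exact Iff.rfl
          · rw [insert_next_second]
            exact hn p
  · intro h T hr' hn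
    have h1 : Sum.inr (false, true) ∈ T ↔ Sum.inl p ∈ T := by
      rw [← hn (Sum.inl p), insert_next_corner]
    have h2 : Sum.inr (true, true) ∈ T ↔ Sum.inl p ∈ T := by
      rw [← h1, ← hn (Sum.inr (false, true)), insert_next_first]
    have h3 : Sum.inl (M.next p) ∈ T ↔ Sum.inl p ∈ T := by
      rw [← h2, ← hn (Sum.inr (true, true)), insert_next_second]
    have h4 : ∀ z, ∃ w, Sum.inl w ∈ T ↔ z ∈ T := by
      rintro (z | ⟨i, j⟩)
      · exact ⟨z, Iff.rfl⟩
      · refine ⟨p, ?_⟩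
        have h5 : ∀ i, Sum.inl p ∈ T ↔ Sum.inr (i, true) ∈ T := by
          rintro (_ | _)
          · exact h1.symm
          · exact h2.symm
        rcases j with _ | _
        · rw [h5 i, ← hr' (Sum.inr (i, true)), insert_rev_inr]
          rfl
        · exact h5 i
    intro x y hx
    obtain ⟨x', hx'⟩ := h4 x
    obtain ⟨y', hy'⟩ := h4 y
    rw [← hy']
    refine h (Sum.inl ⁻¹' T) (fun z => hr' (Sum.inl z)) ?_ x' y' (hx'.2 hx)
    intro z
    by_cases hz : z = p
    · subst hz
      exact h3
    · have := hn (Sum.inl z)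
      rw [insert_next_inl _ _ _ _ hz] at this
      exact this

omit [Finite D] in
theorem insert_commute {x : D} (hx : x ∉ M.yellow) : ∀ y, M.next.SameCycle x y →
    (M.insertTwoGon p hp e he r hr).next (Sum.inl y) = Sum.inl (M.next y) := by
  intro y hy
  refine insert_next_inl _ _ _ _ ?_
  rintro rfl
  exact hx ((M.yellow_sameCycle hy).2 hp)

theorem insert_face_blue_iff {i : Bool} {y : D ⊕ TwoGonDart} :
    (M.insertTwoGon p hp e he r hr).face y =
      (M.insertTwoGon p hp e he r hr).face (Sum.inr (i, false)) ↔ ∃ j, y = Sum.inr (j, false) := by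
  constructor
  · intro h
    refine sameCycle_forward (p := fun y => ∃ j, y = Sum.inr (j, false)) ?_
      (((M.insertTwoGon p hp e he r hr).face_eq_iff).1 h.symm) ⟨i, rfl⟩
    rintro _ ⟨j, rfl⟩
    exact ⟨!j, insert_next_blue _ _ _ _ j⟩
  · rintro ⟨j, rfl⟩
    by_cases hij : i = j
    · rw [hij]
    · rw [← CombMap.face_next _ (Sum.inr (j, false)), insert_next_blue, Bool.eq_not.2 hij]

theorem blueCollapse_insert_iff :
    (M.insertTwoGon p hp e he r hr).BlueCollapse ↔ M.BlueCollapse := by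
  constructor
  · intro h x hx y hy
    exact h (Sum.inl x) hx (Sum.inl y) ((M.insert_face_inl_iff hp he hr).2 hy)
  · intro h
    rintro (x | ⟨i, j⟩) hx y hy
    · obtain ⟨w, hw, rfl⟩ := sameCycle_of_commute (M.insert_commute hp he hr hx)
        ((CombMap.face_eq_iff _).1 hy.symm)
      exact h x hx w (M.face_eq_iff.2 hw).symm
    · rw [insert_yellow_inr, Bool.not_eq_true] at hx
      subst hx
      obtain ⟨j, rfl⟩ := (M.insert_face_blue_iff hp he hr).1 hy
      rw [insert_edge_inr, insert_edge_inr]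

/-- The yellow darts of the 2-gon belong to the face of `p` and always stay live. Its blue face is
attached to that face alone, so its removal disconnects nothing. -/
theorem isNonSeparable_insert_iff (hM : M.BlueCollapse) :
    (M.insertTwoGon p hp e he r hr).IsNonSeparable ↔ M.IsNonSeparable := by
  have hN := (M.blueCollapse_insert_iff hp he hr).2 hM
  rw [hM.isNonSeparable_iff, hN.isNonSeparable_iff]
  refine forall₂_congr fun e' _ => ?_
  have hlive : ∀ x, (M.insertTwoGon p hp e he r hr).Live e' (Sum.inl x) ↔ M.Live e' x :=
    fun _ => Iff.rfl
  have hy : ∀ i, (M.insertTwoGon p hp e he r hr).Live e' (Sum.inr (i, true)) := fun i => Or.inl rfl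
  have hpl : (M.insertTwoGon p hp e he r hr).Live e' (Sum.inl p) := Or.inl hp
  constructor
  · intro h T hn hr' x y hx hy hxT
    refine h {z | Sum.elim (· ∈ T) (fun _ => p ∈ T) z} ?_ ?_ (Sum.inl x) (Sum.inl y) hx hy hxT
    · rintro (z | ⟨i, j⟩) hz
      · by_cases hzp : z = p
        · subst hzp
          rw [insert_next_corner]
          exact Iff.rfl
        · rw [insert_next_inl _ _ _ _ hzp]
          exact hn z hz
      · rcases j with _ | _
        · rw [insert_next_blue]
          exact Iff.rfl
        · rcases i with _ | _
          · rw [insert_next_first]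
            exact Iff.rfl
          · rw [insert_next_second]
            exact hn p hpl
    · rintro (z | ⟨i, j⟩) hz hz'
      · exact hr' z hz hz'
      · exact Iff.rfl
  · intro h T hn hr'
    have h1 : Sum.inr (false, true) ∈ T ↔ Sum.inl p ∈ T := by
      rw [← hn (Sum.inl p) hpl, insert_next_corner]
    have h2 : Sum.inr (true, true) ∈ T ↔ Sum.inl p ∈ T := by
      rw [← h1, ← hn (Sum.inr (false, true)) (hy _), insert_next_first]
    have h3 : Sum.inl (M.next p) ∈ T ↔ Sum.inl p ∈ T := by
      rw [← h2, ← hn (Sum.inr (true, true)) (hy _), insert_next_second]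
    have h4 : ∀ z, (M.insertTwoGon p hp e he r hr).Live e' z →
        ∃ w, M.Live e' w ∧ (Sum.inl w ∈ T ↔ z ∈ T) := by
      rintro (z | ⟨i, j⟩) hz
      · exact ⟨z, hz, Iff.rfl⟩
      · refine ⟨p, hpl, ?_⟩
        have h5 : ∀ i, Sum.inl p ∈ T ↔ Sum.inr (i, true) ∈ T := by
          rintro (_ | _)
          · exact h1.symm
          · exact h2.symm
        rcases j with _ | _
        · rw [h5 i, ← hr' (Sum.inr (i, true)) (hy i) hz, insert_rev_inr]
          rfl
        · exact h5 i
    intro x y hx hy' hxT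
    obtain ⟨x', hx', hx''⟩ := h4 x hx
    obtain ⟨y', hyl, hy''⟩ := h4 y hy'
    rw [← hy'']
    refine h (Sum.inl ⁻¹' T) ?_ (fun z hz hz' => hr' (Sum.inl z) hz hz') x' y' hx' hyl (hx''.2 hxT)
    intro z hz
    by_cases hzp : z = p
    · subst hzp
      exact h3
    · have := hn (Sum.inl z) hz
      rw [insert_next_inl _ _ _ _ hzp] at this
      exact this

theorem degree_insert : (M.insertTwoGon p hp e he r hr).degree
    ((M.insertTwoGon p hp e he r hr).face (Sum.inr (false, false))) = 2 := by
  have h : {y | (M.insertTwoGon p hp e he r hr).face y =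
      (M.insertTwoGon p hp e he r hr).face (Sum.inr (false, false))} =
      {Sum.inr (false, false), Sum.inr (true, false)} := by
    ext y
    rw [Set.mem_ofPred_eq, insert_face_blue_iff]
    simp
  change ({y | (M.insertTwoGon p hp e he r hr).face y =
      (M.insertTwoGon p hp e he r hr).face (Sum.inr (false, false))}).ncard = 2
  rw [h, Set.ncard_pair]
  simp

/-- The only new blue face has degree two, and w_1 = 1; the other blue faces are untouched because
the insertion takes place in a yellow corner. -/
theorem weight_insert : (M.insertTwoGon p hp e he r hr).weight = M.weight := by
  set N := M.insertTwoGon p hp e he r hr with hN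
  set R : Set N.Face := {f | N.IsBlue f ∧ f ≠ N.face (Sum.inr (false, false))} with hR
  have h2 : {f : N.Face | N.IsBlue f} = insert (N.face (Sum.inr (false, false))) R := by
    ext f
    simp only [Set.mem_ofPred_eq, Set.mem_insert_iff, hR]
    constructor
    · intro hf
      tauto
    · rintro (rfl | hf)
      · exact N.isBlue_face.2 (by rw [hN, insert_yellow_inr]; simp)
      · exact hf.1
  have hs : ∀ x, N.next.SameCycle (Sum.inl x) (Sum.inl (M.next x)) := fun x => by
    rw [← CombMap.face_eq_iff, insert_face_inl_iff, M.face_next]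
  have hbij : Set.BijOn (faceMap (φ := Sum.inl) hs) {f : M.Face | M.IsBlue f} R := by
    refine ⟨?_, ?_, ?_⟩
    · intro f hf
      obtain ⟨x, rfl⟩ := M.exists_face f
      refine ⟨N.isBlue_face.2 (M.isBlue_face.1 hf), fun hh => ?_⟩
      obtain ⟨j, hj⟩ := (M.insert_face_blue_iff hp he hr).1 hh
      cases hj
    · intro f hf g hg hfg
      obtain ⟨x, rfl⟩ := M.exists_face f
      obtain ⟨y, rfl⟩ := M.exists_face g
      exact (M.insert_face_inl_iff hp he hr).1 hfg
    · intro g hg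
      obtain ⟨x | ⟨i, j⟩, rfl⟩ := N.exists_face g
      · exact ⟨M.face x, M.isBlue_face.2 (N.isBlue_face.1 hg.1), rfl⟩
      · have hb := N.isBlue_face.1 hg.1
        rw [hN, insert_yellow_inr, Bool.not_eq_true] at hb
        subst hb
        exact absurd ((M.insert_face_blue_iff hp he hr).2 ⟨i, rfl⟩) hg.2
  have h3 : ∏ᶠ f ∈ {f : M.Face | M.IsBlue f}, faceWeight (M.degree f) =
      ∏ᶠ f ∈ R, faceWeight (N.degree f) := by
    refine finprod_mem_eq_of_bijOn _ hbij fun f hf => ?_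
    obtain ⟨x, rfl⟩ := M.exists_face f
    congr 1
    exact (degree_of_commute (N := N) Sum.inl_injective
      (M.insert_commute hp he hr (M.isBlue_face.1 hf))).symm
  rw [weight_eq_finprod, weight_eq_finprod, h2, finprod_mem_insert, h3,
    show N.degree (N.face (Sum.inr (false, false))) = 2 from M.degree_insert hp he hr]
  · simp [faceWeight, catalanWeight]
  · exact fun hh => hh.2 rfl
  · exact Set.toFinite _

end Insert

end MarkedMap

/-! ### The boundary after the insertion of a 2-gon -/

namespace MarkedMap

variable {D D' : Type}

theorem iterate_of_cycle {f : Perm D} {s : ℕ → D} {n : ℕ} (hn : 0 < n)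
    (hs : ∀ i, i + 1 < n → f (s i) = s (i + 1)) (hlast : f (s (n - 1)) = s 0)
    (hne : ∀ i, 0 < i → i < n → s i ≠ s 0) :
    Function.minimalPeriod f (s 0) = n ∧ ∀ i < n, f^[i] (s 0) = s i := by
  have h1 : ∀ i < n, f^[i] (s 0) = s i := by
    intro i
    induction i with
    | zero => exact fun _ => rfl
    | succ i ih =>
      intro hi
      rw [Function.iterate_succ_apply', ih (by omega), hs i hi]
  refine ⟨?_, h1⟩
  have h2 : Function.IsPeriodicPt f n (s 0) := by
    have h3 := h1 (n - 1) (by omega)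
    have h4 : n = (n - 1) + 1 := by omega
    rw [h4]
    change f^[n - 1 + 1] (s 0) = s 0
    rw [Function.iterate_succ_apply', h3, hlast]
  by_contra hne'
  have h3 := h2.minimalPeriod_le hn
  have h4 := h2.minimalPeriod_pos hn
  refine hne _ h4 (by omega) ?_
  rw [← h1 _ (by omega), Function.iterate_minimalPeriod]

theorem bdry_zero (M : MarkedMap d D) : M.bdry 0 = M.root := rfl

theorem bdry_period (M : MarkedMap d D) :
    M.bdry (Function.minimalPeriod M.next M.root) = M.root := Function.iterate_minimalPeriod

/-- Indices up to the period itself are admitted, since an insertion after the last boundary edge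
(empty `π₂`) has `k` equal to the period and `bdry k` equal to the root. -/
theorem bdry_inj (M : MarkedMap d D) {i j : ℕ} (hi : i ≤ Function.minimalPeriod M.next M.root)
    (hj : j ≤ Function.minimalPeriod M.next M.root) (h : M.bdry i = M.bdry j) :
    i = j ∨ (i = 0 ∧ j = Function.minimalPeriod M.next M.root) ∨
      (j = 0 ∧ i = Function.minimalPeriod M.next M.root) := by
  have key : ∀ i j, i < Function.minimalPeriod M.next M.root →
      j < Function.minimalPeriod M.next M.root → M.bdry i = M.bdry j → i = j := fun i j hi hj h =>
    (Function.iterate_eq_iterate_iff_of_lt_minimalPeriod hi hj).1 h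
  rcases hi.lt_or_eq with hi | rfl <;> rcases hj.lt_or_eq with hj | rfl
  · exact Or.inl (key i j hi hj h)
  · rw [bdry_period, ← bdry_zero] at h
    exact Or.inr (Or.inl ⟨key i 0 hi (by omega) h, rfl⟩)
  · rw [bdry_period, ← bdry_zero] at h
    exact Or.inr (Or.inr ⟨(key 0 j (by omega) hj h).symm, rfl⟩)
  · exact Or.inl rfl

theorem face_bdry (M : MarkedMap d D) (k : ℕ) : M.face (M.bdry k) = M.externalFace :=
  M.face_iterate _ _

theorem pos_corner (M : MarkedMap d D) {k : ℕ} {e : LatticeEdge d} (he : e.fst = M.pos (M.bdry k)) :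
    e.fst = M.pos (M.next (M.next.symm (M.bdry k))) := by
  rw [Equiv.apply_symm_apply, he]

theorem corner_mem (M : MarkedMap d D) (k : ℕ) : M.next.symm (M.bdry k) ∈ M.yellow := by
  rw [← M.yellow_next, Equiv.apply_symm_apply]
  exact M.bdry_mem k

/-- The root after the insertion of a two-gon before the boundary dart number `k`. -/
def insertRoot (M : MarkedMap d D) (k : ℕ) : D ⊕ TwoGonDart :=
  -- For `k = 0` and for `k` equal to the boundary length the corner is the same; only the root
  -- distinguishes a backtrack at the start of the word from one at its end.
  if k = 0 then Sum.inr (false, true) else Sum.inl M.root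

theorem insertRoot_mem (M : MarkedMap d D) (k : ℕ) :
    Sum.elim (· ∈ M.yellow) (fun q : TwoGonDart => q.2 = true) (M.insertRoot k) := by
  unfold insertRoot
  split_ifs
  · rfl
  · exact M.root_mem

/-- Insert a two-gon, sent to `e`, before the boundary dart number `k`. -/
noncomputable def insertAt (M : MarkedMap d D) (k : ℕ) (e : LatticeEdge d)
    (he : e.fst = M.pos (M.bdry k)) : MarkedMap d (D ⊕ TwoGonDart) :=
  M.insertTwoGon (M.next.symm (M.bdry k)) (M.corner_mem k) e (M.pos_corner he) (M.insertRoot k)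
    (M.insertRoot_mem k)

section InsertAt

variable (M : MarkedMap d D) {k : ℕ} {e : LatticeEdge d} (he : e.fst = M.pos (M.bdry k))

theorem insertAt_root : (M.insertAt k e he).root = M.insertRoot k := rfl

theorem insertAt_next_second :
    (M.insertAt k e he).next (Sum.inr (true, true)) = Sum.inl (M.bdry k) := by
  rw [insertAt, insert_next_second, Equiv.apply_symm_apply]

theorem insertAt_next_corner :
    (M.insertAt k e he).next (Sum.inl (M.next.symm (M.bdry k))) = Sum.inr (false, true) :=
  insert_next_corner _ _ _ _

theorem insertAt_next_inl {x : D} (hx : x ≠ M.next.symm (M.bdry k)) :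
    (M.insertAt k e he).next (Sum.inl x) = Sum.inl (M.next x) := insert_next_inl _ _ _ _ hx

theorem insertAt_next_bdry_of_ne {i : ℕ} (h : M.bdry (i + 1) ≠ M.bdry k) :
    (M.insertAt k e he).next (Sum.inl (M.bdry i)) = Sum.inl (M.bdry (i + 1)) := by
  rw [insertAt, insert_next_inl, bdry_succ]
  intro hh
  rw [bdry_succ, hh, Equiv.apply_symm_apply] at h
  exact h rfl

theorem insertAt_next_bdry {i : ℕ} (h : M.bdry (i + 1) = M.bdry k) :
    (M.insertAt k e he).next (Sum.inl (M.bdry i)) = Sum.inr (false, true) := by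
  have : M.bdry i = M.next.symm (M.bdry k) := by
    rw [Equiv.eq_symm_apply, ← bdry_succ, h]
  rw [this, insertAt, insert_next_corner]

variable [Finite D]

/-- The boundary darts after the insertion. -/
def insertSeq (k i : ℕ) : D ⊕ TwoGonDart :=
  if i < k then Sum.inl (M.bdry i) else if i = k then Sum.inr (false, true) else
    if i = k + 1 then Sum.inr (true, true) else Sum.inl (M.bdry (i - 2))

theorem insertAt_boundary (hk : k ≤ Function.minimalPeriod M.next M.root) :
    Function.minimalPeriod (M.insertAt k e he).next (M.insertRoot k) =
      Function.minimalPeriod M.next M.root + 2 ∧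
    ∀ i < Function.minimalPeriod M.next M.root + 2,
      (M.insertAt k e he).bdry i = M.insertSeq k i := by
  set n := Function.minimalPeriod M.next M.root with hn
  have hn0 : 0 < n := M.minimalPeriod_pos M.root
  have h0 : M.insertSeq k 0 = M.insertRoot k := by
    unfold insertSeq insertRoot
    rcases Nat.eq_zero_or_pos k with rfl | h
    · simp
    · simp [h, h.ne', bdry_zero]
  have hn1 : M.bdry n = M.bdry 0 := M.bdry_period
  have hinj : ∀ {i j}, i ≤ n → j ≤ n → M.bdry i = M.bdry j → i = j ∨ (i = 0 ∧ j = n) ∨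
    (j = 0 ∧ i = n) := fun hi hj h => M.bdry_inj hi hj h
  have key := iterate_of_cycle (f := (M.insertAt k e he).next) (s := M.insertSeq k) (n := n + 2)
    (by omega) ?_ ?_ ?_
  · rw [h0] at key
    exact key
  · intro i hi
    unfold insertSeq
    rcases lt_trichotomy (i + 1) k with h | h | h
    · rw [if_pos (by omega), if_pos h, insertAt_next_bdry_of_ne]
      intro hh
      have := hinj (by omega) hk hh
      omega
    · rw [if_pos (by omega), if_neg (by omega), if_pos h, insertAt_next_bdry]
      rw [h]
    · rcases lt_trichotomy i (k + 1) with h' | h' | h'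
      · obtain rfl : i = k := by omega
        rw [if_neg (by omega), if_pos rfl, if_neg (by omega), if_neg (by omega), if_pos rfl]
        exact insert_next_first _ _ _ _
      · subst h'
        rw [if_neg (by omega), if_neg (by omega), if_pos rfl, if_neg (by omega), if_neg (by omega),
          if_neg (by omega), insertAt_next_second]
        rfl
      · rw [if_neg (by omega), if_neg (by omega), if_neg (by omega), if_neg (by omega),
          if_neg (by omega), if_neg (by omega), insertAt_next_bdry_of_ne]
        · congr 2
          omega
        · intro hh
          have := hinj (by omega) hk hh
          omega
  · rw [h0]
    unfold insertSeq insertRoot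
    rw [if_neg (by omega), if_neg (by omega)]
    by_cases h1 : k = n
    -- Insertion at the very end: the last boundary dart is the second one of the 2-gon, and it
    -- leads back to the old root.
    · subst h1
      rw [if_pos (by omega), if_neg (by omega), insertAt_next_second, hn1]
      rfl
    · rw [if_neg (by omega)]
      have e1 : n + 2 - 1 - 2 + 1 = n := by omega
      by_cases h2 : k = 0
      · subst h2
        rw [if_pos rfl, insertAt_next_bdry]
        rw [e1, hn1]
      · rw [if_neg h2, insertAt_next_bdry_of_ne, e1, hn1]
        · rfl
        · rw [e1]
          intro hh
          have := hinj le_rfl hk hh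
          omega
  · intro i hi0 hi hh
    rw [h0] at hh
    unfold insertSeq insertRoot at hh
    rcases Nat.eq_zero_or_pos k with rfl | h
    · rw [if_pos rfl] at hh
      split_ifs at hh
      · omega
      · simp at hh
    · rw [if_neg h.ne', ← bdry_zero] at hh
      split_ifs at hh
      · have := hinj (by omega) (by omega) (Sum.inl.inj hh)
        omega
      · have := hinj (by omega) (by omega) (Sum.inl.inj hh)
        omega

theorem insertAt_faceWord (hk : k ≤ Function.minimalPeriod M.next M.root) :
    (M.insertAt k e he).faceWord (M.insertAt k e he).root =
      (M.faceWord M.root).take k ++ e :: e.symm :: (M.faceWord M.root).drop k := by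
  obtain ⟨h1, h2⟩ := M.insertAt_boundary he hk
  have hlen := M.faceWord_length M.root
  apply List.ext_getElem
  · rw [faceWord_length, insertAt_root, h1]
    simp only [List.length_append, List.length_take, List.length_cons, List.length_drop, hlen]
    omega
  · intro i hi hi'
    rw [faceWord_length, insertAt_root, h1] at hi
    rw [faceWord_getElem]
    change (M.insertAt k e he).edge ((M.insertAt k e he).bdry i) = _
    rw [h2 i hi]
    unfold insertSeq
    have hlt : ((M.faceWord M.root).take k).length = k := by
      rw [List.length_take, hlen]
      omega
    rcases lt_or_ge i k with h | h
    · rw [if_pos h, List.getElem_append_left (by omega), List.getElem_take, faceWord_getElem]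
      rfl
    · rw [if_neg (by omega), List.getElem_append_right (by omega)]
      simp only [hlt]
      rcases Nat.eq_or_lt_of_le h with rfl | h3
      · simp only [if_true, Nat.sub_self, List.getElem_cons_zero]
        exact insert_edge_first _ _ _ _
      · rw [if_neg (by omega)]
        obtain ⟨j, rfl⟩ := Nat.exists_eq_add_of_lt h3
        rcases Nat.eq_zero_or_pos j with rfl | hj
        · rw [if_pos (by omega)]
          simp only [show k + 0 + 1 - k = 1 by omega, List.getElem_cons_succ,
            List.getElem_cons_zero]
          exact insert_edge_second _ _ _ _
        · rw [if_neg (by omega)]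
          obtain ⟨j, rfl⟩ := Nat.exists_eq_add_of_lt hj
          simp only [show k + (0 + j + 1) + 1 - k = j + 2 by omega, List.getElem_cons_succ,
            List.getElem_drop, faceWord_getElem]
          rw [insertAt, insert_edge_inl]
          change M.edge (M.bdry _) = M.edge (M.bdry _)
          congr 2
          omega

theorem insertAt_bdry (hk : k ≤ Function.minimalPeriod M.next M.root) :
    (M.insertAt k e he).bdry k = Sum.inr (false, true) := by
  rw [(M.insertAt_boundary he hk).2 k (by omega), insertSeq, if_neg (by omega), if_pos rfl]

theorem insertAt_bdry_succ (hk : k ≤ Function.minimalPeriod M.next M.root) :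
    (M.insertAt k e he).bdry (k + 1) = Sum.inr (true, true) := by
  rw [(M.insertAt_boundary he hk).2 (k + 1) (by omega), insertSeq, if_neg (by omega),
    if_neg (by omega), if_pos rfl]

theorem sameYellow_insertAt : SameYellow M (M.insertAt k e he) Sum.inl := by
  refine M.sameYellow_insert _ _ _ ?_ ?_
  · rw [← M.face_next, Equiv.apply_symm_apply, face_bdry]
  · unfold insertRoot
    split_ifs
    · exact Or.inr rfl
    · exact Or.inl rfl

theorem isTwoGonAt_insertAt (hk : k ≤ Function.minimalPeriod M.next M.root) :
    (M.insertAt k e he).IsTwoGonAt k := by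
  have h1 : (M.insertAt k e he).blueFaceAt k =
      (M.insertAt k e he).face (Sum.inr (false, false)) := by
    change (M.insertAt k e he).face ((M.insertAt k e he).rev ((M.insertAt k e he).bdry k)) = _
    rw [M.insertAt_bdry he hk]
    rfl
  have h2 : (M.insertAt k e he).blueFaceAt (k + 1) =
      (M.insertAt k e he).face (Sum.inr (true, false)) := by
    change (M.insertAt k e he).face ((M.insertAt k e he).rev ((M.insertAt k e he).bdry (k + 1))) = _
    rw [M.insertAt_bdry_succ he hk]
    rfl
  refine ⟨?_, ?_⟩
  · rw [h1, h2]
    exact (M.insert_face_blue_iff _ _ _).2 ⟨false, rfl⟩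
  · rw [h1]
    exact M.degree_insert _ _ _

theorem isNPM_insertAt_iff {π₁ π₂ : List (LatticeEdge d)} {K : Plaquette d → ℕ}
    (he : e.fst = M.pos (M.bdry π₁.length)) (hk : π₁.length ≤ Function.minimalPeriod M.next M.root) :
    (M.insertAt π₁.length e he).IsNPM (π₁ ++ e :: e.symm :: π₂) K ↔ M.IsNPM (π₁ ++ π₂) K := by
  have hS := M.sameYellow_insertAt he
  have hw := M.insertAt_faceWord he hk
  have hB := M.blueCollapse_insert_iff (M.corner_mem _) (M.pos_corner he) (M.insertRoot_mem π₁.length)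
  constructor
  · intro h
    have hb := hB.1 h.blueCollapse
    refine ⟨(M.isConnected_insert_iff _ _ _).1 h.connected, ?_,
      ⟨hS.yellow_embedding_iff.1 h.embedding.1, hb⟩,
      fun p => by rw [← hS.card_plaquettes, h.plaquettes], ?_,
      (M.isNonSeparable_insert_iff _ _ _ hb).1 h.nonSeparable⟩
    · rw [← h.planar]
      exact (M.eulerChar_insert _ _ _).symm
    · rw [h.boundary] at hw
      have hlt : π₁.length = ((M.faceWord M.root).take π₁.length).length := by
        rw [List.length_take, M.faceWord_length]
        omega
      obtain ⟨h1, h2⟩ := List.append_inj hw hlt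
      rw [List.cons.injEq, List.cons.injEq] at h2
      rw [← List.take_append_drop π₁.length (M.faceWord M.root), ← h1, ← h2.2.2]
  · intro h
    have hb := hB.2 h.blueCollapse
    refine ⟨(M.isConnected_insert_iff _ _ _).2 h.connected, ?_,
      ⟨hS.yellow_embedding_iff.2 h.embedding.1, hb⟩,
      fun p => by rw [hS.card_plaquettes, h.plaquettes], ?_,
      (M.isNonSeparable_insert_iff _ _ _ h.blueCollapse).2 h.nonSeparable⟩
    · rw [← h.planar]
      exact M.eulerChar_insert _ _ _
    · rw [hw, h.boundary]
      simp

omit [Finite D] in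
theorem IsNPM.period {M : MarkedMap d D} {l : List (LatticeEdge d)} {K : Plaquette d → ℕ}
    (h : M.IsNPM l K) : Function.minimalPeriod M.next M.root = l.length := by
  rw [← M.faceWord_length, h.boundary]

end InsertAt

/-- Insertion is compatible with isomorphisms. -/
noncomputable def Iso.insertAt {M : MarkedMap d D} {N : MarkedMap d D'} (f : M.Iso N) {k : ℕ}
    {e : LatticeEdge d} (he : e.fst = M.pos (M.bdry k)) (he' : e.fst = N.pos (N.bdry k)) :
    (M.insertAt k e he).Iso (N.insertAt k e he') where
  toEquiv := Equiv.sumCongr f.toEquiv (Equiv.refl _)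
  map_rev := by
    rintro (x | q)
    · exact congrArg Sum.inl (f.map_rev x)
    · rfl
  map_next := by
    have hc : f.toEquiv (M.next.symm (M.bdry k)) = N.next.symm (N.bdry k) := by
      rw [f.map_next_symm, f.map_bdry]
    rintro (x | ⟨i, j⟩)
    · by_cases hx : x = M.next.symm (M.bdry k)
      · subst hx
        simp only [Equiv.sumCongr_apply, Sum.map_inl, hc]
        rw [MarkedMap.insertAt, MarkedMap.insertAt, insert_next_corner, insert_next_corner]
        rfl
      · have hx' : f.toEquiv x ≠ N.next.symm (N.bdry k) := by
          rw [← hc]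
          exact fun hh => hx (f.toEquiv.injective hh)
        simp only [Equiv.sumCongr_apply, Sum.map_inl]
        rw [MarkedMap.insertAt, MarkedMap.insertAt, insert_next_inl _ _ _ _ hx,
          insert_next_inl _ _ _ _ hx']
        exact congrArg Sum.inl (f.map_next x)
    · simp only [Equiv.sumCongr_apply, Sum.map_inr, Equiv.refl_apply]
      rcases j with _ | _
      · rw [MarkedMap.insertAt, MarkedMap.insertAt, insert_next_blue, insert_next_blue]
        rfl
      · rcases i with _ | _
        · rw [MarkedMap.insertAt, MarkedMap.insertAt, insert_next_first, insert_next_first]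
          rfl
        · rw [insertAt_next_second, insertAt_next_second]
          exact congrArg Sum.inl (f.map_bdry k)
  map_yellow := by
    rintro (x | q)
    · exact f.map_yellow x
    · exact Iff.rfl
  map_pos := by
    rintro (x | q)
    · exact f.map_pos x
    · rfl
  map_root := by
    rw [insertAt_root, insertAt_root]
    unfold insertRoot
    split_ifs
    · rfl
    · exact congrArg Sum.inl f.map_root

/-- A map is determined by the result of an insertion. -/
theorem iso_of_insertAt [Finite D] [Finite D'] {M : MarkedMap d D} {N : MarkedMap d D'} {k : ℕ}
    {e : LatticeEdge d} {he : e.fst = M.pos (M.bdry k)} {he' : e.fst = N.pos (N.bdry k)}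
    (hk : k ≤ Function.minimalPeriod M.next M.root) (hk' : k ≤ Function.minimalPeriod N.next N.root)
    (f : (M.insertAt k e he).Iso (N.insertAt k e he')) : Nonempty (M.Iso N) := by
  -- An isomorphism respects the numbering of the boundary, which fixes the yellow darts of the
  -- 2-gon, and the blue ones are their reversals.
  have h1 : ∀ q, f.toEquiv (Sum.inr q) = Sum.inr q := by
    have h2 : ∀ i, f.toEquiv (Sum.inr (i, true)) = Sum.inr (i, true) := by
      rintro (_ | _)
      · rw [← M.insertAt_bdry he hk, f.map_bdry, N.insertAt_bdry he' hk']
      · rw [← M.insertAt_bdry_succ he hk, f.map_bdry, N.insertAt_bdry_succ he' hk']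
    rintro ⟨i, _ | _⟩
    · have h3 : (Sum.inr (i, false) : D ⊕ TwoGonDart) =
        (M.insertAt k e he).rev (Sum.inr (i, true)) := rfl
      rw [h3, f.map_rev, h2]
      rfl
    · exact h2 i
  have h2 : ∀ x, ∃ y, f.toEquiv (Sum.inl x) = Sum.inl y := by
    intro x
    rcases hx : f.toEquiv (Sum.inl x) with y | q
    · exact ⟨y, rfl⟩
    · rw [← h1 q] at hx
      cases f.toEquiv.injective hx
  choose g hg using h2
  have hbij : Function.Bijective g := by
    constructor
    · intro x y hxy
      have : f.toEquiv (Sum.inl x) = f.toEquiv (Sum.inl y) := by rw [hg, hg, hxy]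
      exact Sum.inl.inj (f.toEquiv.injective this)
    · intro y
      obtain ⟨x | q, hx⟩ := f.toEquiv.surjective (Sum.inl y)
      · exact ⟨x, Sum.inl.inj ((hg x).symm.trans hx)⟩
      · rw [h1] at hx
        cases hx
  have hcorner : g (M.next.symm (M.bdry k)) = N.next.symm (N.bdry k) := by
    by_contra hne
    have h3 := f.map_next (Sum.inl (M.next.symm (M.bdry k)))
    rw [hg, insertAt_next_corner, insertAt_next_inl _ _ hne] at h3
    rw [h1] at h3
    cases h3
  have hk0 : g (M.bdry k) = N.bdry k := by
    have h3 := f.map_next (Sum.inr (true, true))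
    rw [h1, insertAt_next_second, insertAt_next_second, hg] at h3
    exact Sum.inl.inj h3
  refine ⟨⟨Equiv.ofBijective g hbij, ?_, ?_, ?_, ?_, ?_⟩⟩
  · intro x
    have h3 := f.map_rev (Sum.inl x)
    rw [hg] at h3
    change f.toEquiv (Sum.inl (M.rev x)) = _ at h3
    rw [hg] at h3
    exact Sum.inl.inj h3
  · intro x
    change g (M.next x) = N.next (g x)
    by_cases hx : x = M.next.symm (M.bdry k)
    · subst hx
      rw [hcorner, Equiv.apply_symm_apply, Equiv.apply_symm_apply, hk0]
    · have hx' : g x ≠ N.next.symm (N.bdry k) := by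
        rw [← hcorner]
        exact fun hh => hx (hbij.1 hh)
      have h3 := f.map_next (Sum.inl x)
      rw [hg, insertAt_next_inl _ _ hx, insertAt_next_inl _ _ hx', hg] at h3
      exact Sum.inl.inj h3
  · intro x
    have h3 := f.map_yellow (Sum.inl x)
    rw [hg] at h3
    exact h3
  · intro x
    have h3 := f.map_pos (Sum.inl x)
    rw [hg] at h3
    exact h3
  · change g M.root = N.root
    have h3 := f.map_root
    rw [insertAt_root, insertAt_root] at h3
    -- For `k = 0` the new root lies on the 2-gon, and the old root is recovered as the boundary
    -- dart that follows the 2-gon.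
    unfold insertRoot at h3
    by_cases hk1 : k = 0
    · subst hk1
      exact hk0
    · rw [if_neg hk1, if_neg hk1, hg] at h3
      exact Sum.inl.inj h3

end MarkedMap

namespace MarkedMap

variable {D D' : Type}

/-! ### Removing a two-gon -/

/-- The darts of a two-gon at the boundary darts number `k` and `k + 1`. -/
def twoGonDart (N : MarkedMap d D) (k : ℕ) (q : TwoGonDart) : D :=
  if q.2 then N.bdry (if q.1 then k + 1 else k) else N.rev (N.bdry (if q.1 then k + 1 else k))

theorem mem_range_iff_of_commute {f : Perm D} {g : TwoGonDart → D} {σ : Perm TwoGonDart}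
    (h : ∀ q, f (g q) = g (σ q)) (x : D) : f x ∉ Set.range g ↔ x ∉ Set.range g := by
  refine not_congr ⟨?_, ?_⟩
  · rintro ⟨q, hq⟩
    refine ⟨σ.symm q, f.injective ?_⟩
    rw [h, Equiv.apply_symm_apply, hq]
  · rintro ⟨q, rfl⟩
    exact ⟨σ q, (h q).symm⟩

/-- The boundary darts number `k` and `k + 1` bound a two-gon. -/
structure HasTwoGon (N : MarkedMap d D) (k : ℕ) : Prop where
  ne : N.bdry k ≠ N.bdry (k + 1)
  free : N.Free k
  next_far : N.next (N.rev (N.bdry k)) = N.inner k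

namespace HasTwoGon

theorem rev_twoGonDart (N : MarkedMap d D) (k : ℕ) (q : TwoGonDart) :
    N.rev (N.twoGonDart k q) = N.twoGonDart k (twoGonRev q) := by
  obtain ⟨i, _ | _⟩ := q
  · exact N.rev_rev _
  · rfl

variable {N : MarkedMap d D} {k : ℕ} (h : N.HasTwoGon k)

include h

theorem injective : Function.Injective (N.twoGonDart k) := by
  have h1 : ∀ i j, N.twoGonDart k (i, true) ≠ N.twoGonDart k (j, false) := fun i j hh =>
    N.rev_notMem (N.bdry_mem (if j then k + 1 else k))
      ((congrArg (· ∈ N.yellow) hh).mp (N.bdry_mem (if i then k + 1 else k)))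
  have h2 : ∀ i j, N.twoGonDart k (i, true) = N.twoGonDart k (j, true) → i = j := by
    rintro (_ | _) (_ | _) hh
    · rfl
    · exact absurd hh h.ne
    · exact absurd hh.symm h.ne
    · rfl
  rintro ⟨i, _ | _⟩ ⟨j, _ | _⟩ hh
  · rw [h2 i j (N.rev.injective hh)]
  · exact absurd hh.symm (h1 _ _)
  · exact absurd hh (h1 _ _)
  · rw [h2 i j hh]

open Classical in
/-- The rotation around faces that leaves out the two-gon. -/
noncomputable abbrev bypass (_ : N.HasTwoGon k) : Perm D :=
  N.next * swap (N.next.symm (N.bdry k)) (N.bdry (k + 1))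

theorem corner_ne : N.next.symm (N.bdry k) ≠ N.bdry k := by
  rw [ne_eq, Equiv.symm_apply_eq, ← bdry_succ]
  exact h.ne

/-- If the dart before `bdry k` were on the 2-gon it would be `bdry (k + 1)`, and the external face
would consist of these two darts alone. -/
theorem corner_notMem (hne : N.bdry (k + 2) ≠ N.bdry k) :
    N.next.symm (N.bdry k) ∉ Set.range (N.twoGonDart k) := by
  have h1 := N.corner_mem k
  rintro ⟨⟨i, _ | _⟩, hq⟩
  · rw [← hq] at h1
    exact N.rev_notMem (N.bdry_mem _) h1
  · rcases i with _ | _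
    · exact h.corner_ne hq.symm
    · apply hne
      have h2 : N.bdry (k + 1) = N.next.symm (N.bdry k) := hq
      rw [bdry_succ _ (k + 1), h2, Equiv.apply_symm_apply]

theorem bypass_corner : h.bypass (N.next.symm (N.bdry k)) = N.bdry (k + 2) := by
  classical
  rw [bypass, Perm.mul_apply, swap_apply_left, bdry_succ _ (k + 1)]

theorem bypass_of_ne {x : D} (h1 : x ≠ N.next.symm (N.bdry k)) (h2 : x ≠ N.bdry (k + 1)) :
    h.bypass x = N.next x := by
  classical
  rw [bypass, Perm.mul_apply, swap_apply_of_ne_of_ne h1 h2]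

/-- The transposition closes the 2-gon off as a component of its own, so that the remaining darts
are invariant and carry a map. -/
theorem bypass_twoGonDart (q : TwoGonDart) :
    h.bypass (N.twoGonDart k q) = N.twoGonDart k (twoGonNext q) := by
  have hc := N.corner_mem k
  obtain ⟨i, _ | _⟩ := q
  · have h1 : N.twoGonDart k (i, false) ∉ N.yellow := N.rev_notMem (N.bdry_mem _)
    rw [h.bypass_of_ne (by rintro hh; rw [hh] at h1; exact h1 hc)
      (by rintro hh; rw [hh] at h1; exact h1 (N.bdry_mem _))]
    cases i
    · exact h.next_far
    · exact h.free
  · cases i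
    · change h.bypass (N.bdry k) = N.bdry (k + 1)
      rw [h.bypass_of_ne h.corner_ne.symm h.ne, bdry_succ]
    · change h.bypass (N.bdry (k + 1)) = N.bdry k
      classical
      rw [bypass, Perm.mul_apply, swap_apply_right, Equiv.apply_symm_apply]

omit h in
theorem ne_of_notMem {x : D} (hx : x ∉ Set.range (N.twoGonDart k)) : x ≠ N.bdry (k + 1) := by
  rintro rfl
  exact hx ⟨(true, true), rfl⟩

theorem pos_far : N.pos (N.bdry (k + 2)) = N.pos (N.bdry k) := by
  have h1 := N.pos_next (N.rev (N.bdry k))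
  rw [h.next_far, N.rev_rev] at h1
  rw [bdry_succ _ (k + 1), N.pos_next]
  exact h1

/-- Remove a two-gon. -/
noncomputable def remove (r : D) (hr : r ∈ N.yellow) (hr' : r ∉ Set.range (N.twoGonDart k)) :
    MarkedMap d {x // x ∉ Set.range (N.twoGonDart k)} where
  rev := N.rev.subtypePerm (mem_range_iff_of_commute (HasTwoGon.rev_twoGonDart N k))
  next := h.bypass.subtypePerm (mem_range_iff_of_commute h.bypass_twoGonDart)
  rev_rev x := Subtype.ext (N.rev_rev x.1)
  rev_ne x hx := N.rev_ne x.1 (congrArg Subtype.val hx)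
  yellow := {x | x.1 ∈ N.yellow}
  yellow_next := by
    rintro ⟨x, hx⟩
    change h.bypass x ∈ N.yellow ↔ x ∈ N.yellow
    by_cases hxc : x = N.next.symm (N.bdry k)
    · subst hxc
      rw [h.bypass_corner]
      exact iff_of_true (N.bdry_mem _) (N.corner_mem k)
    · rw [h.bypass_of_ne hxc (ne_of_notMem hx), N.yellow_next]
  yellow_rev x := N.yellow_rev x.1
  pos x := N.pos x.1
  pos_vertex := by
    have key : ∀ x, x ∉ Set.range (N.twoGonDart k) → N.pos (h.bypass x) = N.pos (N.rev x) := by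
      intro x hx
      by_cases hxc : x = N.next.symm (N.bdry k)
      · subst hxc
        rw [h.bypass_corner, h.pos_far, ← N.pos_next, Equiv.apply_symm_apply]
      · rw [h.bypass_of_ne hxc (ne_of_notMem hx), N.pos_next]
    rintro ⟨x, hx⟩
    change N.pos (h.bypass (N.rev x)) = N.pos x
    rw [key _ ((mem_range_iff_of_commute (HasTwoGon.rev_twoGonDart N k) x).2 hx), N.rev_rev]
  pos_adj x := N.pos_adj x.1
  root := ⟨r, hr'⟩
  root_mem := hr

/-- Every map with a two-gon arises by an insertion. -/
theorem exists_insertAt [Finite D] (hk : k + 2 ≤ Function.minimalPeriod N.next N.root)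
    (hp : 2 < Function.minimalPeriod N.next N.root) {e : LatticeEdge d} (he : N.edge (N.bdry k) = e) (he' : N.edge (N.bdry (k + 1)) = e.symm) :
    ∃ (D' : Type) (_ : Finite D') (M : MarkedMap d D') (hM : e.fst = M.pos (M.bdry k)),
      k ≤ Function.minimalPeriod M.next M.root ∧ Nonempty ((M.insertAt k e hM).Iso N) := by
  have hinj : ∀ {i j}, i < Function.minimalPeriod N.next N.root →
      j < Function.minimalPeriod N.next N.root → N.bdry i = N.bdry j → i = j := fun hi hj hh =>
    (Function.iterate_eq_iterate_iff_of_lt_minimalPeriod hi hj).1 hh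
  have hne2 : N.bdry (k + 2) ≠ N.bdry k := fun hh => by
    have := N.bdry_inj hk (by omega) hh
    omega
  have hmem : ∀ i, i < Function.minimalPeriod N.next N.root → i ≠ k → i ≠ k + 1 →
      N.bdry i ∉ Set.range (N.twoGonDart k) := by
    rintro i hi hi1 hi2 ⟨⟨j, _ | _⟩, hq⟩
    · exact N.rev_notMem (N.bdry_mem (if j then k + 1 else k))
        ((congrArg (· ∈ N.yellow) hq).mpr (N.bdry_mem i))
    · cases j
      · exact hi1 (hinj hi (by omega) hq.symm)
      · exact hi2 (hinj hi (by omega) hq.symm)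
  -- For `k = 0` the old root disappears with the 2-gon, and the dart after the 2-gon takes its
  -- place.
  set r := if k = 0 then N.bdry (k + 2) else N.root with hr
  have hry : r ∈ N.yellow := by
    rw [hr]
    split_ifs
    · exact N.bdry_mem _
    · exact N.root_mem
  have hrm : r ∉ Set.range (N.twoGonDart k) := by
    rw [hr]
    split_ifs with hk0
    · exact hmem _ (by omega) (by omega) (by omega)
    · exact hmem 0 (by omega) (Ne.symm hk0) (by omega)
  set M := h.remove r hry hrm with hMdef
  have hnext : ∀ x : {x // x ∉ Set.range (N.twoGonDart k)}, (M.next x).1 = h.bypass x.1 :=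
    fun _ => rfl
  have hb : ∀ i < k, (M.bdry i).1 = N.bdry i := by
    intro i
    induction i with
    | zero =>
      intro hk0
      change r = N.root
      rw [hr, if_neg (by omega)]
    | succ i ih =>
      intro hi
      rw [bdry_succ, hnext, bypass_of_ne, ih (by omega), bdry_succ]
      · rw [ih (by omega), ne_eq, Equiv.eq_symm_apply, ← bdry_succ]
        intro hh
        have := hinj (by omega) (by omega) hh
        omega
      · exact ne_of_notMem (M.bdry i).2
  have hbk : (M.bdry k).1 = N.bdry (k + 2) := by
    rcases Nat.eq_zero_or_pos k with hk0 | hk0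
    · subst hk0
      rfl
    · obtain ⟨j, hj⟩ : ∃ j, k = j + 1 := ⟨k - 1, by omega⟩
      have hsucc : ∀ m, m = j + 1 → M.bdry m = M.next (M.bdry j) := by
        rintro m rfl
        exact M.bdry_succ j
      have hcj : N.bdry j = N.next.symm (N.bdry k) := by
        rw [Equiv.eq_symm_apply, ← bdry_succ, hj]
      rw [hsucc k hj, hnext, hb j (by omega), hcj, h.bypass_corner]
  have hcM : N.next.symm (N.bdry k) ∉ Set.range (N.twoGonDart k) := h.corner_notMem hne2
  have hcorner : M.next.symm (M.bdry k) = ⟨_, hcM⟩ := by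
    rw [Equiv.symm_apply_eq]
    apply Subtype.ext
    rw [hnext, h.bypass_corner, hbk]
  have hM : e.fst = M.pos (M.bdry k) := by
    change _ = N.pos (M.bdry k).1
    rw [hbk, h.pos_far, ← he]
    rfl
  -- If the new boundary closed before `k`, the original boundary, which agrees with it there, would
  -- repeat a dart too early.
  have hkM : k ≤ Function.minimalPeriod M.next M.root := by
    by_contra! hlt
    have h1 := M.minimalPeriod_pos M.root
    have h2 : M.bdry (Function.minimalPeriod M.next M.root) = M.bdry 0 := M.bdry_period
    have h3 : N.bdry (Function.minimalPeriod M.next M.root) = N.bdry 0 := by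
      rw [← hb _ hlt, h2, hb 0 (by omega)]
    have := hinj (by omega) (by omega) h3
    omega
  refine ⟨_, inferInstance, M, hM, hkM, ⟨⟨Equiv.ofBijective
    (Sum.elim Subtype.val (N.twoGonDart k)) ⟨?_, ?_⟩, ?_, ?_, ?_, ?_, ?_⟩⟩⟩
  · rintro (⟨x, hx⟩ | q) (⟨y, hy⟩ | q') hh
    · exact congrArg Sum.inl (Subtype.ext hh)
    · exact absurd ⟨q', Eq.symm hh⟩ hx
    · exact absurd ⟨q, hh⟩ hy
    · exact congrArg Sum.inr (h.injective hh)
  · intro x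
    by_cases hx : x ∈ Set.range (N.twoGonDart k)
    · obtain ⟨q, rfl⟩ := hx
      exact ⟨Sum.inr q, rfl⟩
    · exact ⟨Sum.inl ⟨x, hx⟩, rfl⟩
  · rintro (x | q)
    · rfl
    · exact (rev_twoGonDart N k q).symm
  · rintro (x | ⟨i, j⟩)
    · by_cases hx : x = M.next.symm (M.bdry k)
      · have h1 : (M.insertAt k e hM).next (Sum.inl x) = Sum.inr (false, true) := by
          rw [hx]
          exact M.insertAt_next_corner hM
        have h2 : x.1 = N.next.symm (N.bdry k) := by rw [hx, hcorner]
        rw [h1]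
        change N.bdry k = N.next x.1
        rw [h2, Equiv.apply_symm_apply]
      · rw [insertAt_next_inl _ _ hx]
        change (M.next x).1 = N.next x.1
        rw [hnext, h.bypass_of_ne _ (ne_of_notMem x.2)]
        intro hh
        apply hx
        rw [hcorner]
        exact Subtype.ext hh
    · rcases j with _ | _
      · rw [insertAt, insert_next_blue]
        cases i
        · exact h.next_far.symm
        · exact h.free.symm
      · cases i
        · rw [insertAt, insert_next_first]
          exact N.bdry_succ k
        · rw [insertAt_next_second]
          change (M.bdry k).1 = N.next (N.bdry (k + 1))
          rw [hbk, bdry_succ]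
  · rintro (x | ⟨i, j⟩)
    · exact Iff.rfl
    · rw [insertAt, insert_yellow_inr]
      change N.twoGonDart k (i, j) ∈ N.yellow ↔ _
      cases j
      · exact iff_of_false (N.rev_notMem (N.bdry_mem _)) (by simp)
      · exact iff_of_true (N.bdry_mem _) rfl
  · have h0 : N.pos (N.bdry k) = e.fst := by rw [← he]; rfl
    have h1 : N.pos (N.bdry (k + 1)) = e.snd := by
      rw [← N.edge_fst, he']
      rfl
    have h2 : N.pos (N.rev (N.bdry k)) = e.snd := by rw [← he]; rfl
    have h3 : N.pos (N.rev (N.bdry (k + 1))) = e.fst := by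
      rw [← N.edge_snd, he']
      rfl
    rintro (x | ⟨i, j⟩)
    · rfl
    · cases i <;> cases j
      · exact h2
      · exact h0
      · exact h3
      · exact h1
  · rw [insertAt_root]
    unfold insertRoot
    split_ifs with hk0
    · subst hk0
      rfl
    · change r = N.root
      rw [hr, if_neg hk0]

end HasTwoGon

theorem IsNPM.hasTwoGon [Finite D] {N : MarkedMap d D} {K : Plaquette d → ℕ}
    {π₁ π₂ : List (LatticeEdge d)} {e : LatticeEdge d}
    (h : N.IsNPM (π₁ ++ e :: e.symm :: π₂) K) (h2 : N.IsTwoGonAt π₁.length) :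
    N.HasTwoGon π₁.length := by
  obtain ⟨h3, h4⟩ := (isTwoGonAt_iff (edge_bdry_left h) (edge_bdry_right h)).1 h2
  refine ⟨bdry_ne (edge_bdry_left h) (edge_bdry_right h), h3, ?_⟩
  rw [N.degree_face] at h4
  rw [← h3]
  have h5 : N.next^[2] (N.inner π₁.length) = N.inner π₁.length := by
    rw [← h4]
    exact Function.iterate_minimalPeriod
  exact h5

end MarkedMap

namespace MarkedMap

variable {D D' : Type}

/-! ### Isomorphism classes of maps on arbitrary finite sets of darts -/

/-- Transport of a map along a bijection. -/
def relabel (M : MarkedMap d D) (g : D ≃ D') : MarkedMap d D' where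
  rev := g.permCongr M.rev
  next := g.permCongr M.next
  rev_rev y := by simp [M.rev_rev]
  rev_ne y h := M.rev_ne (g.symm y) (by
    rw [Equiv.permCongr_apply, ← Equiv.eq_symm_apply] at h
    exact h)
  yellow := {y | g.symm y ∈ M.yellow}
  yellow_next y := by simp [M.yellow_next]
  yellow_rev y := by simp [M.yellow_rev]
  pos y := M.pos (g.symm y)
  pos_vertex y := by simp [M.pos_vertex]
  pos_adj y := by simpa using M.pos_adj (g.symm y)
  root := g M.root
  root_mem := by simpa using M.root_mem

/-- A map is isomorphic to its transport. -/
def relabelIso (M : MarkedMap d D) (g : D ≃ D') : M.Iso (M.relabel g) where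
  toEquiv := g
  map_rev x := by simp [relabel]
  map_next x := by simp [relabel]
  map_yellow x := by simp [relabel]
  map_pos x := by simp [relabel]
  map_root := rfl

/-- The isomorphism class of a finite map. -/
noncomputable def toClass (M : MarkedMap d D) [Finite D] : MapClass d :=
  Quotient.mk (mapSetoid d) ⟨Nat.card D, M.relabel (Finite.equivFin D)⟩

variable (M : MarkedMap d D) [Finite D] (N : MarkedMap d D') [Finite D']

theorem toClass_eq_mk_iff {P : Σ n : ℕ, MarkedMap d (Fin n)} :
    M.toClass = Quotient.mk (mapSetoid d) P ↔ Nonempty (M.Iso P.2) := by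
  constructor
  · intro h
    obtain ⟨f⟩ : Nonempty ((M.relabel (Finite.equivFin D)).Iso P.2) := Quotient.exact h
    exact ⟨(M.relabelIso _).trans f⟩
  · rintro ⟨f⟩
    exact Quotient.sound ⟨(M.relabelIso _).symm.trans f⟩

theorem toClass_eq_iff : M.toClass = N.toClass ↔ Nonempty (M.Iso N) := by
  unfold toClass
  rw [← toClass, toClass_eq_mk_iff]
  exact ⟨fun ⟨f⟩ => ⟨f.trans (N.relabelIso _).symm⟩, fun ⟨f⟩ => ⟨f.trans (N.relabelIso _)⟩⟩

theorem area_toClass : M.toClass.area = M.area := (M.relabelIso _).area_eq.symm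

theorem weight_toClass : M.toClass.weight = M.weight := (M.relabelIso _).weight_eq.symm

variable {M} in
theorem IsNPM.toClass_mem {l : List (LatticeEdge d)} {K : Plaquette d → ℕ} (h : M.IsNPM l K)
    (hbal : IsBalanced l K) : M.toClass ∈ NPM l K :=
  (mk_mem_NPM hbal).2 ((M.relabelIso _).isNPM h)

variable {M} in
theorem IsNPM.toClass_mem_twoGon {l : List (LatticeEdge d)} {K : Plaquette d → ℕ} {k : ℕ}
    (h : M.IsNPM l K) (h' : M.IsTwoGonAt k) (hbal : IsBalanced l K) :
    M.toClass ∈ NPMTwoGon l K k :=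
  (mk_mem_NPMTwoGon hbal).2 ⟨(M.relabelIso _).isNPM h, (M.relabelIso _).isTwoGonAt h'⟩

/-! ### The map consisting of one two-gon -/

/-- The map whose faces are one two-gon, sent to `e`, and the external face. -/
def twoGonMap (e : LatticeEdge d) : MarkedMap d TwoGonDart where
  rev := twoGonRev
  next := twoGonNext
  rev_rev := by decide
  rev_ne := by decide
  yellow := {q | q.2 = true}
  yellow_next q := Iff.rfl
  yellow_rev q := by simp [twoGonRev]
  pos q := if q.1 = q.2 then e.snd else e.fst
  pos_vertex := by
    rintro ⟨_ | _, _ | _⟩ <;> rfl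
  pos_adj := by
    rintro ⟨_ | _, _ | _⟩
    · exact e.adj.symm
    · exact e.adj
    · exact e.adj
    · exact e.adj.symm
  root := (false, true)
  root_mem := rfl

section TwoGonMap

variable (e : LatticeEdge d)

theorem twoGonMap_face_iff {q q' : TwoGonDart} :
    (twoGonMap e).face q = (twoGonMap e).face q' ↔ q.2 = q'.2 := by
  rw [CombMap.face_eq_iff]
  have : ∀ q q', twoGonNext.SameCycle q q' ↔ q.2 = q'.2 := by decide
  exact this q q'

theorem twoGonMap_edge_second : (twoGonMap e).edge (true, true) = e.symm := rfl

theorem twoGonMap_edge (q : TwoGonDart) : ((twoGonMap e).edge q).edge = e.edge := by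
  have h : ∀ i, ((twoGonMap e).edge (i, true)).edge = e.edge := by
    rintro (_ | _)
    · rfl
    · rw [twoGonMap_edge_second, SimpleGraph.Dart.edge_symm]
  obtain ⟨i, _ | _⟩ := q
  · rw [← h i, ← edge_rev_edge _ (i, true)]
    rfl
  · exact h i

theorem twoGonMap_not_internal (f : (twoGonMap e).Face) : ¬ (twoGonMap e).IsInternalYellow f := by
  obtain ⟨q, rfl⟩ := (twoGonMap e).exists_face f
  rw [isInternalYellow_face]
  rintro ⟨h1, h2⟩
  exact h1 ((twoGonMap_face_iff e).2 h2)

theorem area_twoGonMap : (twoGonMap e).area = 0 := by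
  have : IsEmpty {f : (twoGonMap e).Face // (twoGonMap e).IsInternalYellow f} :=
    ⟨fun f => twoGonMap_not_internal e f.1 f.2⟩
  exact Nat.card_of_isEmpty

theorem weight_twoGonMap : (twoGonMap e).weight = 1 := by
  have h : {f : (twoGonMap e).Face | (twoGonMap e).IsBlue f} =
      {(twoGonMap e).face (false, false)} := by
    ext f
    obtain ⟨⟨i, j⟩, rfl⟩ := (twoGonMap e).exists_face f
    rw [Set.mem_ofPred_eq, isBlue_face, Set.mem_singleton_iff, twoGonMap_face_iff]
    exact Bool.not_eq_true j ▸ Iff.rfl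
  have h2 : {q : TwoGonDart | (twoGonMap e).face q = (twoGonMap e).face (false, false)} =
      {(false, false), (true, false)} := by
    ext ⟨i, j⟩
    rw [Set.mem_ofPred_eq, twoGonMap_face_iff]
    cases i <;> simp
  have h3 : (twoGonMap e).degree ((twoGonMap e).face (false, false)) = 2 := by
    change {q : TwoGonDart | (twoGonMap e).face q = (twoGonMap e).face (false, false)}.ncard = 2
    rw [h2, Set.ncard_pair (by simp)]
  rw [weight_eq_finprod, h, finprod_mem_singleton, h3]
  simp [faceWeight, catalanWeight]

/-- This map accounts for the value 1 of the null loop when the backtrack is the whole loop. -/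
theorem isNPM_twoGonMap : (twoGonMap e).IsNPM [e, e.symm] 0 := by
  have hB : (twoGonMap e).BlueCollapse := fun x _ y _ => by
    rw [twoGonMap_edge, twoGonMap_edge]
  refine ⟨?_, ?_, ⟨?_, hB⟩, ?_, ?_, ?_⟩
  · rw [CombMap.isConnected_iff]
    intro T hr hn
    have h1 : ∀ q, q ∈ T ↔ (false, true) ∈ T := by
      rintro ⟨_ | _, _ | _⟩
      · exact hr (false, true)
      · rfl
      · exact (hr (true, true)).trans (hn (false, true))
      · exact hn (false, true)
    intro x y hx
    exact (h1 y).2 ((h1 x).1 hx)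
  · rw [CombMap.eulerChar_eq]
    change (numCycles (twoGonNext * twoGonRev) : ℤ) - numCycles twoGonRev + numCycles twoGonNext = 2
    rw [numCycles_twoGonNext, numCycles_twoGonRev, numCycles_twoGonVertex]
    norm_num
  · intro x hx hx'
    exact absurd ((twoGonMap_face_iff e (q := x) (q' := (false, true))).2 hx) hx'
  · intro p
    have : IsEmpty {f : (twoGonMap e).Face // (twoGonMap e).IsSentToPlaquette f p} :=
      ⟨fun f => twoGonMap_not_internal e f.1 f.2.1⟩
    exact Nat.card_of_isEmpty
  · have h := iterate_of_cycle (f := (twoGonMap e).next) (s := fun i => if i = 0 then (false, true)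
      else (true, true)) (n := 2) (by omega) ?_ rfl ?_
    · unfold faceWord
      change List.map _ (List.range (Function.minimalPeriod (twoGonMap e).next (false, true))) = _
      have h1 : Function.minimalPeriod (twoGonMap e).next (false, true) = 2 := h.1
      rw [h1]
      rfl
    · intro i hi
      obtain rfl : i = 0 := by omega
      rfl
    · intro i hi hi'
      obtain rfl : i = 1 := by omega
      simp
  · rw [hB.isNonSeparable_iff]
    intro e' _ T hn hr
    have h1 : (true, true) ∈ T ↔ (false, true) ∈ T := hn (false, true) (Or.inl rfl)
    have h2 : ∀ q, (twoGonMap e).Live e' q → (q ∈ T ↔ (false, true) ∈ T) := by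
      rintro ⟨_ | _, _ | _⟩ hq
      · exact hr (false, true) (Or.inl rfl) hq
      · rfl
      · exact (hr (true, true) (Or.inl rfl) hq).trans h1
      · exact h1
    intro x y hx hy hxT
    exact (h2 y hy).2 ((h2 x hx).1 hxT)

theorem isTwoGonAt_twoGonMap : (twoGonMap e).IsTwoGonAt 0 := by
  refine (isTwoGonAt_iff (k := 0) (edge_bdry_left (π₁ := []) (π₂ := []) (isNPM_twoGonMap e))
    (edge_bdry_right (π₁ := []) (π₂ := []) (isNPM_twoGonMap e))).2 ⟨rfl, ?_⟩
  have h2 : {q : TwoGonDart | (twoGonMap e).face q = (twoGonMap e).face ((twoGonMap e).inner 0)} =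
      {(false, false), (true, false)} := by
    ext ⟨i, j⟩
    rw [Set.mem_ofPred_eq, twoGonMap_face_iff]
    change j = false ↔ _
    cases i <;> simp
  change {q : TwoGonDart | (twoGonMap e).face q =
    (twoGonMap e).face ((twoGonMap e).inner 0)}.ncard = 2
  rw [h2, Set.ncard_pair (by simp)]

variable {e}

omit [Finite D] in
/-- A map with boundary `e e⁻¹` in which both edges bound a two-gon has no other faces. -/
theorem HasTwoGon.iso_twoGonMap {N : MarkedMap d D} {K : Plaquette d → ℕ} (h : N.HasTwoGon 0)
    (hN : N.IsNPM [e, e.symm] K) : Nonempty ((twoGonMap e).Iso N) := by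
  have he : N.edge (N.bdry 0) = e := edge_bdry_left (π₁ := []) (π₂ := []) hN
  have he' : N.edge (N.bdry 1) = e.symm := edge_bdry_right (π₁ := []) (π₂ := []) hN
  have hper : N.next (N.bdry 1) = N.bdry 0 := by
    rw [← bdry_succ, bdry_zero]
    have := N.bdry_period
    rwa [hN.period] at this
  have hnext : ∀ q, N.next (N.twoGonDart 0 q) = N.twoGonDart 0 (twoGonNext q) := by
    rintro ⟨_ | _, _ | _⟩
    · exact h.next_far
    · exact (N.bdry_succ 0).symm
    · exact h.free
    · exact hper
  have hsurj : Function.Surjective (N.twoGonDart 0) := by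
    intro y
    -- With a boundary of length two the four darts of the 2-gon are closed under both rotations, so
    -- connectedness leaves no other dart.
    refine N.isConnected_iff.1 hN.connected (Set.range (N.twoGonDart 0)) ?_ ?_ (N.bdry 0) y
      ⟨(false, true), rfl⟩
    · exact fun x => not_iff_not.1 (mem_range_iff_of_commute (rev_twoGonDart N 0) x)
    · exact fun x => not_iff_not.1 (mem_range_iff_of_commute hnext x)
  refine ⟨⟨Equiv.ofBijective (N.twoGonDart 0) ⟨h.injective, hsurj⟩,
    fun q => (rev_twoGonDart N 0 q).symm, fun q => (hnext q).symm, ?_, ?_, rfl⟩⟩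
  · rintro ⟨i, _ | _⟩
    · exact iff_of_false (N.rev_notMem (N.bdry_mem _)) Bool.false_ne_true
    · exact iff_of_true (N.bdry_mem _) rfl
  · have h1 : N.pos (N.bdry 1) = e.snd := by
      rw [← N.edge_fst, he']
      rfl
    have h3 : N.pos (N.rev (N.bdry 1)) = e.fst := by
      rw [← N.edge_snd, he']
      rfl
    rintro ⟨_ | _, _ | _⟩
    · exact congrArg (fun e : LatticeEdge d => e.snd) he
    · exact congrArg (fun e : LatticeEdge d => e.fst) he
    · exact h3
    · exact h1

end TwoGonMap

end MarkedMap

/-- A map that represents a class. -/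
noncomputable def MapClass.rep (c : MapClass d) : Σ n : ℕ, MarkedMap d (Fin n) := Quotient.out c

theorem MapClass.mk_rep (c : MapClass d) : Quotient.mk (mapSetoid d) c.rep = c := Quotient.out_eq c

/-! ### Erasure of a backtrack -/

section Erasure

variable {K : Plaquette d → ℕ} {π₁ π₂ : List (LatticeEdge d)} {e : LatticeEdge d}

/-- The erased edges contribute equally to the counts of `f` and of `f.symm`, since one of them is
the reversal of the other. -/
theorem IsBalanced.erase (h : IsBalanced (π₁ ++ e :: e.symm :: π₂) K) :
    IsBalanced (π₁ ++ π₂) K := by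
  classical
  intro f
  have h1 := h f
  unfold edgeCount at h1 ⊢
  simp only [List.count_append, List.count_cons, beq_iff_eq] at h1 ⊢
  have h2 : (e = f) ↔ (e.symm = f.symm) :=
    (SimpleGraph.Dart.symm_involutive (G := latticeGraph d)).injective.eq_iff.symm
  have h3 : (e.symm = f) ↔ (e = f.symm) := by
    rw [← (SimpleGraph.Dart.symm_involutive (G := latticeGraph d)).injective.eq_iff,
      SimpleGraph.Dart.symm_symm]
  simp only [h2, h3] at h1
  omega

/-- The 2-gon fits into the corner because `e` starts there: rotating the loop puts `π₂π₁` right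
after `e⁻¹`, so its first edge starts where `e⁻¹` ends. -/
theorem pos_bdry_of_isLoop (hloop : IsLoop (π₁ ++ e :: e.symm :: π₂)) (hne : π₁ ++ π₂ ≠ [])
    {D : Type} [Finite D] {M : MarkedMap d D} (h : M.IsNPM (π₁ ++ π₂) K) :
    e.fst = M.pos (M.bdry π₁.length) := by
  obtain ⟨f, t, hft⟩ : ∃ f t, π₂ ++ π₁ = f :: t := by
    refine List.exists_cons_of_ne_nil fun hh => hne ?_
    rw [List.append_eq_nil_iff] at hh ⊢
    exact hh.symm
  have h1 : e.fst = f.fst := by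
    have hrot : ((π₁ ++ e :: e.symm :: π₂ : List (LatticeEdge d)) : Cycle (LatticeEdge d)) =
        ((e.symm :: ((π₂ ++ π₁) ++ [e]) : List (LatticeEdge d)) : Cycle (LatticeEdge d)) := by
      rw [Cycle.coe_eq_coe]
      have := List.isRotated_append (l := π₁ ++ [e]) (l' := e.symm :: π₂)
      simpa using this
    unfold IsLoop at hloop
    rw [hrot, Cycle.chain_coe_cons, hft] at hloop
    have h2 : (latticeGraph d).DartAdj e.symm f := by
      simp only [List.cons_append, List.isChain_cons_cons] at hloop
      exact hloop.1
    exact h2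
  rw [h1, ← M.edge_fst]
  congr 2
  rcases π₂ with _ | ⟨g, π₂⟩
  -- With `π₂` empty, the edge following the backtrack cyclically is the first edge of `π₁`, and the
  -- boundary number wraps around to 0.
  · have h2 : π₁ = f :: t := hft
    have h3 : M.bdry π₁.length = M.bdry 0 := by
      have := M.bdry_period
      rw [h.period, List.append_nil] at this
      exact this
    rw [h3, h.edge_bdry (by simp [h2])]
    simp [h2]
  · have h2 : g = f := (List.cons.inj hft).1
    rw [h.edge_bdry (by simp)]
    simp [h2]

-- The bijection is built backwards, by inserting a 2-gon into a representative. It is injective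
-- because the inserted 2-gon can be located by its boundary numbers, and surjective because every
-- 2-gon can be removed.
open MarkedMap in
theorem exists_equiv (hloop : IsLoop (π₁ ++ e :: e.symm :: π₂))
    (hbal : IsBalanced (π₁ ++ e :: e.symm :: π₂) K) (hne : π₁ ++ π₂ ≠ []) :
    ∃ f : NPMTwoGon (π₁ ++ e :: e.symm :: π₂) K π₁.length ≃ NPM (π₁ ++ π₂) K,
      ∀ c, (f c).1.area = c.1.area ∧ (f c).1.weight = c.1.weight := by
  have hbal' := hbal.erase
  have hrep : ∀ c : NPM (π₁ ++ π₂) K, c.1.rep.2.IsNPM (π₁ ++ π₂) K := fun c => by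
    rw [← mk_mem_NPM hbal', MapClass.mk_rep]
    exact c.2
  have hpos : ∀ c : NPM (π₁ ++ π₂) K, e.fst = c.1.rep.2.pos (c.1.rep.2.bdry π₁.length) :=
    fun c => pos_bdry_of_isLoop hloop hne (hrep c)
  have hlen : ∀ {D : Type} {M : MarkedMap d D}, M.IsNPM (π₁ ++ π₂) K →
      π₁.length ≤ Function.minimalPeriod M.next M.root := fun h => by
    rw [h.period, List.length_append]
    omega
  let g : NPM (π₁ ++ π₂) K → NPMTwoGon (π₁ ++ e :: e.symm :: π₂) K π₁.length := fun c =>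
    ⟨(c.1.rep.2.insertAt π₁.length e (hpos c)).toClass,
      ((isNPM_insertAt_iff _ (hpos c) (hlen (hrep c))).2 (hrep c)).toClass_mem_twoGon
        (isTwoGonAt_insertAt _ _ (hlen (hrep c))) hbal⟩
  have hg : Function.Bijective g := by
    constructor
    · intro c c' hcc
      obtain ⟨f⟩ := (toClass_eq_iff _ _).1 (congrArg Subtype.val hcc)
      have h1 := iso_of_insertAt (hlen (hrep c)) (hlen (hrep c')) f
      apply Subtype.ext
      rw [← c.1.mk_rep, ← c'.1.mk_rep]
      exact Quotient.sound h1
    · rintro ⟨c, hc⟩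
      obtain ⟨-, N, rfl, hN, h2⟩ := id hc
      have hlen1 := List.length_pos_iff.2 hne
      have hlen2 := hN.period
      simp only [List.length_append, List.length_cons] at hlen1 hlen2
      obtain ⟨D, hD, M, hM, hk, ⟨f⟩⟩ := (hN.hasTwoGon h2).exists_insertAt (by omega)
        (by omega) (edge_bdry_left hN) (edge_bdry_right hN)
      have hMN : M.IsNPM (π₁ ++ π₂) K := (isNPM_insertAt_iff M hM hk).1 (f.symm.isNPM hN)
      refine ⟨⟨M.toClass, hMN.toClass_mem hbal'⟩, ?_⟩
      apply Subtype.ext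
      obtain ⟨f'⟩ : Nonempty (M.Iso M.toClass.rep.2) := by
        rw [← toClass_eq_mk_iff, MapClass.mk_rep]
      refine (toClass_eq_mk_iff _).2 ⟨Iso.trans ?_ f⟩
      exact (f'.insertAt hM (hpos ⟨M.toClass, hMN.toClass_mem hbal'⟩)).symm
  refine ⟨(Equiv.ofBijective g hg).symm, fun c => ?_⟩
  obtain ⟨c, rfl⟩ := hg.2 c
  have h1 : (Equiv.ofBijective g hg).symm (g c) = c := (Equiv.ofBijective g hg).symm_apply_apply c
  rw [h1]
  have h2 : c.1 = Quotient.mk (mapSetoid d) c.1.rep := c.1.mk_rep.symm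
  have h3 : c.1.area = c.1.rep.2.area := by
    conv_lhs => rw [h2]
    rfl
  have h4 : c.1.weight = c.1.rep.2.weight := by
    conv_lhs => rw [h2]
    rfl
  refine ⟨?_, ?_⟩
  · rw [h3]
    exact ((area_toClass _).trans (sameYellow_insertAt _ _).area_eq).symm
  · rw [h4]
    exact ((weight_toClass _).trans (weight_insert _ _ _ _)).symm

theorem phi_eq_finsum_twoGon (β : ℝ) (hbal : IsBalanced (π₁ ++ e :: e.symm :: π₂) K) :
    phi β K (π₁ ++ e :: e.symm :: π₂) =
      ∑ᶠ c ∈ NPMTwoGon (π₁ ++ e :: e.symm :: π₂) K π₁.length, β ^ c.area * c.weight := by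
  unfold phi
  rw [if_neg (by simp), ← finsum_mem_add_sdiff NPMTwoGon_subset (NPM_finite _ _),
    sum_weight_eq_zero β hbal, add_zero]

/-- The 2-gon is the entire map and has no internal yellow face, which forces `K = 0`. -/
theorem NPMTwoGon_pair (hbal : IsBalanced [e, e.symm] K) :
    NPMTwoGon [e, e.symm] K 0 = {c | K = 0 ∧ c = (MarkedMap.twoGonMap e).toClass} := by
  ext c
  constructor
  · rintro ⟨-, N, rfl, hN, h2⟩
    have h : N.2.HasTwoGon 0 := MarkedMap.IsNPM.hasTwoGon (π₁ := []) (π₂ := []) hN h2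
    obtain ⟨f⟩ := h.iso_twoGonMap hN
    refine ⟨?_, ((MarkedMap.toClass_eq_mk_iff _).2 ⟨f⟩).symm⟩
    funext p
    rw [← hN.plaquettes p, (f.isNPM (MarkedMap.isNPM_twoGonMap e)).plaquettes p]
  · rintro ⟨rfl, rfl⟩
    exact (MarkedMap.isNPM_twoGonMap e).toClass_mem_twoGon (MarkedMap.isTwoGonAt_twoGonMap e) hbal

theorem phi_erase (β : ℝ) (hloop : IsLoop (π₁ ++ e :: e.symm :: π₂))
    (hbal : IsBalanced (π₁ ++ e :: e.symm :: π₂) K) :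
    phi β K (π₁ ++ e :: e.symm :: π₂) = phi β K (π₁ ++ π₂) := by
  rw [phi_eq_finsum_twoGon β hbal]
  by_cases hne : π₁ ++ π₂ = []
  · obtain ⟨rfl, rfl⟩ := List.append_eq_nil_iff.1 hne
    change ∑ᶠ c ∈ NPMTwoGon [e, e.symm] K 0, _ = phi β K []
    rw [NPMTwoGon_pair hbal]
    unfold phi
    rw [if_pos rfl]
    by_cases hK : K = 0
    · rw [if_pos hK]
      simp only [hK, true_and]
      rw [show {c | c = (MarkedMap.twoGonMap e).toClass} = {(MarkedMap.twoGonMap e).toClass} from rfl,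
        finsum_mem_singleton, MarkedMap.area_toClass, MarkedMap.weight_toClass,
        MarkedMap.area_twoGonMap, MarkedMap.weight_twoGonMap]
      simp
    · rw [if_neg hK]
      simp [hK]
  · obtain ⟨f, hf⟩ := exists_equiv hloop hbal hne
    unfold phi
    rw [if_neg hne, ← finsum_set_coe_eq_finsum_mem, ← finsum_set_coe_eq_finsum_mem]
    refine finsum_eq_of_bijective f f.bijective fun c => ?_
    rw [(hf c).1, (hf c).2]

end Erasure

end SurfaceSum

theorem lemma4p2 (d : ℕ) (β : ℝ) (K : SurfaceSum.Plaquette d → ℕ)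
    (π₁ π₂ : List (SurfaceSum.LatticeEdge d)) (e : SurfaceSum.LatticeEdge d)
    (hloop : SurfaceSum.IsLoop (π₁ ++ e :: e.symm :: π₂))
    (hbal : SurfaceSum.IsBalanced (π₁ ++ e :: e.symm :: π₂) K) :
    -- the sums defining both sides are finite sums
    (SurfaceSum.NPM (π₁ ++ e :: e.symm :: π₂) K).Finite ∧
    (SurfaceSum.NPM (π₁ ++ π₂) K).Finite ∧
    -- backtrack erasure
    SurfaceSum.phi β K (π₁ ++ e :: e.symm :: π₂) = SurfaceSum.phi β K (π₁ ++ π₂) ∧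
    -- maps with the backtrack in a blue 2-gon correspond to maps with the shorter boundary
    (π₁ ++ π₂ ≠ [] →
      ∃ f : SurfaceSum.NPMTwoGon (π₁ ++ e :: e.symm :: π₂) K π₁.length ≃
          SurfaceSum.NPM (π₁ ++ π₂) K,
        ∀ c, (f c).1.area = c.1.area ∧ (f c).1.weight = c.1.weight) ∧
    -- the weights of all other maps cancel
    ∑ᶠ c ∈ SurfaceSum.NPM (π₁ ++ e :: e.symm :: π₂) K \
        SurfaceSum.NPMTwoGon (π₁ ++ e :: e.symm :: π₂) K π₁.length,
      c.weight = 0 := by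
  refine ⟨SurfaceSum.NPM_finite _ _, SurfaceSum.NPM_finite _ _, SurfaceSum.phi_erase β hloop hbal,
    SurfaceSum.exists_equiv hloop hbal, ?_⟩
  -- At β = 1 the area factor disappears and the plain weights remain.
  simpa using SurfaceSum.sum_weight_eq_zero 1 hbal
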